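/- Let $k\ge 2$ and $n>2k$ be integers. Let $(\mathbb H^n,\ b=dr^2+\sinh^2 r\,d\Theta^2)$ be hyperbolic space, with $r$ the distance to a fixed point $x_0$, put $V=\cosh r$, and denote by $\bar\nabla$, $|\cdot|$, $\|\cdot\|_b$ the covariant derivative and norms of $b$. **Definitions.** For a Riemannian metric $g$ let $\tilde R_{ijsl}=R_{ijsl}+g_{is}g_{jl}-g_{il}g_{js}$ (with $R_{ijij}>0$ on round spheres), let $\delta^{i_1\dots i_m}_{j_1\dots j_m}=\det(\delta^{i_a}_{j_b})$ be the generalized Kronecker delta, and $$\tilde L_k=\tfrac1{2^k}\,\delta^{i_1\dots i_{2k}}_{j_1\dots j_{2k}}\tilde R_{i_1i_2}{}^{j_1j_2}\cdots\tilde R_{i_{2k-1}i_{2k}}{}^{j_{2k-1}j_{2k}},$$ $$\tilde P_{(k)}^{stjl}=\tfrac1{2^k}\,\delta^{i_1\dots i_{2k-2}st}_{j_1\dots j_{2k-2}pq}\tilde R_{i_1i_2}{}^{j_1j_2}\cdots\tilde R_{i_{2k-3}i_{2k-2}}{}^{j_{2k-3}j_{2k-2}}g^{pj}g^{ql}.$$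 A metric $g$ defined outside a bounded set of $\mathbb H^n$ is asymptotically hyperbolic of decay order $\tau$ (with the identity as chart at infinity) if, outside some ball, $g$ and $b$ are uniformly equivalent and $\|g-b\|_b+\|\bar\nabla g\|_b+\|\bar\nabla^2g\|_b=O(e^{-\tau r})$. With $e=g-b$, $S_r$ the geodesic sphere of radius $r$ about $x_0$ and $\nu$ its outward $b$-unit normal, put $$H_k(W)=\lim_{r\to\infty}\int_{S_r}\big(W\bar\nabla_l e_{js}-e_{js}\bar\nabla_lW\big)\tilde P_{(k)}^{ijsl}\,\nu_i\,d\mu,\qquad m_k^{\mathbb H}=c(n,k)\inf_{W\in\mathbb N_b^1}H_k(W),$$ where $c(n,k)=\frac{(n-2k)!}{2^{k-1}(n-1)!\,\omega_{n-1}}$, $\omega_{n-1}=|\mathbb S^{n-1}|$, and $\mathbb N_b^1$ is the set of positive $W\in C^\infty(\mathbb H^n)$ with $\mathrm{Hess}^bW=Wb$ and $\eta(W,W)=1$; here $\eta$ is the Lorentz inner product of signature $(+,-,\dots,-)$ for which $\cosh r,\ x^1\sinh r,\dots,x^n\sinh r$ is an orthonormal basis of $\{W:\mathrm{Hess}^bW=Wb\}$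 ($x^i$ being the coordinate functions on $\mathbb S^{n-1}$). **Theorem.** Let $\Omega\subset\mathbb H^n$ be a bounded open set with smooth boundary $\Sigma=\partial\Omega$, given as $\Omega=\{\rho<0\}$ with $\rho\in C^\infty(\mathbb H^n)$ and $d\rho\ne0$ on $\{\rho=0\}$. Let $f:\mathbb H^n\setminus\Omega\to\mathbb R$ be continuous, and smooth on $\mathbb H^n\setminus\overline\Omega$, such that the graph of $f$ is smooth up to its boundary (near every $(p,f(p))$, $p\in\Sigma$, it is contained in a smooth embedded hypersurface of $\mathbb H^n\times\mathbb R$), each connected component of $\Sigma$ lies in a level set of $f$, and $|\bar\nabla f(x)|\to\infty$ as $x\to\Sigma$. Let $(\mathcal M^n,g)=(\mathbb H^n\setminus\Omega,\ b+V^2df\otimes df)$ be asymptotically hyperbolic of decay order $\tau>\frac n{k+1}$, with $V\tilde L_k$ integrable over $(\mathcal M^n,g)$. Then the limit defining $H_k(V)$ exists, the two integrals below converge, and $$c(n,k)\,H_k(V)=c(n,k)\left(\frac12\int_{\mathcal M}\frac{V\tilde L_k}{\sqrt{1+V^2|\bar\nabla f|^2}}\,dV_g+\frac{(2k-1)!}{2}\int_\Sigma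 V\sigma_{2k-1}\,d\mu\right),$$ where $\sigma_{2k-1}$ is the $(2k-1)$-th elementary symmetric function of the principal curvatures of $\Sigma$ in $(\mathbb H^n,b)$ with respect to the normal pointing out of $\Omega$ (positive for balls) and $d\mu$ is the area element of $b$. Consequently, if the infimum defining $m_k^{\mathbb H}$ is attained at $V=\cosh r$, then $$m_k^{\mathbb H}=c(n,k)\left(\frac12\int_{\mathcal M}\frac{V\tilde L_k}{\sqrt{1+V^2|\bar\nabla f|^2}}\,dV_g+\frac{(2k-1)!}{2}\int_\Sigma V\sigma_{2k-1}\,d\mu\right).$$ -/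

import Mathlib

open Real Set Filter Topology MeasureTheory
open scoped ContDiff

namespace GBCMass

noncomputable section

/-! ### Tensor calculus in global coordinates

All manifolds below are (subsets of) hyperbolic space, which carries one global chart.
A metric is given by its coefficient matrix, a covariant tensor field by its coefficients, and
curvature and covariant derivatives by the classical coordinate formulas. -/

/-- The underlying manifold `ℝⁿ` of hyperbolic space `ℍⁿ`, in the global coordinates in which the
point at hyperbolic distance `r` from the base point `x₀ = 0` in the direction `θ ∈ 𝕊ⁿ⁻¹` is
`x = (sinh r) θ`. The hyperbolic metric is `hypMetric` below. -/
abbrev H (n : ℕ) : Type := EuclideanSpace ℝ (Fin n)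

/-- A (0,2)-tensor field `x ↦ (g_{ij}(x))`. -/
abbrev MetricField (n : ℕ) : Type := H n → Matrix (Fin n) (Fin n) ℝ

/-- A covariant tensor field of rank `m`. -/
abbrev CovTensor (n m : ℕ) : Type := H n → (Fin m → Fin n) → ℝ

/-- The coordinate partial derivative `∂_i F`. -/
def pd {n : ℕ} (i : Fin n) (F : H n → ℝ) (x : H n) : ℝ :=
  fderiv ℝ F x (EuclideanSpace.single i (1 : ℝ))

/-- The Christoffel symbols `Γ^l_{ij}` of the Levi-Civita connection of `g`. -/
def christoffel {n : ℕ} (g : MetricField n) (l i j : Fin n) (x : H n) : ℝ :=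
  (1 / 2) * ∑ m, (g x)⁻¹ l m *
    (pd i (fun y => g y m j) x + pd j (fun y => g y m i) x - pd m (fun y => g y i j) x)

/-- A (0,2)-tensor field as a covariant tensor of rank 2. -/
def ofMatrix {n : ℕ} (T : MetricField n) : CovTensor n 2 := fun x I => T x (I 0) (I 1)

/-- The covariant derivative of a covariant tensor field with respect to `g`; the differentiation
index comes first: `(covDeriv g T)_{l i₁ … i_m} = ∇_l T_{i₁ … i_m}`. -/
def covDeriv {n m : ℕ} (g : MetricField n) (T : CovTensor n m) : CovTensor n (m + 1) :=
  fun x I => pd (I 0) (fun y => T y (Fin.tail I)) x -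
    ∑ a : Fin m, ∑ l : Fin n,
      christoffel g l (I 0) (I a.succ) x * T x (Function.update (Fin.tail I) a l)

/-- The pointwise norm `‖T‖_g` of a covariant tensor. -/
def tensorNorm {n m : ℕ} (g : MetricField n) (T : CovTensor n m) (x : H n) : ℝ :=
  √(∑ I : Fin m → Fin n, ∑ J : Fin m → Fin n, (∏ a, (g x)⁻¹ (I a) (J a)) * T x I * T x J)

/-- The Hessian `∇_i∇_j F` with respect to `g`. -/
def hess {n : ℕ} (g : MetricField n) (F : H n → ℝ) (x : H n) (i j : Fin n) : ℝ :=
  pd i (pd j F) x - ∑ l, christoffel g l i j x * pd l F x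

/-- The gradient `∇^i F = g^{ij} ∂_j F` with respect to `g`. -/
def grad {n : ℕ} (g : MetricField n) (F : H n → ℝ) (x : H n) (i : Fin n) : ℝ :=
  ∑ j, (g x)⁻¹ i j * pd j F x

/-- `|∇F|²_g = g^{ij} ∂_i F ∂_j F`. -/
def gradSq {n : ℕ} (g : MetricField n) (F : H n → ℝ) (x : H n) : ℝ :=
  ∑ i, ∑ j, (g x)⁻¹ i j * pd i F x * pd j F x

/-- The curvature tensor `R_{ij}{}^s{}_l`, i.e. `R(∂_i, ∂_j) ∂_l = R_{ij}{}^s{}_l ∂_s`; thus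
`R_{ijij} = g(R(∂_i, ∂_j) ∂_j, ∂_i)` is positive on round spheres. -/
def riem {n : ℕ} (g : MetricField n) (i j s l : Fin n) (x : H n) : ℝ :=
  pd i (christoffel g s j l) x - pd j (christoffel g s i l) x +
    ∑ m, (christoffel g s i m x * christoffel g m j l x -
      christoffel g s j m x * christoffel g m i l x)

/-- The modified curvature tensor `R̃_{ijsl} = R_{ijsl} + g_{is} g_{jl} - g_{il} g_{js}`, with the
last two indices raised: `R̃_{ij}{}^{sl}`. -/
def modRiem {n : ℕ} (g : MetricField n) (i j s l : Fin n) (x : H n) : ℝ :=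
  (∑ m, riem g i j s m x * (g x)⁻¹ m l) +
    ((if i = s then 1 else 0) * (if j = l then 1 else 0) -
      (if i = l then 1 else 0) * (if j = s then 1 else 0))

/-- The generalized Kronecker delta `δ^{i_1 … i_r}_{j_1 … j_r} = det (δ^{i_a}_{j_b})`, for
multi-indices over any finite index type. -/
def genDelta {n : ℕ} {ι : Type} [Fintype ι] [DecidableEq ι] (I J : ι → Fin n) : ℝ :=
  Matrix.det (Matrix.of fun a b : ι => if I a = J b then (1 : ℝ) else 0)

/-- The modified Gauss-Bonnet curvature
`L̃_k = 2^{-k} δ^{i_1 i_2 … i_{2k-1} i_{2k}}_{j_1 j_2 … j_{2k-1} j_{2k}}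
  R̃_{i_1 i_2}{}^{j_1 j_2} ⋯ R̃_{i_{2k-1} i_{2k}}{}^{j_{2k-1} j_{2k}}`.
The index `i_{2a+1}` is `I (a, 0)` and `i_{2a+2}` is `I (a, 1)`. -/
def modGaussBonnet {n : ℕ} (g : MetricField n) (k : ℕ) (x : H n) : ℝ :=
  (1 / 2 ^ k) * ∑ I : Fin k × Fin 2 → Fin n, ∑ J : Fin k × Fin 2 → Fin n,
    genDelta I J * ∏ a : Fin k, modRiem g (I (a, 0)) (I (a, 1)) (J (a, 0)) (J (a, 1)) x

/-- The tensor `P̃_{(k)}^{stjl} = 2^{-k} δ^{i_1 … i_{2k-2} s t}_{j_1 … j_{2k-2} p q}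
  R̃_{i_1 i_2}{}^{j_1 j_2} ⋯ R̃_{i_{2k-3} i_{2k-2}}{}^{j_{2k-3} j_{2k-2}} g^{pj} g^{ql}`. -/
def modP {n : ℕ} (g : MetricField n) (k : ℕ) (s t j l : Fin n) (x : H n) : ℝ :=
  (1 / 2 ^ k) * ∑ I : Fin (k - 1) × Fin 2 → Fin n, ∑ J : Fin (k - 1) × Fin 2 → Fin n,
    ∑ p : Fin n, ∑ q : Fin n,
      genDelta (Sum.elim I ![s, t]) (Sum.elim J ![p, q]) *
        (∏ a : Fin (k - 1), modRiem g (I (a, 0)) (I (a, 1)) (J (a, 0)) (J (a, 1)) x) *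
        (g x)⁻¹ p j * (g x)⁻¹ q l

/-! ### Hyperbolic space -/

/-- The hyperbolic distance `r` to the base point. -/
def hypRadius {n : ℕ} (x : H n) : ℝ := arsinh ‖x‖

/-- The function `V = V_{(0)} = cosh r`. -/
def V {n : ℕ} (x : H n) : ℝ := cosh (hypRadius x)

/-- The hyperbolic metric `b = dr² + sinh² r dΘ²`. In the coordinates `x = (sinh r) θ` it is
`b_{ij} = δ_{ij} - x_i x_j / (1 + |x|²)`. It is the metric induced from Minkowski space by the
parametrization `x ↦ (V x, x)` of the hyperboloid, see `hypMetric_eq_minkowski`. -/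
def hypMetric (n : ℕ) : MetricField n :=
  fun x => Matrix.of fun i j => (if i = j then 1 else 0) - x i * x j / (1 + ‖x‖ ^ 2)

lemma V_eq {n : ℕ} (x : H n) : V x = √(1 + ‖x‖ ^ 2) := cosh_arsinh ‖x‖

lemma V_sq {n : ℕ} (x : H n) : V x ^ 2 - ‖x‖ ^ 2 = 1 := by
  rw [V_eq, sq_sqrt (by positivity)]; ring

lemma hasFDerivAt_V {n : ℕ} (x : H n) :
    HasFDerivAt (V : H n → ℝ) ((1 / V x) • innerSL ℝ x) x := by
  have h0 : (V : H n → ℝ) = fun y => √(1 + ‖y‖ ^ 2) := funext V_eq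
  have h1 : HasFDerivAt (fun y : H n => 1 + ‖y‖ ^ 2) (2 • innerSL ℝ x) x :=
    (hasStrictFDerivAt_norm_sq x).hasFDerivAt.const_add 1
  have h2 := h1.sqrt (by positivity)
  rw [← h0, ← V_eq] at h2
  refine h2.congr_fderiv ?_
  ext v
  simp
  ring

lemma pd_V {n : ℕ} (i : Fin n) (x : H n) : pd i V x = x i / V x := by
  rw [pd, (hasFDerivAt_V x).fderiv]
  simp [EuclideanSpace.inner_single_right, div_eq_inv_mul]

/-- `b` is the pull-back of the Minkowski metric `-dy_0² + dy_1² + ⋯ + dy_n²` under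
`x ↦ (V x, x)`. -/
lemma hypMetric_eq_minkowski {n : ℕ} (x : H n) (i j : Fin n) :
    hypMetric n x i j = - pd i V x * pd j V x + (if i = j then 1 else 0) := by
  have h : V x ^ 2 = 1 + ‖x‖ ^ 2 := by linarith [V_sq x]
  have hV : V x ≠ 0 := (cosh_pos _).ne'
  rw [pd_V, pd_V, hypMetric, Matrix.of_apply, ← h]
  field_simp
  ring

/-- `ℕ_b = {W ∈ C^∞(ℍⁿ) | Hess^b W = W b}`. -/
def Nb (n : ℕ) : Set (H n → ℝ) :=
  {W | ContDiff ℝ ∞ W ∧ ∀ x i j, hess (hypMetric n) W x i j = W x * hypMetric n x i j}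

/-- The Lorentz inner product `η` on `ℕ_b`. It is the one for which the basis
`V_{(0)} = cosh r`, `V_{(i)} = x^i sinh r` (here: the coordinate functions) is orthonormal with
signature `(+, -, …, -)`: since `V_{(0)}` has value 1 and gradient 0 at the base point, while
`V_{(i)}` has value 0 and gradient the `i`-th unit vector there, the coefficients of `W` in this
basis are `W(0), ∂_1 W(0), …, ∂_n W(0)`. -/
def eta {n : ℕ} (U W : H n → ℝ) : ℝ := U 0 * W 0 - ∑ i, pd i U 0 * pd i W 0

lemma pd_coord {n : ℕ} (i j : Fin n) (x : H n) :
    pd i (fun y : H n => y j) x = if i = j then 1 else 0 := by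
  have : HasFDerivAt (fun y : H n => y j) (EuclideanSpace.proj j : H n →L[ℝ] ℝ) x :=
    (EuclideanSpace.proj j : H n →L[ℝ] ℝ).hasFDerivAt
  rw [pd, this.fderiv]
  simp [eq_comm]

lemma eta_V_V {n : ℕ} : eta (V : H n → ℝ) V = 1 := by
  simp [eta, pd_V, V_eq]

lemma eta_V_coord {n : ℕ} (i : Fin n) : eta (V : H n → ℝ) (fun y => y i) = 0 := by
  simp [eta, pd_V]

lemma eta_coord_coord {n : ℕ} (i j : Fin n) :
    eta (fun y : H n => y i) (fun y => y j) = if i = j then -1 else 0 := by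
  simp only [eta, pd_coord]
  split_ifs with h <;> simp [h, eq_comm]

/-- `ℕ_b^1`: the positive functions `W ∈ ℕ_b` with `η(W, W) = 1`. -/
def Nb1 (n : ℕ) : Set (H n → ℝ) := {W | W ∈ Nb n ∧ (∀ x, 0 < W x) ∧ eta W W = 1}

/-! ### Integration and hypersurfaces -/

/-- The integral `∫_S F dV_g` for the Riemannian volume `dV_g = √(det g) dx`. -/
def volumeIntegral {n : ℕ} (g : MetricField n) (S : Set (H n)) (F : H n → ℝ) : ℝ :=
  ∫ x in S, F x * √(g x).det

/-- Integrability of `F` over `S` with respect to `dV_g`. -/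
def VolumeIntegrable {n : ℕ} (g : MetricField n) (S : Set (H n)) (F : H n → ℝ) : Prop :=
  IntegrableOn (fun x => F x * √(g x).det) S

/-- The density, with respect to the Euclidean surface measure, of the area element `dμ` which
`g` induces on a level hypersurface of `u`:
`dμ_g = √(det g) (|du|_g / |du|_{eucl}) dμ_{eucl}`. -/
def areaDensity {n : ℕ} (g : MetricField n) (u : H n → ℝ) (x : H n) : ℝ :=
  √(g x).det * √(gradSq g u x) / √(∑ i, pd i u x ^ 2)

/-- The integral `∫_S F dμ` over a hypersurface `S` (a level set of `u`), for the area element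
`dμ` induced by `g`. -/
def surfaceIntegral {n : ℕ} (g : MetricField n) (u : H n → ℝ) (S : Set (H n))
    (F : H n → ℝ) : ℝ :=
  ∫ x in S, F x * areaDensity g u x ∂(μHE[n - 1] : Measure (H n))

/-- Integrability of `F` over the hypersurface `S` with respect to `dμ`. -/
def SurfaceIntegrable {n : ℕ} (g : MetricField n) (u : H n → ℝ) (S : Set (H n))
    (F : H n → ℝ) : Prop :=
  IntegrableOn (fun x => F x * areaDensity g u x) S (μHE[n - 1] : Measure (H n))

/-- The `g`-unit normal field `ν^i = ∇^i u / |∇u|_g` of the level sets of `u`, pointing towards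
larger values of `u`. -/
def unitNormal {n : ℕ} (g : MetricField n) (u : H n → ℝ) (x : H n) (i : Fin n) : ℝ :=
  grad g u x i / √(gradSq g u x)

/-- The Weingarten map `X ↦ ∇_X ν` of the level sets of `u`, as the matrix
`A^i_j = ∇_j ν^i = ∂_j ν^i + Γ^i_{jm} ν^m` on the full tangent space. It takes values in the
tangent space of the level set and restricts there to the shape operator with respect to `ν`. -/
def weingarten {n : ℕ} (g : MetricField n) (u : H n → ℝ) (x : H n) :
    Matrix (Fin n) (Fin n) ℝ :=
  Matrix.of fun i j => pd j (fun y => unitNormal g u y i) x +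
    ∑ m, christoffel g i j m x * unitNormal g u x m

/-- The `j`-th mean curvature `σ_j` of the level set of `u` through `x`, with respect to the
metric `g` and the normal `ν` (geodesic spheres with outward normal have positive `σ_j`): the
`j`-th elementary symmetric function of the principal curvatures. The eigenvalues of the matrix
`weingarten g u x` are the `n - 1` principal curvatures and one additional `0`, which does not
change the elementary symmetric functions. -/
def meanCurv {n : ℕ} (g : MetricField n) (u : H n → ℝ) (j : ℕ) (x : H n) : ℝ :=
  (weingarten g u x).charpoly.roots.esymm j

/-- `Ω` is an open set with smooth boundary and `ρ` is a smooth defining function of it: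
`Ω = {ρ < 0}` and `dρ ≠ 0` on `{ρ = 0}` (which is then `∂Ω`). The normal `unitNormal g ρ` on
`∂Ω` points out of `Ω`. -/
structure IsDefiningFunction {n : ℕ} (ρ : H n → ℝ) (Ω : Set (H n)) : Prop where
  smooth : ContDiff ℝ ∞ ρ
  eq_lt : Ω = {x | ρ x < 0}
  regular : ∀ x, ρ x = 0 → fderiv ℝ ρ x ≠ 0

/-! ### Asymptotically hyperbolic metrics and the Gauss-Bonnet-Chern mass -/

/-- `g` is asymptotically hyperbolic of decay order `τ` with the identity as chart at infinity:
outside a closed ball `g` and `b` are uniformly equivalent, and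
`‖g - b‖_b + ‖∇̄g‖_b + ‖∇̄²g‖_b = O(e^{-τ r})`. -/
structure IsAsymptoticallyHyperbolic {n : ℕ} (g : MetricField n) (τ : ℝ) : Prop where
  equivalent : ∃ R C : ℝ, 0 < C ∧ ∀ x : H n, R < hypRadius x → ∀ v : Fin n → ℝ,
    C⁻¹ * ∑ i, ∑ j, hypMetric n x i j * v i * v j ≤ ∑ i, ∑ j, g x i j * v i * v j ∧
    ∑ i, ∑ j, g x i j * v i * v j ≤ C * ∑ i, ∑ j, hypMetric n x i j * v i * v j
  decay : (fun x : H n =>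
      tensorNorm (hypMetric n) (ofMatrix fun y => g y - hypMetric n y) x +
      tensorNorm (hypMetric n) (covDeriv (hypMetric n) (ofMatrix g)) x +
      tensorNorm (hypMetric n)
        (covDeriv (hypMetric n) (covDeriv (hypMetric n) (ofMatrix g))) x)
    =O[Bornology.cobounded (H n)] fun x => exp (-τ * hypRadius x)

/-- The integrand `((W ∇̄_l e_{js} - e_{js} ∇̄_l W) P̃_{(k)}^{ijsl}) ν_i`, where `e = g - b`,
`P̃_{(k)}` is taken with respect to `g`, and `ν` is the outward `b`-unit normal of the geodesic
spheres `{r = const}`. -/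
def massIntegrand {n : ℕ} (g : MetricField n) (k : ℕ) (W : H n → ℝ) (x : H n) : ℝ :=
  ∑ i, (∑ j, ∑ s, ∑ l,
      (W x * covDeriv (hypMetric n) (ofMatrix fun y => g y - hypMetric n y) x ![l, j, s] -
        (g x j s - hypMetric n x j s) * pd l W x) * modP g k i j s l x) *
    ∑ m, hypMetric n x i m * unitNormal (hypMetric n) hypRadius x m

/-- The flux of the mass integrand through the geodesic sphere `S_R = {r = R}`. -/
def massFlux {n : ℕ} (g : MetricField n) (k : ℕ) (W : H n → ℝ) (R : ℝ) : ℝ :=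
  surfaceIntegral (hypMetric n) hypRadius {x | hypRadius x = R} (massIntegrand g k W)

/-- The mass functional `H_k(W) = lim_{R → ∞} ∫_{S_R} (…) dμ`, with respect to the identity
chart at infinity. -/
def massFunctional {n : ℕ} (g : MetricField n) (k : ℕ) (W : H n → ℝ) : ℝ :=
  limUnder atTop (massFlux g k W)

/-- `c(n,k) = (n-2k)! / (2^{k-1} (n-1)! ω_{n-1})`, with `ω_{n-1}` the volume of the standard unit
sphere `𝕊ⁿ⁻¹`. -/
def massConst (n k : ℕ) : ℝ :=
  (n - 2 * k).factorial /
    (2 ^ (k - 1) * (n - 1).factorial *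
      (μHE[n - 1] : Measure (H n)).real (Metric.sphere (0 : H n) 1))

/-- The Gauss-Bonnet-Chern mass `m_k = c(n,k) inf_{W ∈ ℕ_b^1} H_k(W)`. -/
def gbcMass {n : ℕ} (g : MetricField n) (k : ℕ) : ℝ :=
  massConst n k * sInf (massFunctional g k '' Nb1 n)

/-! ### Graphs with a horizon boundary -/

/-- The metric `b + V² df ⊗ df` induced on the graph of `f` in
`ℍⁿ⁺¹ = (ℍⁿ × ℝ, b + V² ds ⊗ ds)`. -/
def graphMetric {n : ℕ} (f : H n → ℝ) : MetricField n :=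
  fun x => Matrix.of fun i j => hypMetric n x i j + V x ^ 2 * pd i f x * pd j f x

/-- The graph of `f` over `ℍⁿ ∖ Ω` is a smooth hypersurface with horizon boundary over
`Σ = ∂Ω`. -/
structure IsHorizonGraph {n : ℕ} (Ω : Set (H n)) (f : H n → ℝ) : Prop where
  /-- `f` is smooth on the interior of `ℍⁿ ∖ Ω` … -/
  smooth : ContDiffOn ℝ ∞ f (closure Ω)ᶜ
  /-- … and continuous up to `Σ`. -/
  continuousOn : ContinuousOn f Ωᶜ
  /-- The graph is smooth up to its boundary: near each boundary point it lies in a smooth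
  embedded hypersurface `{G = 0}` of `ℍⁿ × ℝ`. -/
  smooth_boundary : ∀ p ∈ frontier Ω, ∃ G : H n × ℝ → ℝ, ContDiff ℝ ∞ G ∧
    fderiv ℝ G (p, f p) ≠ 0 ∧ ∀ᶠ x in 𝓝[Ωᶜ] p, G (x, f x) = 0
  /-- Each connected component of `Σ` lies in a level set of `f`. -/
  level : ∀ p ∈ frontier Ω, ∀ q ∈ connectedComponentIn (frontier Ω) p, f q = f p
  /-- `|∇̄f(x)| → ∞` as `x → Σ`. -/
  grad_tendsto : Tendsto (fun x => √(gradSq (hypMetric n) f x))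
    (𝓝ˢ (frontier Ω) ⊓ 𝓟 (closure Ω)ᶜ) atTop

end

end GBCMass

open GBCMass

/-! The map (x, s) ↦ (V cosh s, V sinh s, x) embeds (ℍⁿ × ℝ, b + V² ds²) isometrically in a
hyperboloid of Minkowski space, so the global coordinates x are restrictions of linear functions.
For the graph of f let q be the horizontal part of the unit normal, h the second fundamental form
and A the shape operator. Flatness of Minkowski space gives Γ^l_{ij} = h_{ij} q^l - x^l g_{ij}
(`christoffel_graphMetric`) and A_i^s = ∂_i q^s. Codazzi then amounts to the symmetry of second
partial derivatives of q, and the Gauss equation reads R̃_{ij}^{sl} = A_i^s A_j^l - A_i^l A_j^s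
(`modRiem_graphMetric`).

Thus L̃_k is a full contraction of the generalized delta with 2k factors ∂q. Such an expression is a
null Lagrangian: half of it is the Euclidean divergence of Z^i = ½ δ^{i i₂…}_{p j₂…} q^p A_{i₂}^{j₂}
⋯ (`gbcField`, `sum_pd_gbcField`). All hyperbolic weights cancel. On one side V √det g = √(1 +
V²|∇̄f|²) turns the volume integrand into L̃_k dx. On the other, the mass integrand times the
hyperbolic area density is the Euclidean flux density of Z through the sphere |x| = sinh R
(`massIntegrand_mul_areaDensity`), because the part of V∇̄e - e∇̄V that does not come from h is
symmetric in the two indices where P̃ is antisymmetric. The theorem is therefore a divergence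
theorem for Z between Σ and a large Euclidean sphere (`massFlux_eq`), followed by R → ∞.

At Σ the derivatives of f blow up and Z may be singular, but its conormal component is not. The
contraction of Z with a covector α does not change when A is altered by α ⊗ v, nor when (q, A) is
replaced by (-q, -A), the number of slots being even (`fluxForm_congr`). If the graph lies in {G =
0}, replacing f by G alters q by a sign and A by a sign and a multiple of the horizontal
differential of G (`fluxForm_graph_eq`). So the conormal component extends continuously to Σ. There
the vertical derivative of G vanishes and the horizontal one is proportional to dρ; the same
invariance replaces A by the shape operator of Σ (`fluxForm_level_eq`), and the result is
((2k-1)!/2) V σ_{2k-1} dμ (`meanCurv_mul_areaDensity`).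

To integrate by parts with such a Z (`integral_divergence_eq`), one cuts off by functions of (f -
const)². Their differentials are conormal, hence only see the continuous component of Z, and along
segments transversal to the boundary they act as an approximate identity concentrating at the
boundary point. Surface integrals are computed in local graph coordinates, with the area formula
`measure_image_graph`. -/

namespace GBCMass

noncomputable section

/-! ### Mixed discriminants -/

/-- The mixed discriminant `δ^I_J ∏ₐ (Mₐ)_{I a}^{J a}`, summed over all multi-indices. -/
def mixedDisc {n : ℕ} {ι : Type} [Fintype ι] [DecidableEq ι]
    (M : ι → Matrix (Fin n) (Fin n) ℝ) : ℝ :=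
  ∑ I : ι → Fin n, ∑ J : ι → Fin n, genDelta I J * ∏ a, M a (I a) (J a)

section MixedDisc

variable {n : ℕ} {ι : Type} [Fintype ι] [DecidableEq ι]

lemma genDelta_comp_right (I J : ι → Fin n) (σ : Equiv.Perm ι) :
    genDelta I (J ∘ σ) = (Equiv.Perm.sign σ : ℝ) * genDelta I J := by
  rw [genDelta, genDelta, ← Matrix.det_permute']
  rfl

lemma genDelta_comp_left (I J : ι → Fin n) (σ : Equiv.Perm ι) :
    genDelta (I ∘ σ) J = (Equiv.Perm.sign σ : ℝ) * genDelta I J := by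
  rw [genDelta, genDelta, ← Matrix.det_permute]
  rfl

/-- Column form of the mixed discriminant. -/
lemma mixedDisc_eq_sum_det_col (M : ι → Matrix (Fin n) (Fin n) ℝ) :
    mixedDisc M = ∑ J : ι → Fin n, Matrix.det (Matrix.of fun a b => M b (J a) (J b)) := by
  rw [mixedDisc, Finset.sum_comm]
  refine Finset.sum_congr rfl fun J _ => ?_
  -- In the Leibniz expansion of the delta, the term of σ forces I = J ∘ σ; the sum over I collapses
  -- and what is left is again a Leibniz expansion.
  have h : ∀ I : ι → Fin n, genDelta I J * ∏ a, M a (I a) (J a) =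
      ∑ σ : Equiv.Perm ι, (Equiv.Perm.sign σ : ℝ) *
        ∏ a, ((if I a = J (σ a) then 1 else 0) * M a (I a) (J a)) := by
    intro I
    rw [genDelta, ← Matrix.det_transpose, Matrix.det_apply', Finset.sum_mul]
    refine Finset.sum_congr rfl fun σ _ => ?_
    rw [Finset.prod_mul_distrib, mul_assoc]
    rfl
  simp_rw [h]
  rw [Finset.sum_comm, Matrix.det_apply']
  refine Finset.sum_congr rfl fun σ _ => ?_
  rw [← Finset.mul_sum]
  congr 1
  rw [← Fintype.piFinset_univ, ← Finset.prod_univ_sum (fun _ => Finset.univ)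
    (fun a i => (if i = J (σ a) then (1 : ℝ) else 0) * M a i (J a))]
  refine Finset.prod_congr rfl fun a _ => ?_
  simp

/-- Row form of the mixed discriminant. -/
lemma mixedDisc_eq_sum_det_row (M : ι → Matrix (Fin n) (Fin n) ℝ) :
    mixedDisc M = ∑ I : ι → Fin n, Matrix.det (Matrix.of fun a b => M a (I a) (I b)) := by
  rw [mixedDisc]
  refine Finset.sum_congr rfl fun I _ => ?_
  have h : ∀ J : ι → Fin n, genDelta I J * ∏ a, M a (I a) (J a) =
      ∑ σ : Equiv.Perm ι, (Equiv.Perm.sign σ : ℝ) *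
        ∏ a, ((if I (σ a) = J a then 1 else 0) * M a (I a) (J a)) := by
    intro J
    rw [genDelta, Matrix.det_apply', Finset.sum_mul]
    refine Finset.sum_congr rfl fun σ _ => ?_
    rw [Finset.prod_mul_distrib, mul_assoc]
    rfl
  simp_rw [h]
  rw [Finset.sum_comm, ← Matrix.det_transpose, Matrix.det_apply']
  refine Finset.sum_congr rfl fun σ _ => ?_
  rw [← Finset.mul_sum]
  congr 1
  rw [← Fintype.piFinset_univ, ← Finset.prod_univ_sum (fun _ => Finset.univ)
    (fun a j => (if I (σ a) = j then (1 : ℝ) else 0) * M a (I a) j)]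
  refine Finset.prod_congr rfl fun a _ => ?_
  simp

/-- Only the family of matrices matters, not its labels. This allows passing between pairs of
curvature indices, the slots of the flux form, and an initial segment of ℕ. -/
lemma mixedDisc_reindex {κ : Type} [Fintype κ] [DecidableEq κ] (e : κ ≃ ι)
    (M : ι → Matrix (Fin n) (Fin n) ℝ) : mixedDisc (fun a => M (e a)) = mixedDisc M := by
  rw [mixedDisc_eq_sum_det_row, mixedDisc_eq_sum_det_row]
  refine Fintype.sum_equiv (e.arrowCongr (Equiv.refl _)) _ _ fun I => ?_
  rw [← Matrix.det_submatrix_equiv_self e]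
  congr 1
  ext a b
  simp [Equiv.arrowCongr]

/-- If one factor is `α ⊗ q`, then multiples `α ⊗ v` may be added to the others. -/
lemma mixedDisc_add_vecMulVec (M N : ι → Matrix (Fin n) (Fin n) ℝ) (a₀ : ι)
    (α q : Fin n → ℝ) (v : ι → Fin n → ℝ) (hM : M a₀ = Matrix.vecMulVec α q)
    (hN : N a₀ = Matrix.vecMulVec α q)
    (h : ∀ a, a ≠ a₀ → N a = M a + Matrix.vecMulVec α (v a)) :
    mixedDisc N = mixedDisc M := by
  rw [mixedDisc_eq_sum_det_col, mixedDisc_eq_sum_det_col]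
  refine Finset.sum_congr rfl fun J _ => ?_
  -- Column a₀ is q (J a₀) times α. If that factor vanishes, both determinants are zero; otherwise
  -- every added column is a multiple of column a₀, and this is a column operation.
  by_cases hq : q (J a₀) = 0
  · rw [Matrix.det_eq_zero_of_column_eq_zero a₀, Matrix.det_eq_zero_of_column_eq_zero a₀]
    · intro i; simp [hM, Matrix.vecMulVec, hq]
    · intro i; simp [hN, Matrix.vecMulVec, hq]
  · rw [← Matrix.det_transpose, ← Matrix.det_transpose (Matrix.of fun a b => M b (J a) (J b))]
    refine Matrix.det_eq_of_forall_row_eq_smul_add_const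
      (fun b => if b = a₀ then 0 else v b (J b) / q (J a₀)) a₀ (by simp) fun b a => ?_
    by_cases hb : b = a₀
    · subst hb; simp [hM, hN]
    · simp [h b hb, hM, hb, Matrix.vecMulVec]
      field_simp

lemma mixedDisc_smul (c : ℝ) (M : ι → Matrix (Fin n) (Fin n) ℝ) :
    mixedDisc (fun a => c • M a) = c ^ Fintype.card ι * mixedDisc M := by
  simp only [mixedDisc, Matrix.smul_apply, smul_eq_mul, Finset.prod_mul_distrib,
    Finset.prod_const, Finset.card_univ, Finset.mul_sum]
  refine Finset.sum_congr rfl fun I _ => Finset.sum_congr rfl fun J _ => ?_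
  ring

end MixedDisc

/-- The `δ`-contraction of products of `2 × 2` minors of `A`. -/
lemma sum_mul_prod_minor {n m : ℕ} (A : Matrix (Fin n) (Fin n) ℝ)
    (D : (Fin m × Fin 2 → Fin n) → ℝ) (I : Fin m × Fin 2 → Fin n)
    (hD : ∀ a J, D (J ∘ Equiv.swap (a, 0) (a, 1)) = - D J) :
    ∑ J : Fin m × Fin 2 → Fin n, D J * ∏ a : Fin m,
        (A (I (a, 0)) (J (a, 0)) * A (I (a, 1)) (J (a, 1)) -
          A (I (a, 0)) (J (a, 1)) * A (I (a, 1)) (J (a, 0))) =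
      2 ^ m * ∑ J : Fin m × Fin 2 → Fin n, D J * ∏ c, A (I c) (J c) := by
  set x : (Fin m × Fin 2 → Fin n) → Fin m → ℝ := fun J a =>
    A (I (a, 0)) (J (a, 0)) * A (I (a, 1)) (J (a, 1)) with hx
  set y : (Fin m × Fin 2 → Fin n) → Fin m → ℝ := fun J a =>
    A (I (a, 0)) (J (a, 1)) * A (I (a, 1)) (J (a, 0)) with hy
  -- The minors are replaced by their diagonal terms x one at a time; T collects the pairs that
  -- still carry a full minor.
  have key : ∀ T : Finset (Fin m),
      ∑ J, D J * ((∏ a ∈ T, (x J a - y J a)) * ∏ a ∈ Tᶜ, x J a) =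
        2 ^ T.card * ∑ J, D J * ∏ a, x J a := by
    intro T
    induction T using Finset.induction_on with
    | empty => simp
    | insert b T hb ih =>
      have hcompl : ∀ J, ∏ a ∈ Tᶜ, x J a = x J b * ∏ a ∈ (insert b T)ᶜ, x J a := by
        intro J
        rw [Finset.compl_insert]
        exact (Finset.mul_prod_erase _ _ (by simpa using hb)).symm
      -- Exchanging the two entries of J in the pair b turns y into x and changes the sign of D, so
      -- the two terms of the minor contribute equally: one factor 2 per pair.
      have hswap : ∑ J, D J * ((∏ a ∈ T, (x J a - y J a)) *
            (y J b * ∏ a ∈ (insert b T)ᶜ, x J a)) =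
          - ∑ J, D J * ((∏ a ∈ T, (x J a - y J a)) *
            (x J b * ∏ a ∈ (insert b T)ᶜ, x J a)) := by
        rw [← Finset.sum_neg_distrib]
        refine Fintype.sum_equiv ((Equiv.swap (b, (0 : Fin 2)) (b, 1)).arrowCongr
          (Equiv.refl (Fin n))) _ _ fun J => ?_
        have e1 : ((Equiv.swap (b, (0 : Fin 2)) (b, 1)).arrowCongr (Equiv.refl (Fin n))) J =
            J ∘ Equiv.swap (b, (0 : Fin 2)) (b, 1) := by
          ext c; simp [Equiv.arrowCongr]
        rw [e1, hD]
        have e2 : ∀ a, a ≠ b → ∀ i : Fin 2,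
            (J ∘ Equiv.swap (b, (0 : Fin 2)) (b, 1)) (a, i) = J (a, i) := by
          intro a ha i
          rw [Function.comp_apply, Equiv.swap_apply_of_ne_of_ne] <;> simp [ha]
        have e3 : ∏ a ∈ T, (x (J ∘ Equiv.swap (b, (0 : Fin 2)) (b, 1)) a -
            y (J ∘ Equiv.swap (b, (0 : Fin 2)) (b, 1)) a) = ∏ a ∈ T, (x J a - y J a) := by
          refine Finset.prod_congr rfl fun a ha => ?_
          have : a ≠ b := fun h => hb (h ▸ ha)
          simp only [hx, hy, e2 a this]
        have e4 : ∏ a ∈ (insert b T)ᶜ, x (J ∘ Equiv.swap (b, (0 : Fin 2)) (b, 1)) a =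
            ∏ a ∈ (insert b T)ᶜ, x J a := by
          refine Finset.prod_congr rfl fun a ha => ?_
          have : a ≠ b := by rintro rfl; simp at ha
          simp only [hx, e2 a this]
        have e5 : x (J ∘ Equiv.swap (b, (0 : Fin 2)) (b, 1)) b = y J b := by
          simp [hx, hy]
        rw [e3, e4, e5]; ring
      have : ∀ J, D J * ((∏ a ∈ insert b T, (x J a - y J a)) * ∏ a ∈ (insert b T)ᶜ, x J a) =
          D J * ((∏ a ∈ T, (x J a - y J a)) * (x J b * ∏ a ∈ (insert b T)ᶜ, x J a)) -
          D J * ((∏ a ∈ T, (x J a - y J a)) * (y J b * ∏ a ∈ (insert b T)ᶜ, x J a)) := by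
        intro J
        rw [Finset.prod_insert hb]; ring
      simp_rw [this]
      rw [Finset.sum_sub_distrib, hswap, Finset.card_insert_of_notMem hb, pow_succ]
      simp_rw [← hcompl, ih]
      ring
  have h := key Finset.univ
  simp only [Finset.compl_univ, Finset.prod_empty, mul_one, Finset.card_univ,
    Fintype.card_fin] at h
  rw [h]
  congr 1
  refine Finset.sum_congr rfl fun J _ => ?_
  rw [Fintype.prod_prod_type]
  simp [hx]

/-! ### Elementary symmetric functions as mixed discriminants -/

/-- A tuple with a repeated index gives two equal rows, hence 0. The injective tuples are grouped by
their image: every m-element set has m! enumerations, and all of them give the same principal minor.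
-/
lemma mixedDisc_const_eq_sum_minors {n m : ℕ} (W : Matrix (Fin n) (Fin n) ℝ) :
    mixedDisc (fun _ : Fin m => W) = m.factorial *
      ∑ s ∈ Finset.univ.powersetCard m,
        (W.submatrix (Subtype.val : s → Fin n) (Subtype.val : s → Fin n)).det := by
  have e0 : mixedDisc (fun _ : Fin m => W) = ∑ I : Fin m → Fin n, (W.submatrix I I).det :=
    mixedDisc_eq_sum_det_row _
  rw [e0]
  have hinj : ∑ I : Fin m → Fin n, (W.submatrix I I).det =
      ∑ I : Fin m → Fin n with Function.Injective I, (W.submatrix I I).det := by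
    rw [Finset.sum_filter]
    refine Finset.sum_congr rfl fun I _ => ?_
    split_ifs with h
    · rfl
    · simp only [Function.Injective, not_forall] at h
      obtain ⟨a, b, hab, hne⟩ := h
      refine Matrix.det_zero_of_row_eq hne ?_
      ext c; simp [hab]
  rw [hinj, Finset.mul_sum]
  rw [← Finset.sum_fiberwise_of_maps_to (s := Finset.univ.filter Function.Injective)
    (t := Finset.univ.powersetCard m) (g := fun I : Fin m → Fin n => Finset.univ.image I)]
  · refine Finset.sum_congr rfl fun s hs => ?_
    have hcard : s.card = m := (Finset.mem_powersetCard.1 hs).2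
    have hconst : ∀ I ∈ (Finset.univ.filter Function.Injective).filter
        (fun I : Fin m → Fin n => Finset.univ.image I = s), (W.submatrix I I).det =
        (W.submatrix (Subtype.val : s → Fin n) (Subtype.val : s → Fin n)).det := by
      intro I hI
      simp only [Finset.mem_filter, Finset.mem_univ, true_and] at hI
      obtain ⟨hI, rfl⟩ := hI
      let e : Fin m ≃ (Finset.univ.image I : Finset (Fin n)) :=
        Equiv.ofBijective (fun a => ⟨I a, by simp⟩)
          ⟨fun a b h => hI (by simpa using h), fun ⟨x, hx⟩ => by
            simp only [Finset.mem_image, Finset.mem_univ, true_and] at hx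
            obtain ⟨a, rfl⟩ := hx
            exact ⟨a, rfl⟩⟩
      rw [← Matrix.det_submatrix_equiv_self e]
      rfl
    rw [Finset.sum_congr rfl hconst, Finset.sum_const, nsmul_eq_mul]
    congr 2
    have : ((Finset.univ.filter Function.Injective).filter
        (fun I : Fin m → Fin n => Finset.univ.image I = s)).card =
        Fintype.card (Fin m ≃ s) := by
      rw [← Finset.card_univ]
      refine Finset.card_bij' (fun I hI => Equiv.ofBijective (fun a => (⟨I a, ?_⟩ : s)) ?_)
        (fun e _ a => (e a : Fin n)) ?_ ?_ ?_ ?_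
      · simp only [Finset.mem_filter, Finset.mem_univ, true_and] at hI
        rw [← hI.2]; simp
      · simp only [Finset.mem_filter, Finset.mem_univ, true_and] at hI
        refine ⟨fun a b h => hI.1 (by simpa using h), fun ⟨x, hx⟩ => ?_⟩
        rw [← hI.2] at hx
        simp only [Finset.mem_image, Finset.mem_univ, true_and] at hx
        obtain ⟨a, rfl⟩ := hx
        exact ⟨a, rfl⟩
      · intro I hI; simp
      · intro e _
        simp only [Finset.mem_filter, Finset.mem_univ, true_and]
        refine ⟨fun a b h => e.injective (Subtype.ext h), ?_⟩
        ext x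
        simp only [Finset.mem_image, Finset.mem_univ, true_and]
        constructor
        · rintro ⟨a, rfl⟩; exact (e a).2
        · intro hx; exact ⟨e.symm ⟨x, hx⟩, by simp⟩
      · intro I hI; rfl
      · intro e _; ext a; rfl
    rw [this, Fintype.card_equiv (Fintype.equivOfCardEq (by simp [hcard]))]
    simp
  · intro I hI
    simp only [Finset.mem_filter, Finset.mem_univ, true_and] at hI
    simp [Finset.mem_powersetCard, Finset.card_image_of_injective _ hI]

/-- If `W ν = 0` and `ν(q) = 1`, then contracting one slot with `ν ⊗ q` lowers the degree. -/
lemma mixedDisc_vecMulVec_cons {n m : ℕ} (W : Matrix (Fin n) (Fin n) ℝ) (ν q : Fin n → ℝ)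
    (hW : ∀ i, ∑ j, W i j * ν j = 0) (hν : ∑ i, ν i * q i = 1) :
    mixedDisc (Fin.cons (Matrix.vecMulVec ν q) (fun _ : Fin m => W) :
      Fin (m + 1) → Matrix (Fin n) (Fin n) ℝ) = mixedDisc (fun _ : Fin m => W) := by
  rw [mixedDisc_eq_sum_det_row, mixedDisc_eq_sum_det_row]
  rw [← (Fin.consEquiv (fun _ : Fin (m + 1) => Fin n)).sum_comp, Fintype.sum_prod_type,
    Finset.sum_comm]
  refine Finset.sum_congr rfl fun I _ => ?_
  -- Laplace expansion along row 0, the row of ν ⊗ q. The first term sums to the reduced determinant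
  -- because ν(q) = 1. In all others the index i survives as a column of W, and summation against ν
  -- produces W ν = 0.
  have hdet : ∀ i : Fin n, Matrix.det (Matrix.of fun a b : Fin (m + 1) =>
      (Fin.cons (Matrix.vecMulVec ν q) (fun _ : Fin m => W) :
        Fin (m + 1) → Matrix (Fin n) (Fin n) ℝ) a
        ((Fin.consEquiv (fun _ : Fin (m + 1) => Fin n)) (i, I) a)
        ((Fin.consEquiv (fun _ : Fin (m + 1) => Fin n)) (i, I) b)) =
      ν i * q i * (W.submatrix I I).det +
      ∑ j : Fin m, (-1) ^ (j.succ : ℕ) * (q (I j) * (ν i *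
        (Matrix.of fun a b : Fin m =>
          W (I a) ((Fin.cons i I : Fin (m + 1) → Fin n) (j.succ.succAbove b))).det)) := by
    intro i
    rw [Matrix.det_succ_row_zero, Fin.sum_univ_succ]
    congr 1
    · simp [Matrix.vecMulVec, Fin.consEquiv]
      left; rfl
    · refine Finset.sum_congr rfl fun j _ => ?_
      simp only [Matrix.of_apply, Fin.cons_zero, Fin.consEquiv_apply, Fin.cons_succ,
        Matrix.vecMulVec, Matrix.submatrix]
      ring_nf
  simp_rw [hdet]
  rw [Finset.sum_add_distrib, ← Finset.sum_mul, hν, one_mul, Finset.sum_comm]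
  conv_rhs => rw [← add_zero (Matrix.det _)]
  congr 1
  refine Finset.sum_eq_zero fun j _ => ?_
  rw [← Finset.mul_sum, ← Finset.mul_sum]
  suffices h : ∑ i : Fin n, ν i * (Matrix.of fun a b : Fin m =>
      W (I a) ((Fin.cons i I : Fin (m + 1) → Fin n) (j.succ.succAbove b))).det = 0 by
    rw [h]; simp
  obtain ⟨m, rfl⟩ : ∃ m', m = m' + 1 := ⟨m - 1, by have := j.2; omega⟩
  set B : Matrix (Fin (m + 1)) (Fin (m + 1)) ℝ := Matrix.of fun a b =>
      W (I a) ((Fin.cons (I 0) I : Fin (m + 2) → Fin n) (j.succ.succAbove b)) with hB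
  have hcol : ∀ i, (Matrix.of fun a b : Fin (m + 1) =>
      W (I a) ((Fin.cons i I : Fin (m + 2) → Fin n) (j.succ.succAbove b))) =
      B.updateCol 0 (fun a => W (I a) i) := by
    intro i
    ext a b
    refine Fin.cases ?_ (fun b => ?_) b
    · simp
    · simp [hB]
  simp_rw [hcol, ← Matrix.cramer_apply, ← smul_eq_mul]
  have h2 : ∑ i, ν i • B.cramer (fun a => W (I a) i) = 0 := by
    simp_rw [← map_smul]
    rw [← map_sum]
    have : ∑ i, ν i • (fun a => W (I a) i) = (0 : Fin (m + 1) → ℝ) := by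
      ext a
      simp only [Finset.sum_apply, Pi.smul_apply, smul_eq_mul, Pi.zero_apply]
      rw [← hW (I a)]
      exact Finset.sum_congr rfl fun i _ => mul_comm _ _
    rw [this, map_zero]
  simpa using congrFun h2 0

/-! ### Partial derivatives -/

section Pd

variable {n : ℕ} {F G : H n → ℝ} {x : H n} (i : Fin n)

lemma pd_congr (h : F =ᶠ[𝓝 x] G) : pd i F x = pd i G x := by
  rw [pd, pd, h.fderiv_eq]

lemma pd_const (c : ℝ) : pd i (fun _ : H n => c) x = 0 := by simp [pd]

lemma pd_add (hF : DifferentiableAt ℝ F x) (hG : DifferentiableAt ℝ G x) :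
    pd i (fun y => F y + G y) x = pd i F x + pd i G x := by
  simp [pd, fderiv_fun_add hF hG]

lemma pd_sub (hF : DifferentiableAt ℝ F x) (hG : DifferentiableAt ℝ G x) :
    pd i (fun y => F y - G y) x = pd i F x - pd i G x := by
  simp [pd, fderiv_fun_sub hF hG]

lemma pd_mul (hF : DifferentiableAt ℝ F x) (hG : DifferentiableAt ℝ G x) :
    pd i (fun y => F y * G y) x = pd i F x * G x + F x * pd i G x := by
  simp [pd, fderiv_fun_mul hF hG]; ring

lemma pd_const_mul (c : ℝ) (hF : DifferentiableAt ℝ F x) :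
    pd i (fun y => c * F y) x = c * pd i F x := by
  simp [pd, fderiv_const_mul hF]

lemma pd_sum {ι : Type*} {s : Finset ι} {F : ι → H n → ℝ}
    (hF : ∀ a ∈ s, DifferentiableAt ℝ (F a) x) :
    pd i (fun y => ∑ a ∈ s, F a y) x = ∑ a ∈ s, pd i (F a) x := by
  simp [pd, fderiv_fun_sum hF]

lemma pd_comp {φ : ℝ → ℝ} {φ' : ℝ} (hφ : HasDerivAt φ φ' (F x)) (hF : DifferentiableAt ℝ F x) :
    pd i (fun y => φ (F y)) x = φ' * pd i F x := by
  have := hφ.comp_hasFDerivAt x hF.hasFDerivAt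
  rw [pd, show (fun y => φ (F y)) = φ ∘ F from rfl, this.fderiv]
  simp [pd]

lemma contDiffAt_pd_top (hF : ContDiffAt ℝ ∞ F x) : ContDiffAt ℝ ∞ (pd i F) x :=
  (hF.fderiv_right (m := ∞) (by simp)).clm_apply contDiffAt_const

lemma pd_pd_comm (j : Fin n) (hF : ContDiffAt ℝ ∞ F x) :
    pd i (pd j F) x = pd j (pd i F) x := by
  have h : ∀ k l : Fin n, pd k (pd l F) x = fderiv ℝ (fderiv ℝ F) x
      (EuclideanSpace.single k 1) (EuclideanSpace.single l 1) := by
    intro k l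
    have hd : DifferentiableAt ℝ (fderiv ℝ F) x :=
      (hF.fderiv_right (m := ∞) (by simp)).differentiableAt (by simp)
    have e : pd l F = fun y => fderiv ℝ F y (EuclideanSpace.single l 1) := rfl
    rw [e, pd, fderiv_clm_apply hd (differentiableAt_const _)]
    simp
  rw [h, h]
  exact (hF.isSymmSndFDerivAt (by rw [minSmoothness_of_isRCLikeNormedField]; exact WithTop.coe_le_coe.2 (le_top : (2 : ℕ∞) ≤ ⊤))) _ _

lemma fderiv_apply_eq_sum_pd (v : H n) :
    fderiv ℝ F x v = ∑ i, v i * pd i F x := by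
  conv_lhs => rw [← (EuclideanSpace.basisFun (Fin n) ℝ).sum_repr v]
  simp [pd, map_sum]

end Pd

lemma one_add_norm_sq_pos {n : ℕ} (x : H n) : 0 < 1 + ‖x‖ ^ 2 := by positivity

lemma norm_sq_eq_sum {n : ℕ} (x : H n) : ‖x‖ ^ 2 = ∑ i, x i * x i := by
  rw [EuclideanSpace.real_norm_sq_eq]
  simp [sq]

lemma V_sq_eq {n : ℕ} (x : H n) : V x ^ 2 = 1 + ‖x‖ ^ 2 := by linarith [V_sq x]

lemma V_pos {n : ℕ} (x : H n) : 0 < V x := cosh_pos _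

lemma contDiff_V {n : ℕ} : ContDiff ℝ ∞ (V : H n → ℝ) := by
  have : (V : H n → ℝ) = fun y => √(1 + ‖y‖ ^ 2) := funext V_eq
  rw [this]
  exact (contDiff_const.add (contDiff_norm_sq ℝ)).sqrt fun x => (one_add_norm_sq_pos x).ne'

lemma contDiff_coord {n : ℕ} (i : Fin n) : ContDiff ℝ ∞ (fun y : H n => y i) :=
  (EuclideanSpace.proj i : H n →L[ℝ] ℝ).contDiff

/-! ### The lift of a covector to the horizontal part of a unit normal -/

/-- The hyperbolic inner product `b⁻¹(α, α)`. -/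
def coNormSq {n : ℕ} (x : H n) (α : Fin n → ℝ) : ℝ :=
  ∑ i, α i * α i + (∑ i, x i * α i) ^ 2

/-- The horizontal part of the unit conormal `(α, c)` of a hypersurface of
`(ℍⁿ × ℝ, b + V² ds²)`, as a vector. -/
def normalPart {n : ℕ} (x : H n) (c : ℝ) (α : Fin n → ℝ) (s : Fin n) : ℝ :=
  (α s + x s * ∑ i, x i * α i) / √(c ^ 2 / (1 + ‖x‖ ^ 2) + coNormSq x α)

lemma coNormSq_nonneg {n : ℕ} (x : H n) (α : Fin n → ℝ) : 0 ≤ coNormSq x α :=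
  add_nonneg (Finset.sum_nonneg fun _ _ => mul_self_nonneg _) (sq_nonneg _)

lemma coNormSq_pos {n : ℕ} (x : H n) {α : Fin n → ℝ} (h : α ≠ 0) : 0 < coNormSq x α := by
  obtain ⟨i, hi⟩ := Function.ne_iff.1 h
  have h1 : 0 < ∑ i, α i * α i :=
    Finset.sum_pos' (fun _ _ => mul_self_nonneg _) ⟨i, Finset.mem_univ _, mul_self_pos.2 hi⟩
  unfold coNormSq
  positivity

lemma coNormSq_smul {n : ℕ} (x : H n) (μ : ℝ) (α : Fin n → ℝ) :
    coNormSq x (μ • α) = μ ^ 2 * coNormSq x α := by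
  have h1 : ∑ i, (μ • α) i * (μ • α) i = μ ^ 2 * ∑ i, α i * α i := by
    rw [Finset.mul_sum]; refine Finset.sum_congr rfl fun i _ => ?_
    simp; ring
  have h2 : ∑ i, x i * (μ • α) i = μ * ∑ i, x i * α i := by
    rw [Finset.mul_sum]; refine Finset.sum_congr rfl fun i _ => ?_
    simp; ring
  rw [coNormSq, coNormSq, h1, h2]; ring

/-- A unit normal depends on the conormal only up to positive factors. For μ = 0 both sides are 0,
by the convention on division by 0. -/
lemma normalPart_smul {n : ℕ} (x : H n) (μ c : ℝ) (α : Fin n → ℝ) (s : Fin n) :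
    normalPart x (μ * c) (μ • α) s = μ / |μ| * normalPart x c α s := by
  have h2 : ∑ i, x i * (μ • α) i = μ * ∑ i, x i * α i := by
    rw [Finset.mul_sum]; refine Finset.sum_congr rfl fun i _ => ?_
    simp; ring
  rw [normalPart, normalPart, coNormSq_smul, h2,
    show (μ * c) ^ 2 / (1 + ‖x‖ ^ 2) + μ ^ 2 * coNormSq x α =
      μ ^ 2 * (c ^ 2 / (1 + ‖x‖ ^ 2) + coNormSq x α) by ring,
    Real.sqrt_mul (sq_nonneg _), Real.sqrt_sq_eq_abs]
  simp only [Pi.smul_apply, smul_eq_mul]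
  rw [div_mul_div_comm]
  congr 1
  ring

/-! ### The hyperbolic metric and the graph metric -/

section Metric

variable {n : ℕ} (x : H n)

lemma hypMetric_apply (i j : Fin n) :
    hypMetric n x i j = (if i = j then 1 else 0) - x i * x j / (1 + ‖x‖ ^ 2) := rfl

lemma hypMetric_symm (i j : Fin n) : hypMetric n x i j = hypMetric n x j i := by
  rw [hypMetric_apply, hypMetric_apply, mul_comm]
  simp only [eq_comm]

lemma hypMetric_mul_inv :
    hypMetric n x * (Matrix.of fun i j => (if i = j then 1 else 0) + x i * x j) = 1 := by
  ext i k
  have h := norm_sq_eq_sum x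
  have h0 := (one_add_norm_sq_pos x).ne'
  have e : ∀ j, hypMetric n x i j * ((if j = k then 1 else 0) + x j * x k) =
      (if i = j then (if j = k then 1 else 0) + x j * x k else 0)
      - (if j = k then x i * x j / (1 + ‖x‖ ^ 2) else 0)
      - x i * x k / (1 + ‖x‖ ^ 2) * (x j * x j) := by
    intro j
    rw [hypMetric_apply]
    split_ifs <;> ring
  simp only [Matrix.mul_apply, Matrix.of_apply, e, Finset.sum_sub_distrib, ← Finset.mul_sum, ← h,
    Finset.sum_ite_eq, Finset.sum_ite_eq', Finset.mem_univ, if_true, Matrix.one_apply]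
  field_simp
  ring

lemma hypMetric_inv :
    (hypMetric n x)⁻¹ = Matrix.of fun i j => (if i = j then 1 else 0) + x i * x j :=
  Matrix.inv_eq_right_inv (hypMetric_mul_inv x)

lemma hypMetric_inv_apply (i j : Fin n) :
    (hypMetric n x)⁻¹ i j = (if i = j then 1 else 0) + x i * x j := by
  rw [hypMetric_inv]; rfl

lemma isUnit_det_hypMetric : IsUnit (hypMetric n x).det :=
  Matrix.isUnit_det_of_right_inverse (hypMetric_mul_inv x)

lemma det_hypMetric : (hypMetric n x).det = 1 / (1 + ‖x‖ ^ 2) := by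
  have h0 := (one_add_norm_sq_pos x).ne'
  have e : hypMetric n x = 1 + Matrix.replicateCol Unit (fun i => - x i / (1 + ‖x‖ ^ 2)) *
      Matrix.replicateRow Unit (fun i => x i) := by
    ext i j
    simp [hypMetric_apply, Matrix.one_apply, Matrix.mul_apply]
    ring
  rw [e, Matrix.det_one_add_replicateCol_mul_replicateRow]
  simp only [dotProduct]
  have : ∑ i, x i * (- x i / (1 + ‖x‖ ^ 2)) = - (∑ i, x i * x i) / (1 + ‖x‖ ^ 2) := by
    rw [← Finset.sum_neg_distrib, Finset.sum_div]
    exact Finset.sum_congr rfl fun i _ => by ring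
  rw [this, ← norm_sq_eq_sum]
  field_simp
  ring

lemma sum_hypMetric_inv_mul (i : Fin n) (α : Fin n → ℝ) :
    ∑ j, (hypMetric n x)⁻¹ i j * α j = α i + x i * ∑ j, x j * α j := by
  simp_rw [hypMetric_inv_apply, add_mul, Finset.sum_add_distrib, Finset.mul_sum]
  simp [mul_assoc]

lemma gradSq_hypMetric (F : H n → ℝ) :
    gradSq (hypMetric n) F x = coNormSq x (fun i => pd i F x) := by
  have : ∀ i, ∑ j, (hypMetric n x)⁻¹ i j * pd i F x * pd j F x =
      pd i F x * (pd i F x + x i * ∑ j, x j * pd j F x) := by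
    intro i
    rw [← sum_hypMetric_inv_mul x i (fun j => pd j F x), Finset.mul_sum]
    exact Finset.sum_congr rfl fun j _ => by ring
  simp only [gradSq, this, coNormSq, mul_add, Finset.sum_add_distrib, sq, Finset.sum_mul]
  congr 1
  exact Finset.sum_congr rfl fun j _ => by ring

lemma grad_hypMetric (F : H n → ℝ) (i : Fin n) :
    grad (hypMetric n) F x i = pd i F x + x i * ∑ j, x j * pd j F x :=
  sum_hypMetric_inv_mul x i _

lemma unitNormal_hypMetric (u : H n → ℝ) (i : Fin n) :
    unitNormal (hypMetric n) u x i = normalPart x 0 (fun j => pd j u x) i := by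
  rw [unitNormal, grad_hypMetric, gradSq_hypMetric, normalPart]
  simp

lemma graphMetric_apply (f : H n → ℝ) (i j : Fin n) :
    graphMetric f x i j = (if i = j then 1 else 0) - x i * x j / (1 + ‖x‖ ^ 2) +
      (1 + ‖x‖ ^ 2) * pd i f x * pd j f x := by
  rw [graphMetric, Matrix.of_apply, hypMetric_apply, V_sq_eq]

lemma graphMetric_symm (f : H n → ℝ) (i j : Fin n) :
    graphMetric f x i j = graphMetric f x j i := by
  rw [graphMetric_apply, graphMetric_apply]
  simp only [eq_comm (a := i)]
  ring

/-- The determinant formula for a rank-one perturbation of b. Multiplied by V² the value is 1 +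
V²|∇̄f|², which is why the square root in the volume integrand of the theorem disappears. -/
lemma det_graphMetric (f : H n → ℝ) :
    (graphMetric f x).det = 1 / (1 + ‖x‖ ^ 2) + gradSq (hypMetric n) f x := by
  have h0 := (one_add_norm_sq_pos x).ne'
  have e : graphMetric f x = hypMetric n x +
      Matrix.replicateCol Unit (fun i => (1 + ‖x‖ ^ 2) * pd i f x) *
      Matrix.replicateRow Unit (fun i => pd i f x) := by
    ext i j
    simp [graphMetric, Matrix.mul_apply, V_sq_eq]
  rw [e, Matrix.det_add_replicateCol_mul_replicateRow (isUnit_det_hypMetric x), det_hypMetric]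
  have : (1 + Matrix.replicateRow Unit (fun i => pd i f x) * (hypMetric n x)⁻¹ *
      Matrix.replicateCol Unit (fun i => (1 + ‖x‖ ^ 2) * pd i f x)).det =
      1 + (1 + ‖x‖ ^ 2) * gradSq (hypMetric n) f x := by
    rw [Matrix.det_unique]
    simp only [Matrix.add_apply, Matrix.one_apply, Matrix.mul_apply, if_true,
      Matrix.replicateRow_apply, Matrix.replicateCol_apply, gradSq, Finset.mul_sum,
      Finset.sum_mul]
    rw [Finset.sum_comm]
    congr 1
    exact Finset.sum_congr rfl fun i _ => Finset.sum_congr rfl fun j _ => by ring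
  rw [this]
  field_simp

lemma det_graphMetric_pos (f : H n → ℝ) : 0 < (graphMetric f x).det := by
  rw [det_graphMetric, gradSq_hypMetric]
  have := coNormSq_nonneg x (fun i => pd i f x)
  positivity

lemma sum_graphMetric_mul (f : H n → ℝ) (l : Fin n) (u : Fin n → ℝ) :
    ∑ m, graphMetric f x l m * u m = u l - x l / (1 + ‖x‖ ^ 2) * ∑ m, x m * u m +
      (1 + ‖x‖ ^ 2) * pd l f x * ∑ m, pd m f x * u m := by
  have : ∀ m, graphMetric f x l m * u m = (if l = m then u m else 0) -
      x l / (1 + ‖x‖ ^ 2) * (x m * u m) + (1 + ‖x‖ ^ 2) * pd l f x * (pd m f x * u m) := by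
    intro m
    rw [graphMetric_apply]
    split_ifs <;> ring
  simp only [this, Finset.sum_add_distrib, Finset.sum_sub_distrib, ← Finset.mul_sum,
    Finset.sum_ite_eq, Finset.mem_univ, if_true]

/-- With this, formulas for graphs specialize to b, in particular the Christoffel symbols and the
derivatives of the metric. -/
lemma hypMetric_eq_graphMetric : hypMetric n = graphMetric (fun _ => (0 : ℝ)) := by
  ext x i j
  simp [graphMetric_apply, hypMetric_apply, pd_const]

end Metric

/-! ### The Gauss equation for graphs -/

section Gauss

variable {n : ℕ} {f : H n → ℝ} {x : H n}

/-- The horizontal part of the (downward) unit normal of the graph of `f`. -/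
def graphNormal (f : H n → ℝ) (x : H n) (s : Fin n) : ℝ :=
  normalPart x 1 (fun j => pd j f x) s

/-- The shape operator `A_i^s` of the graph; see `modRiem_graphMetric`. -/
def graphShape (f : H n → ℝ) (x : H n) : Matrix (Fin n) (Fin n) ℝ :=
  Matrix.of fun i s => pd i (fun y => graphNormal f y s) x

lemma coord_differentiableAt (i : Fin n) : DifferentiableAt ℝ (fun y : H n => y i) x :=
  ((contDiff_coord i).contDiffAt).differentiableAt (by simp)

lemma contDiff_one_add_norm_sq : ContDiff ℝ ∞ (fun y : H n => 1 + ‖y‖ ^ 2) :=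
  contDiff_const.add (contDiff_norm_sq ℝ)

lemma pd_one_add_norm_sq (k : Fin n) : pd k (fun y : H n => 1 + ‖y‖ ^ 2) x = 2 * x k := by
  have h1 : HasFDerivAt (fun y : H n => 1 + ‖y‖ ^ 2) (2 • innerSL ℝ x) x :=
    (hasStrictFDerivAt_norm_sq x).hasFDerivAt.const_add 1
  rw [pd, h1.fderiv]
  simp [EuclideanSpace.inner_single_right]

lemma contDiffAt_coNormSq {α : Fin n → H n → ℝ} {m : WithTop ℕ∞}
    (hα : ∀ i, ContDiffAt ℝ m (α i) x) (hm : m ≤ ∞) :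
    ContDiffAt ℝ m (fun y => coNormSq y fun i => α i y) x := by
  unfold coNormSq
  refine (ContDiffAt.sum fun i _ => (hα i).mul (hα i)).add (ContDiffAt.pow ?_ 2)
  exact ContDiffAt.sum fun i _ => ((contDiff_coord i).contDiffAt.of_le hm).mul (hα i)

lemma contDiffAt_normalPart {α : Fin n → H n → ℝ} {c : H n → ℝ} {m : WithTop ℕ∞}
    (hα : ∀ i, ContDiffAt ℝ m (α i) x) (hc : ContDiffAt ℝ m c x) (hm : m ≤ ∞)
    (h0 : c x ≠ 0 ∨ (fun i => α i x) ≠ 0) (s : Fin n) :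
    ContDiffAt ℝ m (fun y => normalPart y (c y) (fun i => α i y) s) x := by
  unfold normalPart
  have hpos : 0 < c x ^ 2 / (1 + ‖x‖ ^ 2) + coNormSq x fun i => α i x := by
    have := coNormSq_nonneg x (fun i => α i x)
    rcases h0 with h | h
    · positivity
    · have := coNormSq_pos x h
      positivity
  refine ContDiffAt.div ?_ (ContDiffAt.sqrt ?_ hpos.ne') (Real.sqrt_pos.2 hpos).ne'
  · exact (hα s).add (((contDiff_coord s).contDiffAt.of_le hm).mul
      (ContDiffAt.sum fun i _ => ((contDiff_coord i).contDiffAt.of_le hm).mul (hα i)))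
  · exact ((hc.pow 2).div (contDiff_one_add_norm_sq.contDiffAt.of_le hm)
      (one_add_norm_sq_pos x).ne').add (contDiffAt_coNormSq hα hm)

lemma contDiffAt_graphNormal (hf : ContDiffAt ℝ ∞ f x) (s : Fin n) :
    ContDiffAt ℝ ∞ (fun y => graphNormal f y s) x :=
  contDiffAt_normalPart (c := fun _ => 1) (fun i => contDiffAt_pd_top i hf) contDiffAt_const le_rfl
    (Or.inl one_ne_zero) s

lemma contDiffAt_graphMetric (hf : ContDiffAt ℝ ∞ f x) (i j : Fin n) :
    ContDiffAt ℝ ∞ (fun y => graphMetric f y i j) x := by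
  simp_rw [graphMetric_apply]
  have h1 := (contDiff_one_add_norm_sq (n := n)).contDiffAt (x := x)
  exact ((contDiffAt_const.sub (((contDiff_coord i).mul (contDiff_coord j)).contDiffAt.div h1
    (one_add_norm_sq_pos x).ne')).add ((h1.mul (contDiffAt_pd_top i hf)).mul
      (contDiffAt_pd_top j hf)))

lemma pd_graphMetric (hf : ContDiffAt ℝ ∞ f x) (k i j : Fin n) :
    pd k (fun y => graphMetric f y i j) x =
      -((if k = i then 1 else 0) * x j + x i * (if k = j then 1 else 0)) / (1 + ‖x‖ ^ 2) +
        2 * x k * x i * x j / (1 + ‖x‖ ^ 2) ^ 2 + 2 * x k * pd i f x * pd j f x +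
        (1 + ‖x‖ ^ 2) * (pd k (pd i f) x * pd j f x + pd i f x * pd k (pd j f) x) := by
  have hN : DifferentiableAt ℝ (fun y : H n => 1 + ‖y‖ ^ 2) x :=
    contDiff_one_add_norm_sq.contDiffAt.differentiableAt (by simp)
  have h0 := (one_add_norm_sq_pos x).ne'
  have hinv : HasDerivAt (fun t : ℝ => t⁻¹) (-((1 + ‖x‖ ^ 2) ^ 2)⁻¹) (1 + ‖x‖ ^ 2) :=
    hasDerivAt_inv h0
  have hNi : DifferentiableAt ℝ (fun y : H n => (1 + ‖y‖ ^ 2)⁻¹) x := hN.inv h0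
  have hi := coord_differentiableAt (x := x) i
  have hj := coord_differentiableAt (x := x) j
  have hfi : DifferentiableAt ℝ (pd i f) x :=
    (contDiffAt_pd_top i hf).differentiableAt (by simp)
  have hfj : DifferentiableAt ℝ (pd j f) x :=
    (contDiffAt_pd_top j hf).differentiableAt (by simp)
  simp_rw [graphMetric_apply, div_eq_mul_inv]
  rw [pd_add k (by fun_prop) (by fun_prop), pd_sub k (by fun_prop) (by fun_prop),
    pd_mul k (by fun_prop) (by fun_prop), pd_mul k (by fun_prop) (by fun_prop),
    pd_mul k (by fun_prop) (by fun_prop), pd_mul k (by fun_prop) (by fun_prop),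
    pd_comp k hinv hN, pd_one_add_norm_sq, pd_const, pd_coord, pd_coord]
  field_simp
  ring

/-- The quantity under the root in `graphNormal`. -/
lemma graphNormal_eq (y : H n) (s : Fin n) : graphNormal f y s =
    (pd s f y + y s * ∑ i, y i * pd i f y) *
      (√(1 / (1 + ‖y‖ ^ 2) + coNormSq y fun i => pd i f y))⁻¹ := by
  rw [graphNormal, normalPart, div_eq_mul_inv, one_pow]

lemma hasDerivAt_inv_sqrt {t : ℝ} (ht : 0 < t) :
    HasDerivAt (fun t : ℝ => (√t)⁻¹) (-(1 / 2) * (√t)⁻¹ ^ 3) t := by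
  have h0 := (Real.sqrt_pos.2 ht).ne'
  refine ((Real.hasDerivAt_sqrt ht.ne').fun_inv h0).congr_deriv ?_
  field_simp

lemma pd_graphNormal (hf : ContDiffAt ℝ ∞ f x) (i s : Fin n) :
    pd i (fun y => graphNormal f y s) x =
      (pd i (pd s f) x + (if i = s then 1 else 0) * (∑ j, x j * pd j f x) +
        x s * (pd i f x + ∑ j, x j * pd i (pd j f) x)) *
        (√(1 / (1 + ‖x‖ ^ 2) + coNormSq x fun i => pd i f x))⁻¹ +
      (pd s f x + x s * ∑ j, x j * pd j f x) *
        ((√(1 / (1 + ‖x‖ ^ 2) + coNormSq x fun i => pd i f x))⁻¹ ^ 3 *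
          (x i / (1 + ‖x‖ ^ 2) ^ 2 - ∑ j, pd j f x * pd i (pd j f) x -
            (∑ j, x j * pd j f x) * (pd i f x + ∑ j, x j * pd i (pd j f) x))) := by
  have hN : DifferentiableAt ℝ (fun y : H n => 1 + ‖y‖ ^ 2) x :=
    contDiff_one_add_norm_sq.contDiffAt.differentiableAt (by simp)
  have h0 := (one_add_norm_sq_pos x).ne'
  have hd : ∀ j, DifferentiableAt ℝ (pd j f) x := fun j =>
    (contDiffAt_pd_top j hf).differentiableAt (by simp)
  have hc : ∀ j, DifferentiableAt ℝ (fun y : H n => y j) x := fun j => coord_differentiableAt j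
  have hinv : HasDerivAt (fun t : ℝ => 1 / t) (-((1 + ‖x‖ ^ 2) ^ 2)⁻¹) (1 + ‖x‖ ^ 2) := by
    simpa using hasDerivAt_inv h0
  have hm : DifferentiableAt ℝ (fun y : H n => ∑ i, y i * pd i f y) x :=
    DifferentiableAt.fun_sum fun i _ => (hc i).mul (hd i)
  have hP : DifferentiableAt ℝ (fun y => coNormSq y fun i => pd i f y) x :=
    (contDiffAt_coNormSq (fun i => contDiffAt_pd_top i hf) le_rfl).differentiableAt (by simp)
  have hNi : DifferentiableAt ℝ (fun y : H n => 1 / (1 + ‖y‖ ^ 2)) x :=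
    hinv.differentiableAt.comp x hN
  have hQ : DifferentiableAt ℝ (fun y : H n => 1 / (1 + ‖y‖ ^ 2) +
    coNormSq y fun i => pd i f y) x := hNi.fun_add hP
  have hpos : 0 < 1 / (1 + ‖x‖ ^ 2) + coNormSq x fun i => pd i f x := by
    have := coNormSq_nonneg x (fun i => pd i f x)
    positivity
  have hsq : HasDerivAt (fun t : ℝ => (√t)⁻¹)
      (-(1 / 2) * (√(1 / (1 + ‖x‖ ^ 2) + coNormSq x fun i => pd i f x))⁻¹ ^ 3)
      (1 / (1 + ‖x‖ ^ 2) + coNormSq x fun i => pd i f x) := hasDerivAt_inv_sqrt hpos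
  have hpm : pd i (fun y : H n => ∑ j, y j * pd j f y) x =
      pd i f x + ∑ j, x j * pd i (pd j f) x := by
    rw [pd_sum i fun j _ => (hc j).fun_mul (hd j)]
    simp_rw [fun j => pd_mul i (hc j) (hd j), pd_coord, Finset.sum_add_distrib]
    simp
  have hpP : pd i (fun y => coNormSq y fun i => pd i f y) x =
      2 * ∑ j, pd j f x * pd i (pd j f) x +
        2 * (∑ j, x j * pd j f x) * (pd i f x + ∑ j, x j * pd i (pd j f) x) := by
    simp only [coNormSq]
    simp_rw [sq]
    rw [pd_add i (DifferentiableAt.fun_sum fun j _ => (hd j).fun_mul (hd j)) (hm.fun_mul hm),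
      pd_mul i hm hm, hpm, pd_sum i fun j _ => (hd j).fun_mul (hd j)]
    have e : ∑ j, pd i (fun y => pd j f y * pd j f y) x =
        2 * ∑ j, pd j f x * pd i (pd j f) x := by
      rw [Finset.mul_sum]
      refine Finset.sum_congr rfl fun j _ => ?_
      rw [pd_mul i (hd j) (hd j)]
      ring
    rw [e]
    ring
  have hR : DifferentiableAt ℝ (fun y : H n => (√(1 / (1 + ‖y‖ ^ 2) +
      coNormSq y fun i => pd i f y))⁻¹) x :=
    (hQ.sqrt hpos.ne').inv (Real.sqrt_pos.2 hpos).ne'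
  have hL : DifferentiableAt ℝ (fun y : H n => y s * ∑ j, y j * pd j f y) x := (hc s).fun_mul hm
  simp_rw [graphNormal_eq]
  rw [pd_mul i ((hd s).fun_add hL) hR, pd_add i (hd s) hL, pd_mul i (hc s) hm, hpm,
    pd_coord, pd_comp i hsq hQ, pd_add i hNi hP, hpP, pd_comp i hinv hN, pd_one_add_norm_sq]
  field_simp
  ring

/-- The second fundamental form of the graph. -/
def graphSff (f : H n → ℝ) (x : H n) (i l : Fin n) : ℝ :=
  (√(1 / (1 + ‖x‖ ^ 2) + coNormSq x fun i => pd i f x))⁻¹ *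
    (pd i (pd l f) x + (pd i f x * x l + pd l f x * x i) / (1 + ‖x‖ ^ 2) +
      (∑ j, x j * pd j f x) * graphMetric f x i l)

lemma graphSff_symm (hf : ContDiffAt ℝ ∞ f x) (i l : Fin n) :
    graphSff f x i l = graphSff f x l i := by
  rw [graphSff, graphSff, pd_pd_comm i l hf, graphMetric_symm]
  ring

lemma sum_graphMetric_mul_coord (l : Fin n) :
    ∑ m, graphMetric f x l m * x m = x l / (1 + ‖x‖ ^ 2) +
      (1 + ‖x‖ ^ 2) * pd l f x * ∑ m, x m * pd m f x := by
  rw [sum_graphMetric_mul, ← norm_sq_eq_sum]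
  have h0 := (one_add_norm_sq_pos x).ne'
  have : ∑ m, pd m f x * x m = ∑ m, x m * pd m f x :=
    Finset.sum_congr rfl fun m _ => mul_comm _ _
  rw [this]
  field_simp
  ring

lemma sum_graphMetric_mul_lift (l : Fin n) :
    ∑ m, graphMetric f x l m * (pd m f x + x m * ∑ j, x j * pd j f x) =
      pd l f x * (1 + ‖x‖ ^ 2) * (1 / (1 + ‖x‖ ^ 2) + coNormSq x fun i => pd i f x) := by
  have h0 := (one_add_norm_sq_pos x).ne'
  set m₀ := ∑ j, x j * pd j f x with hm
  have : ∀ m, graphMetric f x l m * (pd m f x + x m * m₀) =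
      graphMetric f x l m * pd m f x + m₀ * (graphMetric f x l m * x m) := fun m => by ring
  simp_rw [this, Finset.sum_add_distrib, ← Finset.mul_sum]
  rw [sum_graphMetric_mul_coord, sum_graphMetric_mul, coNormSq, ← hm]
  field_simp
  ring

lemma sum_graphMetric_mul_graphNormal (l : Fin n) :
    ∑ m, graphMetric f x l m * graphNormal f x m =
      pd l f x * (1 + ‖x‖ ^ 2) * √(1 / (1 + ‖x‖ ^ 2) + coNormSq x fun i => pd i f x) := by
  have hpos : 0 < 1 / (1 + ‖x‖ ^ 2) + coNormSq x fun i => pd i f x := by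
    have := coNormSq_nonneg x (fun i => pd i f x)
    positivity
  simp_rw [graphNormal_eq, ← mul_assoc]
  rw [← Finset.sum_mul, sum_graphMetric_mul_lift, mul_assoc, ← div_eq_mul_inv,
    Real.div_sqrt]

/-- Weingarten's equation. In Minkowski space the derivative of the unit normal is tangent to the
graph, equal to A_i^s times the s-th coordinate tangent vector, whose horizontal part is the s-th
unit vector. So the horizontal part of the equation is A_i^s = ∂_i q^s. The proof checks this
against the Hessian expression for h. -/
lemma graphSff_eq_sum (hf : ContDiffAt ℝ ∞ f x) (i l : Fin n) :
    graphSff f x i l = ∑ s, graphMetric f x l s * graphShape f x i s := by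
  have h0 := (one_add_norm_sq_pos x).ne'
  have hpos : 0 < 1 / (1 + ‖x‖ ^ 2) + coNormSq x fun i => pd i f x := by
    have := coNormSq_nonneg x (fun i => pd i f x)
    positivity
  simp only [graphShape, Matrix.of_apply, fun s => pd_graphNormal hf i s]
  set a := (√(1 / (1 + ‖x‖ ^ 2) + coNormSq x fun i => pd i f x))⁻¹ with ha
  set m₀ := ∑ j, x j * pd j f x with hm
  set S₁ := ∑ j, pd j f x * pd i (pd j f) x with hS₁
  set S₂ := ∑ j, x j * pd i (pd j f) x with hS₂
  have e : ∀ s, graphMetric f x l s * ((pd i (pd s f) x + (if i = s then 1 else 0) * m₀ +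
        x s * (pd i f x + S₂)) * a + (pd s f x + x s * m₀) * (a ^ 3 *
        (x i / (1 + ‖x‖ ^ 2) ^ 2 - S₁ - m₀ * (pd i f x + S₂)))) =
      a * (graphMetric f x l s * pd i (pd s f) x) +
      (if i = s then a * m₀ * graphMetric f x l s else 0) +
      a * (pd i f x + S₂) * (graphMetric f x l s * x s) +
      (a ^ 3 * (x i / (1 + ‖x‖ ^ 2) ^ 2 - S₁ - m₀ * (pd i f x + S₂))) *
      (graphMetric f x l s * (pd s f x + x s * m₀)) := by
    intro s
    split_ifs <;> ring
  have ha2 : a ^ 2 * (1 / (1 + ‖x‖ ^ 2) + coNormSq x fun i => pd i f x) = 1 := by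
    rw [ha, inv_pow, Real.sq_sqrt hpos.le, inv_mul_cancel₀ hpos.ne']
  simp_rw [e, Finset.sum_add_distrib, ← Finset.mul_sum]
  rw [sum_graphMetric_mul_lift, sum_graphMetric_mul_coord, sum_graphMetric_mul, graphSff,
    ← ha, ← hm, ← hS₁, ← hS₂, Finset.sum_ite_eq, if_pos (Finset.mem_univ _),
    graphMetric_symm x f l i, pd_pd_comm i l hf]
  have e2 : a ^ 3 * (x i / (1 + ‖x‖ ^ 2) ^ 2 - S₁ - m₀ * (pd i f x + S₂)) *
      (pd l f x * (1 + ‖x‖ ^ 2) * (1 / (1 + ‖x‖ ^ 2) + coNormSq x fun i => pd i f x)) =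
      a * (x i / (1 + ‖x‖ ^ 2) ^ 2 - S₁ - m₀ * (pd i f x + S₂)) *
      (pd l f x * (1 + ‖x‖ ^ 2)) := by
    linear_combination (a * (x i / (1 + ‖x‖ ^ 2) ^ 2 - S₁ - m₀ * (pd i f x + S₂)) *
      (pd l f x * (1 + ‖x‖ ^ 2))) * ha2
  rw [e2]
  field_simp
  ring

lemma isUnit_det_graphMetric (f : H n → ℝ) (x : H n) : IsUnit (graphMetric f x).det :=
  (det_graphMetric_pos x f).ne'.isUnit

/-- The Christoffel symbols of the first kind of the graph metric. -/
lemma christoffel_lower_graphMetric (hf : ContDiffAt ℝ ∞ f x) (m i j : Fin n) :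
    (1 / 2) * (pd i (fun y => graphMetric f y m j) x + pd j (fun y => graphMetric f y m i) x -
      pd m (fun y => graphMetric f y i j) x) =
    ∑ r, graphMetric f x m r * (graphSff f x i j * graphNormal f x r -
      x r * graphMetric f x i j) := by
  have h0 := (one_add_norm_sq_pos x).ne'
  have hpos : 0 < 1 / (1 + ‖x‖ ^ 2) + coNormSq x fun i => pd i f x := by
    have := coNormSq_nonneg x (fun i => pd i f x)
    positivity
  have e : ∀ r, graphMetric f x m r * (graphSff f x i j * graphNormal f x r -
      x r * graphMetric f x i j) = graphSff f x i j * (graphMetric f x m r * graphNormal f x r) -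
      graphMetric f x i j * (graphMetric f x m r * x r) := fun r => by ring
  simp_rw [e, Finset.sum_sub_distrib, ← Finset.mul_sum]
  rw [sum_graphMetric_mul_graphNormal, sum_graphMetric_mul_coord, graphSff,
    pd_graphMetric hf, pd_graphMetric hf, pd_graphMetric hf, pd_pd_comm j i hf,
    pd_pd_comm m i hf, pd_pd_comm m j hf]
  set r := √(1 / (1 + ‖x‖ ^ 2) + coNormSq x fun i => pd i f x) with hr
  have hr0 : r ≠ 0 := (Real.sqrt_pos.2 hpos).ne'
  rw [graphMetric_apply x f i j]
  simp only [eq_comm (a := j) (b := i), eq_comm (a := m) (b := i), eq_comm (a := m) (b := j)]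
  field_simp
  ring

/-- Γ^l_{ij} is minus the Hessian on the graph of the coordinate x^l. That coordinate is linear on
Minkowski space, so its Hessian on hyperbolic space is x^l times the metric, and restriction to the
graph adds only the second fundamental form times the normal derivative q^l. -/
lemma christoffel_graphMetric (hf : ContDiffAt ℝ ∞ f x) (l i j : Fin n) :
    christoffel (graphMetric f) l i j x =
      graphSff f x i j * graphNormal f x l - x l * graphMetric f x i j := by
  have h1 : christoffel (graphMetric f) l i j x = ∑ m, (graphMetric f x)⁻¹ l m *
      ∑ r, graphMetric f x m r * (graphSff f x i j * graphNormal f x r -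
        x r * graphMetric f x i j) := by
    rw [christoffel, Finset.mul_sum]
    refine Finset.sum_congr rfl fun m _ => ?_
    rw [← christoffel_lower_graphMetric hf]
    ring
  have h2 := Matrix.nonsing_inv_mul _ (isUnit_det_graphMetric f x)
  have h3 := congrArg (fun M : Matrix (Fin n) (Fin n) ℝ => M.mulVec (fun r =>
    graphSff f x i j * graphNormal f x r - x r * graphMetric f x i j) l) h2
  simp only [Matrix.one_mulVec, ← Matrix.mulVec_mulVec] at h3
  rw [h1, ← h3]
  rfl

lemma christoffel_hypMetric (l i j : Fin n) :
    christoffel (hypMetric n) l i j x = - x l * hypMetric n x i j := by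
  rw [hypMetric_eq_graphMetric, christoffel_graphMetric contDiffAt_const]
  have : graphNormal (fun _ : H n => (0 : ℝ)) x l = 0 := by
    simp [graphNormal_eq, pd_const]
  rw [this]; ring

end Gauss

/-! ### Codazzi and Gauss equations; the Gauss-Bonnet curvature of a graph -/

section Gauss

variable {n : ℕ} {f : H n → ℝ} {x : H n}

lemma contDiffAt_graphShape (hf : ContDiffAt ℝ ∞ f x) (i s : Fin n) :
    ContDiffAt ℝ ∞ (fun y => graphShape f y i s) x :=
  contDiffAt_pd_top i (contDiffAt_graphNormal hf s)

lemma pd_graphShape_comm (hf : ContDiffAt ℝ ∞ f x) (i j s : Fin n) :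
    pd i (fun y => graphShape f y j s) x = pd j (fun y => graphShape f y i s) x :=
  pd_pd_comm i j (contDiffAt_graphNormal hf s)

lemma pd_graphMetric_eq_christoffel (hf : ContDiffAt ℝ ∞ f x) (i j l : Fin n) :
    pd i (fun y => graphMetric f y j l) x =
      ∑ m, (graphMetric f x j m * christoffel (graphMetric f) m i l x +
        graphMetric f x l m * christoffel (graphMetric f) m i j x) := by
  have h1 := christoffel_lower_graphMetric hf j i l
  have h2 := christoffel_lower_graphMetric hf l i j
  have hs : ∀ k a b : Fin n, pd k (fun y => graphMetric f y a b) x =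
      pd k (fun y => graphMetric f y b a) x := fun k a b => by
    simp_rw [graphMetric_symm _ f a b]
  simp_rw [christoffel_graphMetric hf, Finset.sum_add_distrib]
  rw [← h1, ← h2, hs i l j, hs l j i, hs j l i]
  ring

lemma sum_graphSff_mul_graphShape_symm (i j : Fin n) (hf : ContDiffAt ℝ ∞ f x) :
    ∑ r, graphSff f x i r * graphShape f x j r = ∑ r, graphSff f x j r * graphShape f x i r := by
  simp_rw [graphSff_eq_sum hf, Finset.sum_mul]
  rw [Finset.sum_comm]
  refine Finset.sum_congr rfl fun r _ => Finset.sum_congr rfl fun s _ => ?_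
  rw [graphMetric_symm]; ring

/-- The Codazzi equation, with a Christoffel symbol contracted. -/
lemma sum_graphMetric_christoffel_shape (hf : ContDiffAt ℝ ∞ f x) (i j l : Fin n) :
    ∑ r, ∑ m, graphMetric f x l m * christoffel (graphMetric f) m i r x * graphShape f x j r =
    ∑ r, ∑ m, graphMetric f x l m * christoffel (graphMetric f) m j r x * graphShape f x i r := by
  -- The formula for Γ reduces both sides to the third fundamental form h(·, A·) and to h itself,
  -- which are symmetric.
  have e : ∀ a b, ∑ r, ∑ m, graphMetric f x l m * christoffel (graphMetric f) m a r x *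
        graphShape f x b r =
      (∑ r, graphSff f x a r * graphShape f x b r) * (∑ m, graphMetric f x l m * graphNormal f x m)
      - (∑ r, graphMetric f x a r * graphShape f x b r) * ∑ m, graphMetric f x l m * x m := by
    intro a b
    simp_rw [christoffel_graphMetric hf]
    rw [Finset.sum_mul_sum, Finset.sum_mul_sum, ← Finset.sum_sub_distrib]
    refine Finset.sum_congr rfl fun r _ => ?_
    rw [← Finset.sum_sub_distrib]
    exact Finset.sum_congr rfl fun m _ => by ring
  rw [e, e, ← graphSff_eq_sum hf, ← graphSff_eq_sum hf, sum_graphSff_mul_graphShape_symm i j hf,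
    graphSff_symm hf]

lemma eventually_graphSff_eq (hf' : ∀ᶠ y in 𝓝 x, ContDiffAt ℝ ∞ f y) (j l : Fin n) :
    (fun y => graphSff f y j l) =ᶠ[𝓝 x]
      fun y => ∑ r, graphMetric f y l r * graphShape f y j r :=
  hf'.mono fun _ hy => graphSff_eq_sum hy j l

lemma contDiffAt_graphSff (hf' : ∀ᶠ y in 𝓝 x, ContDiffAt ℝ ∞ f y) (j l : Fin n) :
    ContDiffAt ℝ ∞ (fun y => graphSff f y j l) x :=
  (ContDiffAt.sum fun r _ => (contDiffAt_graphMetric hf'.self_of_nhds l r).mul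
    (contDiffAt_graphShape hf'.self_of_nhds j r)).congr_of_eventuallyEq (eventually_graphSff_eq hf' j l)

/-- The Codazzi equation. -/
lemma codazzi_graph (hf' : ∀ᶠ y in 𝓝 x, ContDiffAt ℝ ∞ f y) (i j l : Fin n) :
    pd i (fun y => graphSff f y j l) x - pd j (fun y => graphSff f y i l) x +
      ∑ m, (graphSff f x i m * christoffel (graphMetric f) m j l x -
        graphSff f x j m * christoffel (graphMetric f) m i l x) = 0 := by
  have hf := hf'.self_of_nhds
  have hg : ∀ a b, DifferentiableAt ℝ (fun y => graphMetric f y a b) x := fun a b =>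
    (contDiffAt_graphMetric hf a b).differentiableAt (by simp)
  have hA : ∀ a b, DifferentiableAt ℝ (fun y => graphShape f y a b) x := fun a b =>
    (contDiffAt_graphShape hf a b).differentiableAt (by simp)
  -- Differentiate h_{bl} = g_{lr} A_b^r, expressing ∂g by Christoffel symbols. The term g_{lr} ∂_a
  -- A_b^r is symmetric in a and b because A = ∂q, and so drops out of the difference.
  have e : ∀ a b, pd a (fun y => graphSff f y b l) x =
      ∑ r, ∑ m, graphMetric f x l m * christoffel (graphMetric f) m a r x * graphShape f x b r +
      ∑ m, graphSff f x b m * christoffel (graphMetric f) m a l x +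
      ∑ r, graphMetric f x l r * pd a (fun y => graphShape f y b r) x := by
    intro a b
    rw [pd_congr a (eventually_graphSff_eq hf' b l),
      pd_sum a fun r _ => (hg l r).fun_mul (hA b r)]
    simp_rw [fun r => pd_mul a (hg l r) (hA b r), Finset.sum_add_distrib]
    congr 1
    have e1 : ∀ m, graphSff f x b m * christoffel (graphMetric f) m a l x =
        ∑ r, graphMetric f x r m * christoffel (graphMetric f) m a l x * graphShape f x b r := by
      intro m
      rw [graphSff_eq_sum hf, Finset.sum_mul]
      exact Finset.sum_congr rfl fun r _ => by rw [graphMetric_symm x f m r]; ring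
    simp_rw [e1]
    rw [Finset.sum_comm (f := fun m r => graphMetric f x r m *
      christoffel (graphMetric f) m a l x * graphShape f x b r), ← Finset.sum_add_distrib]
    refine Finset.sum_congr rfl fun r _ => ?_
    rw [pd_graphMetric_eq_christoffel hf, Finset.sum_mul, ← Finset.sum_add_distrib]
    exact Finset.sum_congr rfl fun m _ => by ring
  rw [e, e, sum_graphMetric_christoffel_shape hf i j l, Finset.sum_sub_distrib]
  simp_rw [pd_graphShape_comm hf i j]
  ring

/-- The Gauss equation. -/
lemma riem_graphMetric (hf' : ∀ᶠ y in 𝓝 x, ContDiffAt ℝ ∞ f y) (i j s l : Fin n) :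
    riem (graphMetric f) i j s l x =
      graphSff f x j l * graphShape f x i s - graphSff f x i l * graphShape f x j s -
      (if i = s then 1 else 0) * graphMetric f x j l +
      (if j = s then 1 else 0) * graphMetric f x i l := by
  have hf := hf'.self_of_nhds
  have hg : ∀ a b, DifferentiableAt ℝ (fun y => graphMetric f y a b) x := fun a b =>
    (contDiffAt_graphMetric hf a b).differentiableAt (by simp)
  have hh : ∀ a b, DifferentiableAt ℝ (fun y => graphSff f y a b) x := fun a b =>
    (contDiffAt_graphSff hf' a b).differentiableAt (by simp)
  have hq : DifferentiableAt ℝ (fun y => graphNormal f y s) x :=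
    (contDiffAt_graphNormal hf s).differentiableAt (by simp)
  have hc := coord_differentiableAt (x := x) s
  -- In the curvature, the coefficient of q^s is the Codazzi expression and that of x^s expresses
  -- that ∇g = 0 without torsion; both vanish. What remains comes from ∂_a q^s = A_a^s and ∂_a x^s =
  -- δ_a^s.
  have hΓ : ∀ a b, pd a (christoffel (graphMetric f) s b l) x =
      pd a (fun y => graphSff f y b l) x * graphNormal f x s +
      graphSff f x b l * graphShape f x a s -
      ((if a = s then 1 else 0) * graphMetric f x b l +
        x s * pd a (fun y => graphMetric f y b l) x) := by
    intro a b
    rw [pd_congr a (hf'.mono fun y hy =>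
      christoffel_graphMetric hy s b l), pd_sub a ((hh b l).fun_mul hq) (hc.fun_mul (hg b l)),
      pd_mul a (hh b l) hq, pd_mul a hc (hg b l), pd_coord]
    rfl
  have hprod : ∑ m, (christoffel (graphMetric f) s i m x * christoffel (graphMetric f) m j l x -
      christoffel (graphMetric f) s j m x * christoffel (graphMetric f) m i l x) =
      graphNormal f x s * (∑ m, (graphSff f x i m * christoffel (graphMetric f) m j l x -
        graphSff f x j m * christoffel (graphMetric f) m i l x)) -
      x s * ∑ m, (graphMetric f x i m * christoffel (graphMetric f) m j l x -
        graphMetric f x j m * christoffel (graphMetric f) m i l x) := by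
    rw [Finset.mul_sum, Finset.mul_sum, ← Finset.sum_sub_distrib]
    refine Finset.sum_congr rfl fun m _ => ?_
    rw [christoffel_graphMetric hf s i m, christoffel_graphMetric hf s j m]
    ring
  have hcod := codazzi_graph hf' i j l
  have hcomp : pd i (fun y => graphMetric f y j l) x - pd j (fun y => graphMetric f y i l) x +
      ∑ m, (graphMetric f x i m * christoffel (graphMetric f) m j l x -
        graphMetric f x j m * christoffel (graphMetric f) m i l x) = 0 := by
    rw [pd_graphMetric_eq_christoffel hf, pd_graphMetric_eq_christoffel hf,
      ← Finset.sum_sub_distrib, ← Finset.sum_add_distrib]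
    refine Finset.sum_eq_zero fun m _ => ?_
    have : christoffel (graphMetric f) m i j x = christoffel (graphMetric f) m j i x := by
      rw [christoffel_graphMetric hf, christoffel_graphMetric hf, graphSff_symm hf,
        graphMetric_symm]
    rw [this]; ring
  rw [riem, hΓ, hΓ, hprod]
  linear_combination graphNormal f x s * hcod - x s * hcomp

lemma sum_graphMetric_mul_inv (j l : Fin n) :
    ∑ m, graphMetric f x j m * (graphMetric f x)⁻¹ m l = if j = l then 1 else 0 := by
  have := congrFun (congrFun (Matrix.mul_nonsing_inv _ (isUnit_det_graphMetric f x)) j) l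
  rwa [Matrix.mul_apply, Matrix.one_apply] at this

lemma sum_inv_mul_graphMetric (j l : Fin n) :
    ∑ m, (graphMetric f x)⁻¹ j m * graphMetric f x m l = if j = l then 1 else 0 := by
  have := congrFun (congrFun (Matrix.nonsing_inv_mul _ (isUnit_det_graphMetric f x)) j) l
  rwa [Matrix.mul_apply, Matrix.one_apply] at this

lemma graphMetric_inv_symm (i j : Fin n) :
    (graphMetric f x)⁻¹ i j = (graphMetric f x)⁻¹ j i := by
  have h : (graphMetric f x).IsSymm := by
    ext a b; exact graphMetric_symm x f b a
  have := h.inv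
  exact (congrFun (congrFun this i) j).symm

lemma sum_graphSff_mul_inv (hf : ContDiffAt ℝ ∞ f x) (j l : Fin n) :
    ∑ m, graphSff f x j m * (graphMetric f x)⁻¹ m l = graphShape f x j l := by
  simp_rw [graphSff_eq_sum hf, Finset.sum_mul]
  rw [Finset.sum_comm]
  have : ∀ s, ∑ m, graphMetric f x m s * graphShape f x j s * (graphMetric f x)⁻¹ m l =
      graphShape f x j s * if s = l then 1 else 0 := by
    intro s
    rw [← sum_graphMetric_mul_inv, Finset.mul_sum]
    exact Finset.sum_congr rfl fun m _ => by rw [graphMetric_symm]; ring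
  simp [this]

/-- The correction added to the Riemann tensor cancels exactly the contribution of the ambient
curvature -1, leaving the 2 × 2 minors of the shape operator. -/
lemma modRiem_graphMetric (hf' : ∀ᶠ y in 𝓝 x, ContDiffAt ℝ ∞ f y) (i j s l : Fin n) :
    modRiem (graphMetric f) i j s l x =
      graphShape f x i s * graphShape f x j l - graphShape f x i l * graphShape f x j s := by
  have e : ∑ m, riem (graphMetric f) i j s m x * (graphMetric f x)⁻¹ m l =
      graphShape f x i s * (∑ m, graphSff f x j m * (graphMetric f x)⁻¹ m l) -
      graphShape f x j s * (∑ m, graphSff f x i m * (graphMetric f x)⁻¹ m l) -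
      (if i = s then 1 else 0) * (∑ m, graphMetric f x j m * (graphMetric f x)⁻¹ m l) +
      (if j = s then 1 else 0) * (∑ m, graphMetric f x i m * (graphMetric f x)⁻¹ m l) := by
    simp_rw [riem_graphMetric hf', Finset.mul_sum]
    rw [← Finset.sum_sub_distrib, ← Finset.sum_sub_distrib, ← Finset.sum_add_distrib]
    exact Finset.sum_congr rfl fun m _ => by ring
  have hf := hf'.self_of_nhds
  rw [modRiem, e, sum_graphSff_mul_inv hf, sum_graphSff_mul_inv hf, sum_graphMetric_mul_inv,
    sum_graphMetric_mul_inv]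
  ring

lemma prod_modRiem_sum {m : ℕ} (hf' : ∀ᶠ y in 𝓝 x, ContDiffAt ℝ ∞ f y) (I : Fin m × Fin 2 → Fin n)
    (D : (Fin m × Fin 2 → Fin n) → ℝ)
    (hD : ∀ a J, D (J ∘ Equiv.swap (a, 0) (a, 1)) = - D J) :
    ∑ J : Fin m × Fin 2 → Fin n, D J * ∏ a : Fin m,
      modRiem (graphMetric f) (I (a, 0)) (I (a, 1)) (J (a, 0)) (J (a, 1)) x =
    2 ^ m * ∑ J : Fin m × Fin 2 → Fin n, D J * ∏ c, graphShape f x (I c) (J c) := by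
  rw [← sum_mul_prod_minor _ _ _ hD]
  refine Finset.sum_congr rfl fun J _ => ?_
  congr 1
  exact Finset.prod_congr rfl fun a _ => modRiem_graphMetric hf' _ _ _ _

/-- The Gauss-Bonnet curvature of a graph is a mixed discriminant of the shape operator. -/
lemma modGaussBonnet_graphMetric (hf' : ∀ᶠ y in 𝓝 x, ContDiffAt ℝ ∞ f y) (k : ℕ) :
    modGaussBonnet (graphMetric f) k x =
      mixedDisc (fun _ : Fin k × Fin 2 => graphShape f x) := by
  rw [modGaussBonnet, mixedDisc, Finset.mul_sum]
  refine Finset.sum_congr rfl fun I _ => ?_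
  rw [prod_modRiem_sum hf' I (fun J => genDelta I J) fun a J => ?_]
  · field_simp
  · rw [genDelta_comp_right, Equiv.Perm.sign_swap (by simp)]
    simp

end Gauss

/-! ### The flux field of the mass -/

section Flux

variable {n : ℕ}

/-- The index set for the `2k` slots of the flux; the slot `Sum.inr 0` is the free one. -/
abbrev Slots (k : ℕ) : Type := (Fin (k - 1) × Fin 2) ⊕ Fin 2

/-- `½ δ^{i i₂ … i_{2k}}_{p j₂ … j_{2k}} αᵢ q^p A_{i₂}^{j₂} ⋯ A_{i_{2k}}^{j_{2k}}`. -/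
def fluxForm (k : ℕ) (A : Matrix (Fin n) (Fin n) ℝ) (q α : Fin n → ℝ) : ℝ :=
  (1 / 2) * mixedDisc (Function.update (fun _ : Slots k => A) (Sum.inr 0) (Matrix.vecMulVec α q))

lemma fluxForm_eq (k : ℕ) (A : Matrix (Fin n) (Fin n) ℝ) (q α : Fin n → ℝ) :
    fluxForm k A q α = (1 / 2) * ∑ I : Slots k → Fin n, ∑ J : Slots k → Fin n,
      genDelta I J * (α (I (Sum.inr 0)) * (q (J (Sum.inr 0)) *
        ∏ a ∈ Finset.univ.erase (Sum.inr 0), A (I a) (J a))) := by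
  rw [fluxForm, mixedDisc]
  congr 1
  refine Finset.sum_congr rfl fun I _ => Finset.sum_congr rfl fun J _ => ?_
  rw [← Finset.mul_prod_erase _ _ (Finset.mem_univ (Sum.inr 0 : Slots k))]
  simp only [Function.update_self, Matrix.vecMulVec_apply]
  rw [mul_assoc]
  congr 3
  refine Finset.prod_congr rfl fun a ha => ?_
  rw [Function.update_of_ne (Finset.ne_of_mem_erase ha)]

lemma fluxForm_eq_sum (k : ℕ) (A : Matrix (Fin n) (Fin n) ℝ) (q α : Fin n → ℝ) :
    fluxForm k A q α = ∑ i, α i * fluxForm k A q (Pi.single i 1) := by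
  simp_rw [fluxForm_eq, Finset.mul_sum]
  conv_rhs => rw [Finset.sum_comm]
  refine Finset.sum_congr rfl fun I _ => ?_
  conv_rhs => rw [Finset.sum_comm]
  refine Finset.sum_congr rfl fun J _ => ?_
  simp only [Pi.single_apply, ite_mul, one_mul, zero_mul, mul_ite, mul_zero]
  rw [Finset.sum_ite_eq, if_pos (Finset.mem_univ _)]
  ring

lemma fluxForm_smul_right (k : ℕ) (A : Matrix (Fin n) (Fin n) ℝ) (q α : Fin n → ℝ) (μ : ℝ) :
    fluxForm k A q (μ • α) = μ * fluxForm k A q α := by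
  rw [fluxForm_eq_sum, fluxForm_eq_sum k A q α, Finset.mul_sum]
  exact Finset.sum_congr rfl fun i _ => by simp; ring

/-- The flux form is even in the normal and ignores multiples of `α` in the shape operator. -/
lemma fluxForm_congr {k : ℕ} (hk : 1 ≤ k) {A B : Matrix (Fin n) (Fin n) ℝ} {q r α : Fin n → ℝ}
    {σ : ℝ} (hσ : σ ^ 2 = 1) (hq : r = σ • q) (v : Fin n → ℝ)
    (hB : B = σ • A + Matrix.vecMulVec α v) : fluxForm k B r α = fluxForm k A q α := by
  have h1 : fluxForm k B r α = fluxForm k (σ • A) (σ • q) α := by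
    rw [fluxForm, fluxForm, hq]
    congr 1
    refine mixedDisc_add_vecMulVec _ _ (Sum.inr 0) α (σ • q) (fun _ => v) (by simp) (by simp)
      fun a ha => ?_
    simp [Function.update_of_ne ha, hB]
  have h2 : (Function.update (fun _ : Slots k => σ • A) (Sum.inr 0)
      (Matrix.vecMulVec α (σ • q))) = fun a => σ •
        Function.update (fun _ : Slots k => A) (Sum.inr 0) (Matrix.vecMulVec α q) a := by
    ext a i j
    by_cases h : a = Sum.inr 0
    · subst h; simp [Matrix.vecMulVec_apply]
    · simp [Function.update_of_ne h]
  rw [h1, fluxForm, fluxForm, h2, mixedDisc_smul]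
  -- The number of slots is even, so the sign σ, taken once from the normal and 2k - 1 times from
  -- the shape operator, drops out.
  have : Fintype.card (Slots k) = 2 * k := by
    simp; omega
  rw [this, pow_mul, hσ, one_pow, one_mul]

/-- The vector field whose flux is the mass. -/
def gbcField (f : H n → ℝ) (k : ℕ) (x : H n) : H n :=
  WithLp.toLp 2 fun i => fluxForm k (graphShape f x) (graphNormal f x) (Pi.single i 1)

lemma sum_mul_gbcField (f : H n → ℝ) (k : ℕ) (x : H n) (α : Fin n → ℝ) :
    ∑ i, α i * gbcField f k x i = fluxForm k (graphShape f x) (graphNormal f x) α :=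
  (fluxForm_eq_sum _ _ _ _).symm

lemma pd_prod {ι : Type*} [DecidableEq ι] {s : Finset ι} {F : ι → H n → ℝ} {x : H n} (i : Fin n)
    (hF : ∀ a ∈ s, DifferentiableAt ℝ (F a) x) :
    pd i (fun y => ∏ a ∈ s, F a y) x =
      ∑ a ∈ s, (∏ b ∈ s.erase a, F b x) * pd i (F a) x := by
  rw [pd, (HasFDerivAt.finsetProd fun a ha => (hF a ha).hasFDerivAt).fderiv]
  simp [pd]

lemma contDiffAt_fluxForm {k : ℕ} {A : H n → Matrix (Fin n) (Fin n) ℝ} {q α : H n → Fin n → ℝ}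
    {x : H n} {m : WithTop ℕ∞} (hA : ∀ i j, ContDiffAt ℝ m (fun y => A y i j) x)
    (hq : ∀ i, ContDiffAt ℝ m (fun y => q y i) x) (hα : ∀ i, ContDiffAt ℝ m (fun y => α y i) x) :
    ContDiffAt ℝ m (fun y => fluxForm k (A y) (q y) (α y)) x := by
  simp_rw [fluxForm_eq]
  refine contDiffAt_const.mul (ContDiffAt.sum fun I _ => ContDiffAt.sum fun J _ =>
    contDiffAt_const.mul ((hα _).mul ((hq _).mul (contDiffAt_prod fun a _ => hA _ _))))

lemma continuousWithinAt_fluxForm {X : Type*} [TopologicalSpace X] {k : ℕ}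
    {A : X → Matrix (Fin n) (Fin n) ℝ} {q α : X → Fin n → ℝ}
    {x : X} {s : Set X} (hA : ∀ i j, ContinuousWithinAt (fun y => A y i j) s x)
    (hq : ∀ i, ContinuousWithinAt (fun y => q y i) s x)
    (hα : ∀ i, ContinuousWithinAt (fun y => α y i) s x) :
    ContinuousWithinAt (fun y => fluxForm k (A y) (q y) (α y)) s x := by
  simp_rw [fluxForm_eq]
  exact continuousWithinAt_const.mul (tendsto_finsetSum _ fun I _ => tendsto_finsetSum _ fun J _ =>
    tendsto_const_nhds.mul ((hα _).mul ((hq _).mul (tendsto_finsetProd _ fun a _ => hA _ _))))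

variable {f : H n → ℝ} {x : H n}

lemma contDiffAt_gbcField (hf : ContDiffAt ℝ ∞ f x) (k : ℕ) :
    ContDiffAt ℝ ∞ (gbcField f k) x := by
  rw [contDiffAt_piLp]
  exact fun i => contDiffAt_fluxForm (fun a b => contDiffAt_graphShape hf a b)
    (fun a => contDiffAt_graphNormal hf a) fun _ => contDiffAt_const

/-- The divergence of the flux field. -/
lemma sum_pd_gbcField (hf : ContDiffAt ℝ ∞ f x) (k : ℕ) :
    ∑ i, pd i (fun y => gbcField f k y i) x =
      (1 / 2) * mixedDisc (fun _ : Slots k => graphShape f x) := by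
  have hA : ∀ i j, DifferentiableAt ℝ (fun y => graphShape f y i j) x := fun i j =>
    (contDiffAt_graphShape hf i j).differentiableAt (by simp)
  have hq : ∀ i, DifferentiableAt ℝ (fun y => graphNormal f y i) x := fun i =>
    (contDiffAt_graphNormal hf i).differentiableAt (by simp)
  set o : Slots k := Sum.inr 0 with ho
  have hprod : ∀ I J : Slots k → Fin n, DifferentiableAt ℝ
      (fun y => ∏ a ∈ Finset.univ.erase o, graphShape f y (I a) (J a)) x := fun I J =>
    (HasFDerivAt.finsetProd fun a _ => (hA (I a) (J a)).hasFDerivAt).differentiableAt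
  have hterm : ∀ i, pd i (fun y => gbcField f k y i) x = (1 / 2) *
      ∑ I : Slots k → Fin n, ∑ J : Slots k → Fin n, genDelta I J *
        ((if I o = i then 1 else 0) * pd i (fun y => graphNormal f y (J o) *
          ∏ a ∈ Finset.univ.erase o, graphShape f y (I a) (J a)) x) := by
    intro i
    have e : (fun y => gbcField f k y i) = fun y => (1 / 2) *
      ∑ I : Slots k → Fin n, ∑ J : Slots k → Fin n, genDelta I J *
        ((if I o = i then 1 else 0) * (graphNormal f y (J o) *
          ∏ a ∈ Finset.univ.erase o, graphShape f y (I a) (J a))) := by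
      ext y
      change fluxForm k _ _ _ = _
      rw [fluxForm_eq]
      simp only [Pi.single_apply]
      rfl
    have hd : ∀ I J : Slots k → Fin n, DifferentiableAt ℝ (fun y => graphNormal f y (J o) *
          ∏ a ∈ Finset.univ.erase o, graphShape f y (I a) (J a)) x := fun I J =>
      (hq _).fun_mul (hprod I J)
    rw [e, pd_const_mul, pd_sum]
    · congr 1
      refine Finset.sum_congr rfl fun I _ => ?_
      rw [pd_sum]
      · refine Finset.sum_congr rfl fun J _ => ?_
        rw [pd_const_mul i _ ((hd I J).const_mul _), pd_const_mul i _ (hd I J)]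
      · exact fun J _ => ((hd I J).const_mul _).const_mul _
    · exact fun I _ => DifferentiableAt.fun_sum fun J _ => ((hd I J).const_mul _).const_mul _
    · exact DifferentiableAt.fun_sum fun I _ =>
        DifferentiableAt.fun_sum fun J _ => ((hd I J).const_mul _).const_mul _
  simp_rw [hterm]
  rw [← Finset.mul_sum]
  congr 1
  rw [Finset.sum_comm]
  -- Product rule: when the derivative falls on q it produces one more factor A, completing the
  -- mixed discriminant; the other terms contain a derivative of A.
  have hpd : ∀ I J : Slots k → Fin n, ∑ i, genDelta I J *
        ((if I o = i then 1 else 0) * pd i (fun y => graphNormal f y (J o) *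
          ∏ a ∈ Finset.univ.erase o, graphShape f y (I a) (J a)) x) =
      genDelta I J * ∏ a, graphShape f x (I a) (J a) +
      ∑ a ∈ Finset.univ.erase o, genDelta I J * (graphNormal f x (J o) *
        ((∏ b ∈ (Finset.univ.erase o).erase a, graphShape f x (I b) (J b)) *
          pd (I o) (fun y => graphShape f y (I a) (J a)) x)) := by
    intro I J
    simp only [ite_mul, one_mul, zero_mul, mul_ite, mul_zero]
    rw [Finset.sum_ite_eq, if_pos (Finset.mem_univ _), pd_mul _ (hq _) (hprod I J),
      pd_prod _ fun a _ => hA _ _, mul_add]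
    congr 1
    · rw [← Finset.mul_prod_erase _ _ (Finset.mem_univ o)]
      rfl
    · rw [Finset.mul_sum, Finset.mul_sum]
  -- Since A = ∂q, the derivative of A is symmetric in its two lower indices, whereas the delta is
  -- antisymmetric in them: exchanging the free slot with slot a shows that the sum equals its
  -- negative.
  have hswap : ∀ J : Slots k → Fin n, ∀ a ∈ Finset.univ.erase o,
      ∑ I : Slots k → Fin n, genDelta I J * (graphNormal f x (J o) *
        ((∏ b ∈ (Finset.univ.erase o).erase a, graphShape f x (I b) (J b)) *
          pd (I o) (fun y => graphShape f y (I a) (J a)) x)) = 0 := by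
    intro J a ha
    have hne : a ≠ o := Finset.ne_of_mem_erase ha
    rw [← self_eq_neg, ← Finset.sum_neg_distrib]
    refine Fintype.sum_equiv ((Equiv.swap o a).arrowCongr (Equiv.refl (Fin n))) _ _ fun I => ?_
    have e1 : ((Equiv.swap o a).arrowCongr (Equiv.refl (Fin n))) I = I ∘ Equiv.swap o a := by
      ext c; simp [Equiv.arrowCongr]
    rw [e1, genDelta_comp_left, Equiv.Perm.sign_swap hne.symm]
    have e2 : ∏ b ∈ (Finset.univ.erase o).erase a,
        graphShape f x ((I ∘ Equiv.swap o a) b) (J b) =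
        ∏ b ∈ (Finset.univ.erase o).erase a, graphShape f x (I b) (J b) := by
      refine Finset.prod_congr rfl fun b hb => ?_
      have hb1 : b ≠ a := Finset.ne_of_mem_erase hb
      have hb2 : b ≠ o := Finset.ne_of_mem_erase (Finset.mem_of_mem_erase hb)
      rw [Function.comp_apply, Equiv.swap_apply_of_ne_of_ne hb2 hb1]
    rw [e2]
    simp only [Function.comp_apply, Equiv.swap_apply_left, Equiv.swap_apply_right]
    rw [pd_graphShape_comm hf]
    simp
  rw [mixedDisc]
  have : ∀ I : Slots k → Fin n, ∑ i, ∑ J : Slots k → Fin n, genDelta I J *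
        ((if I o = i then 1 else 0) * pd i (fun y => graphNormal f y (J o) *
          ∏ a ∈ Finset.univ.erase o, graphShape f y (I a) (J a)) x) =
      ∑ J : Slots k → Fin n, (genDelta I J * ∏ a, graphShape f x (I a) (J a) +
      ∑ a ∈ Finset.univ.erase o, genDelta I J * (graphNormal f x (J o) *
        ((∏ b ∈ (Finset.univ.erase o).erase a, graphShape f x (I b) (J b)) *
          pd (I o) (fun y => graphShape f y (I a) (J a)) x))) := by
    intro I
    rw [Finset.sum_comm]
    exact Finset.sum_congr rfl fun J _ => hpd I J
  simp_rw [this, Finset.sum_add_distrib]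
  conv_rhs => rw [← add_zero (∑ I : Slots k → Fin n, _)]
  congr 1
  rw [Finset.sum_comm]
  refine Finset.sum_eq_zero fun J _ => ?_
  rw [Finset.sum_comm]
  exact Finset.sum_eq_zero fun a ha => hswap J a ha

lemma sum_pd_gbcField_eq_modGaussBonnet (hf : ∀ᶠ y in 𝓝 x, ContDiffAt ℝ ∞ f y) {k : ℕ}
    (hk : 1 ≤ k) :
    ∑ i, pd i (fun y => gbcField f k y i) x = (1 / 2) * modGaussBonnet (graphMetric f) k x := by
  rw [sum_pd_gbcField hf.self_of_nhds, modGaussBonnet_graphMetric hf]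
  congr 1
  have e : Slots k ≃ Fin k × Fin 2 := Fintype.equivOfCardEq (by simp; omega)
  exact mixedDisc_reindex e fun _ => graphShape f x

end Flux

/-! ### The mass integrand of a graph -/

section MassIntegrand

variable {n : ℕ} {f : H n → ℝ} {x : H n}

lemma covDeriv_hypMetric_two (T : MetricField n) (l j s : Fin n) :
    covDeriv (hypMetric n) (ofMatrix T) x ![l, j, s] =
      pd l (fun y => T y j s) x + hypMetric n x l j * (∑ m, x m * T x m s) +
        hypMetric n x l s * (∑ m, x m * T x j m) := by
  have e1 : Fin.tail (![l, j, s] : Fin 3 → Fin n) = ![j, s] := rfl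
  have e2 : ∀ m : Fin n, Function.update (![j, s] : Fin 2 → Fin n) 0 m = ![m, s] := fun m => by
    ext a; fin_cases a <;> simp
  have e3 : ∀ m : Fin n, Function.update (![j, s] : Fin 2 → Fin n) 1 m = ![j, m] := fun m => by
    ext a; fin_cases a <;> simp
  rw [covDeriv, Fin.sum_univ_two, e1]
  simp only [e2, e3, christoffel_hypMetric, ofMatrix]
  simp only [Matrix.cons_val_zero, Matrix.cons_val_one, Fin.succ_zero_eq_one,
    Fin.succ_one_eq_two, Matrix.cons_val]
  rw [Finset.mul_sum, Finset.mul_sum, sub_eq_add_neg, neg_add, ← Finset.sum_neg_distrib,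
    ← Finset.sum_neg_distrib, ← add_assoc]
  congr 1
  · congr 1
    exact Finset.sum_congr rfl fun m _ => by ring
  · exact Finset.sum_congr rfl fun m _ => by ring

lemma graphMetric_sub_hypMetric (y : H n) (j s : Fin n) :
    (graphMetric f y - hypMetric n y) j s = (1 + ‖y‖ ^ 2) * (pd j f y * pd s f y) := by
  simp [graphMetric, V_sq_eq]; ring

/-- The tensor `V ∇̄_l e_{js} - e_{js} ∇̄_l V` for `e = g - b`. -/
def massTensor (f : H n → ℝ) (x : H n) (j s l : Fin n) : ℝ :=
  V x * covDeriv (hypMetric n) (ofMatrix fun y => graphMetric f y - hypMetric n y) x ![l, j, s] -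
    (graphMetric f x j s - hypMetric n x j s) * pd l V x

/-- The splitting is chosen so that the second summand is symmetric in s and l. It is annihilated by
P̃, which is antisymmetric in its last two indices, and only the term with the second fundamental
form reaches the mass. -/
lemma massTensor_eq (hf : ContDiffAt ℝ ∞ f x) (j s l : Fin n) :
    massTensor f x j s l = V x * (pd s f x * ((1 + ‖x‖ ^ 2) *
        √(1 / (1 + ‖x‖ ^ 2) + coNormSq x fun i => pd i f x) * graphSff f x j l)) +
      V x * ((1 + ‖x‖ ^ 2) * pd j f x * (pd l (pd s f) x +
        (∑ m, x m * pd m f x) * hypMetric n x l s) -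
        pd s f x * pd l f x * (x j + (1 + ‖x‖ ^ 2) ^ 2 * (∑ m, x m * pd m f x) * pd j f x)) := by
  have hN : DifferentiableAt ℝ (fun y : H n => 1 + ‖y‖ ^ 2) x :=
    contDiff_one_add_norm_sq.contDiffAt.differentiableAt (by simp)
  have hd : ∀ j, DifferentiableAt ℝ (pd j f) x := fun j =>
    (contDiffAt_pd_top j hf).differentiableAt (by simp)
  have h0 := (one_add_norm_sq_pos x).ne'
  have hpos : 0 < 1 / (1 + ‖x‖ ^ 2) + coNormSq x fun i => pd i f x := by
    have := coNormSq_nonneg x (fun i => pd i f x)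
    positivity
  have hV := (V_pos x).ne'
  have hV2 := V_sq_eq x
  have hsub : graphMetric f x j s - hypMetric n x j s =
      (1 + ‖x‖ ^ 2) * (pd j f x * pd s f x) := graphMetric_sub_hypMetric x j s
  rw [massTensor, covDeriv_hypMetric_two, hsub, pd_V]
  simp_rw [graphMetric_sub_hypMetric]
  have e1 : ∑ m, x m * ((1 + ‖x‖ ^ 2) * (pd m f x * pd s f x)) =
      (1 + ‖x‖ ^ 2) * pd s f x * ∑ m, x m * pd m f x := by
    rw [Finset.mul_sum]; exact Finset.sum_congr rfl fun m _ => by ring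
  have e2 : ∑ m, x m * ((1 + ‖x‖ ^ 2) * (pd j f x * pd m f x)) =
      (1 + ‖x‖ ^ 2) * pd j f x * ∑ m, x m * pd m f x := by
    rw [Finset.mul_sum]; exact Finset.sum_congr rfl fun m _ => by ring
  rw [e1, e2, pd_mul l hN ((hd j).fun_mul (hd s)), pd_mul l (hd j) (hd s), pd_one_add_norm_sq,
    graphSff, pd_pd_comm j l hf]
  set r := √(1 / (1 + ‖x‖ ^ 2) + coNormSq x fun i => pd i f x) with hr
  have hr0 : r ≠ 0 := (Real.sqrt_pos.2 hpos).ne'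
  have hg : graphMetric f x j l = hypMetric n x l j + (1 + ‖x‖ ^ 2) * (pd j f x * pd l f x) := by
    rw [← graphMetric_sub_hypMetric, Matrix.sub_apply, hypMetric_symm x l j]; ring
  rw [hg]
  set m₀ := ∑ m, x m * pd m f x
  rw [← hV2]
  field_simp
  ring

lemma sum_inv_mul_pd (p : Fin n) :
    ∑ s, (graphMetric f x)⁻¹ p s * (pd s f x * ((1 + ‖x‖ ^ 2) *
      √(1 / (1 + ‖x‖ ^ 2) + coNormSq x fun i => pd i f x))) = graphNormal f x p := by
  simp_rw [← mul_assoc (pd _ f x), ← sum_graphMetric_mul_graphNormal, Finset.mul_sum, ← mul_assoc]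
  rw [Finset.sum_comm]
  simp_rw [← Finset.sum_mul, sum_inv_mul_graphMetric]
  simp

lemma sum_antisymm_mul_symm {T S : Fin n → Fin n → ℝ} (hT : ∀ p q, T p q = - T q p)
    (hS : ∀ p q, S p q = S q p) : ∑ p, ∑ q, T p q * S p q = 0 := by
  rw [← self_eq_neg, ← Finset.sum_neg_distrib, Finset.sum_comm]
  refine Finset.sum_congr rfl fun p _ => ?_
  rw [← Finset.sum_neg_distrib]
  refine Finset.sum_congr rfl fun q _ => ?_
  rw [hT, hS]; ring

/-- Contracting the mass tensor with an antisymmetric tensor. -/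
lemma sum_antisymm_mul_massTensor (hf : ContDiffAt ℝ ∞ f x) (j : Fin n)
    (T : Fin n → Fin n → ℝ) (hT : ∀ p q, T p q = - T q p) :
    ∑ s, ∑ l, massTensor f x j s l * ∑ p, ∑ q, T p q * (graphMetric f x)⁻¹ p s *
        (graphMetric f x)⁻¹ q l =
      V x * ∑ p, ∑ q, T p q * (graphNormal f x p * graphShape f x j q) := by
  set S : Fin n → Fin n → ℝ := fun s l => V x * ((1 + ‖x‖ ^ 2) * pd j f x * (pd l (pd s f) x +
        (∑ m, x m * pd m f x) * hypMetric n x l s) -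
        pd s f x * pd l f x * (x j + (1 + ‖x‖ ^ 2) ^ 2 * (∑ m, x m * pd m f x) * pd j f x)) with hS
  have hSs : ∀ s l, S s l = S l s := fun s l => by
    simp only [hS]
    rw [pd_pd_comm l s hf, hypMetric_symm x l s]; ring
  have hS2 : ∀ p q, ∑ s, ∑ l, S s l * (graphMetric f x)⁻¹ p s * (graphMetric f x)⁻¹ q l =
      ∑ s, ∑ l, S s l * (graphMetric f x)⁻¹ q s * (graphMetric f x)⁻¹ p l := by
    intro p q
    rw [Finset.sum_comm]
    refine Finset.sum_congr rfl fun s _ => Finset.sum_congr rfl fun l _ => ?_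
    rw [hSs]; ring
  have h2 := sum_antisymm_mul_symm hT hS2
  have e1 : ∑ s, ∑ l, massTensor f x j s l * ∑ p, ∑ q, T p q * (graphMetric f x)⁻¹ p s *
        (graphMetric f x)⁻¹ q l = ∑ p, ∑ q, T p q * ∑ s, ∑ l, massTensor f x j s l *
          (graphMetric f x)⁻¹ p s * (graphMetric f x)⁻¹ q l := by
    simp_rw [Finset.mul_sum]
    rw [Finset.sum_comm' (t' := Finset.univ) (s' := fun _ => Finset.univ) (by simp)]
    simp_rw [fun l => Finset.sum_comm (s := Finset.univ (α := Fin n)) (t := Finset.univ (α := Fin n))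
      (f := fun s p => ∑ q, massTensor f x j s l * (T p q * (graphMetric f x)⁻¹ p s *
        (graphMetric f x)⁻¹ q l))]
    rw [Finset.sum_comm]
    refine Finset.sum_congr rfl fun p _ => ?_
    simp_rw [fun l => Finset.sum_comm (s := Finset.univ (α := Fin n)) (t := Finset.univ (α := Fin n))
      (f := fun s q => massTensor f x j s l * (T p q * (graphMetric f x)⁻¹ p s *
        (graphMetric f x)⁻¹ q l))]
    rw [Finset.sum_comm]
    refine Finset.sum_congr rfl fun q _ => ?_
    rw [Finset.sum_comm]
    exact Finset.sum_congr rfl fun s _ => Finset.sum_congr rfl fun l _ => by ring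
  have e2 : ∀ p q, ∑ s, ∑ l, massTensor f x j s l * (graphMetric f x)⁻¹ p s *
      (graphMetric f x)⁻¹ q l = V x * (graphNormal f x p * graphShape f x j q) +
      ∑ s, ∑ l, S s l * (graphMetric f x)⁻¹ p s * (graphMetric f x)⁻¹ q l := by
    intro p q
    -- Raising s turns the multiple of ∂_s f into q^p, and raising l turns h_{jl} into A_j^q.
    rw [← sum_inv_mul_pd p, ← sum_graphSff_mul_inv hf j q, Finset.sum_mul_sum, Finset.mul_sum,
      ← Finset.sum_add_distrib]
    refine Finset.sum_congr rfl fun s _ => ?_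
    rw [Finset.mul_sum, ← Finset.sum_add_distrib]
    refine Finset.sum_congr rfl fun l _ => ?_
    rw [massTensor_eq hf, graphMetric_inv_symm l q]
    ring
  rw [e1]
  simp_rw [e2, mul_add, Finset.sum_add_distrib]
  rw [h2, add_zero, Finset.mul_sum]
  refine Finset.sum_congr rfl fun p _ => ?_
  rw [Finset.mul_sum]
  exact Finset.sum_congr rfl fun q _ => by ring

lemma sum_comm_two_two {α β γ δ : Type*} [Fintype α] [Fintype β] [Fintype γ] [Fintype δ]
    (F : α → β → γ → δ → ℝ) :
    ∑ a, ∑ b, ∑ c, ∑ d, F a b c d = ∑ c, ∑ d, ∑ a, ∑ b, F a b c d := by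
  rw [Finset.sum_congr rfl fun a _ => Finset.sum_comm, Finset.sum_comm]
  refine Finset.sum_congr rfl fun c _ => ?_
  rw [Finset.sum_congr rfl fun a _ => Finset.sum_comm, Finset.sum_comm]

lemma genDelta_elim_swap {k : ℕ} (I J : Fin (k - 1) × Fin 2 → Fin n) (i j p q : Fin n) :
    genDelta (Sum.elim I ![i, j]) (Sum.elim J ![p, q]) =
      - genDelta (Sum.elim I ![i, j]) (Sum.elim J ![q, p]) := by
  have : (Sum.elim J ![p, q] : Slots k → Fin n) =
      Sum.elim J ![q, p] ∘ Equiv.swap (Sum.inr 0) (Sum.inr 1) := by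
    ext a
    rcases a with a | a
    · rw [Function.comp_apply, Equiv.swap_apply_of_ne_of_ne] <;> simp
    · fin_cases a <;> simp
  rw [this, genDelta_comp_right, Equiv.Perm.sign_swap (by simp)]
  simp

/-- The tensor `P̃` before raising its last two indices. -/
lemma modP_graphMetric (hf : ∀ᶠ y in 𝓝 x, ContDiffAt ℝ ∞ f y) {k : ℕ} (hk : 1 ≤ k)
    (i j s l : Fin n) :
    modP (graphMetric f) k i j s l x = ∑ p, ∑ q, ((1 / 2) *
      ∑ I : Fin (k - 1) × Fin 2 → Fin n, ∑ J : Fin (k - 1) × Fin 2 → Fin n,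
        genDelta (Sum.elim I ![i, j]) (Sum.elim J ![p, q]) * ∏ c, graphShape f x (I c) (J c)) *
        (graphMetric f x)⁻¹ p s * (graphMetric f x)⁻¹ q l := by
  have e : modP (graphMetric f) k i j s l x = ∑ p, ∑ q, ((1 / 2 ^ k) *
      ∑ I : Fin (k - 1) × Fin 2 → Fin n, ∑ J : Fin (k - 1) × Fin 2 → Fin n,
        genDelta (Sum.elim I ![i, j]) (Sum.elim J ![p, q]) * ∏ a : Fin (k - 1),
          modRiem (graphMetric f) (I (a, 0)) (I (a, 1)) (J (a, 0)) (J (a, 1)) x) *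
        (graphMetric f x)⁻¹ p s * (graphMetric f x)⁻¹ q l := by
    rw [modP]
    simp_rw [Finset.mul_sum, Finset.sum_mul]
    rw [sum_comm_two_two]
    refine Finset.sum_congr rfl fun p _ => ?_
    refine Finset.sum_congr rfl fun q _ => Finset.sum_congr rfl fun I _ =>
      Finset.sum_congr rfl fun J _ => ?_
    ring
  rw [e]
  refine Finset.sum_congr rfl fun p _ => Finset.sum_congr rfl fun q _ => ?_
  congr 2
  -- There are only k - 1 curvature factors, each contributing a 2, against the normalization
  -- 2^{-k}. The leftover ½ is the one in the flux form.
  have h2 : (2 : ℝ) ^ k = 2 * 2 ^ (k - 1) := by rw [← pow_succ', Nat.sub_add_cancel hk]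
  rw [Finset.mul_sum, Finset.mul_sum]
  refine Finset.sum_congr rfl fun I _ => ?_
  rw [prod_modRiem_sum hf I (fun J => genDelta (Sum.elim I ![i, j]) (Sum.elim J ![p, q]))]
  · rw [h2]; field_simp
  · intro a J
    have : (Sum.elim (J ∘ Equiv.swap (a, (0 : Fin 2)) (a, 1)) ![p, q]) =
        (Sum.elim J ![p, q]) ∘ Equiv.swap (Sum.inl (a, 0)) (Sum.inl (a, 1)) := by
      ext c
      rcases c with c | c
      · simp only [Sum.elim_inl, Function.comp_apply]
        rw [Sum.inl_injective.swap_apply (a, (0 : Fin 2)) (a, 1) c, Sum.elim_inl]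
      · rw [Function.comp_apply, Equiv.swap_apply_of_ne_of_ne] <;> simp
    rw [this, genDelta_comp_right, Equiv.Perm.sign_swap (by simp)]
    simp

lemma sum_slots {k : ℕ} (F : (Slots k → Fin n) → ℝ) :
    ∑ I, F I = ∑ I : Fin (k - 1) × Fin 2 → Fin n, ∑ i, ∑ j, F (Sum.elim I ![i, j]) := by
  rw [← (Equiv.sumArrowEquivProdArrow (Fin (k - 1) × Fin 2) (Fin 2) (Fin n)).symm.sum_comp,
    Fintype.sum_prod_type]
  refine Finset.sum_congr rfl fun I _ => ?_
  rw [← (finTwoArrowEquiv (Fin n)).symm.sum_comp, Fintype.sum_prod_type]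
  rfl

/-- P̃ supplies 2k - 2 factors A. The mass tensor fills the remaining two slots: one with a further
A, and the free one with q, which is paired with the covector α. -/
lemma sum_massTensor_mul_modP (hf : ∀ᶠ y in 𝓝 x, ContDiffAt ℝ ∞ f y) {k : ℕ} (hk : 1 ≤ k)
    (α : Fin n → ℝ) :
    ∑ i, (∑ j, ∑ s, ∑ l, massTensor f x j s l * modP (graphMetric f) k i j s l x) * α i =
      V x * fluxForm k (graphShape f x) (graphNormal f x) α := by
  have h1 : ∀ i j, ∑ s, ∑ l, massTensor f x j s l * modP (graphMetric f) k i j s l x =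
      V x * ∑ p, ∑ q, ((1 / 2) *
      ∑ I : Fin (k - 1) × Fin 2 → Fin n, ∑ J : Fin (k - 1) × Fin 2 → Fin n,
        genDelta (Sum.elim I ![i, j]) (Sum.elim J ![p, q]) * ∏ c, graphShape f x (I c) (J c)) *
        (graphNormal f x p * graphShape f x j q) := by
    intro i j
    rw [← sum_antisymm_mul_massTensor hf.self_of_nhds]
    · simp_rw [modP_graphMetric hf hk]
    · intro p q
      rw [← mul_neg, ← Finset.sum_neg_distrib]
      congr 1
      refine Finset.sum_congr rfl fun I _ => ?_
      rw [← Finset.sum_neg_distrib]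
      refine Finset.sum_congr rfl fun J _ => ?_
      rw [genDelta_elim_swap, neg_mul]
  simp_rw [h1]
  rw [fluxForm, mixedDisc, sum_slots]
  simp_rw [sum_slots (k := k) (fun J => genDelta _ J * _)]
  simp only [Finset.mul_sum, Finset.sum_mul]
  conv_rhs => rw [Finset.sum_comm]
  refine Finset.sum_congr rfl fun i _ => ?_
  conv_rhs => rw [Finset.sum_comm]
  refine Finset.sum_congr rfl fun j _ => ?_
  conv_lhs => rw [← sum_comm_two_two]
  refine Finset.sum_congr rfl fun I _ => Finset.sum_congr rfl fun J _ =>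
    Finset.sum_congr rfl fun p _ => Finset.sum_congr rfl fun q _ => ?_
  rw [Fintype.prod_sum_type, Fin.prod_univ_two]
  simp only [Sum.elim_inl, Sum.elim_inr, Function.update_self, ne_eq, reduceCtorEq,
    not_false_eq_true, Function.update_of_ne, Sum.inr.injEq, one_ne_zero,
    Matrix.cons_val_zero, Matrix.cons_val_one, Matrix.vecMulVec_apply]
  ring

lemma hasFDerivAt_norm {x : H n} (hx : x ≠ 0) :
    HasFDerivAt (fun y : H n => ‖y‖) ((1 / ‖x‖) • innerSL ℝ x) x := by
  have h0 : ‖x‖ ^ 2 ≠ 0 := pow_ne_zero _ (norm_ne_zero_iff.2 hx)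
  have h1 := (hasStrictFDerivAt_norm_sq x).hasFDerivAt.sqrt h0
  have e : (fun y : H n => √(‖y‖ ^ 2)) = fun y => ‖y‖ := by
    ext y; exact Real.sqrt_sq (norm_nonneg y)
  rw [e, Real.sqrt_sq (norm_nonneg x)] at h1
  refine h1.congr_fderiv ?_
  ext v
  simp
  ring

lemma pd_hypRadius {x : H n} (hx : x ≠ 0) (i : Fin n) :
    pd i hypRadius x = 1 / (‖x‖ * V x) * x i := by
  have h1 : pd i hypRadius x = (√(1 + ‖x‖ ^ 2))⁻¹ * pd i (fun y => ‖y‖) x :=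
    pd_comp i (Real.hasDerivAt_arsinh ‖x‖) (hasFDerivAt_norm hx).differentiableAt
  rw [h1, pd, (hasFDerivAt_norm hx).fderiv, ← V_eq]
  simp [EuclideanSpace.inner_single_right]
  ring

lemma sum_hypMetric_mul_unitNormal (u : H n → ℝ) (i : Fin n) :
    ∑ m, hypMetric n x i m * unitNormal (hypMetric n) u x m =
      (√(gradSq (hypMetric n) u x))⁻¹ * pd i u x := by
  have h := hypMetric_mul_inv x
  rw [← hypMetric_inv] at h
  have h2 := congrArg (fun M : Matrix (Fin n) (Fin n) ℝ => M.mulVec (fun j => pd j u x) i) h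
  simp only [Matrix.one_mulVec, ← Matrix.mulVec_mulVec] at h2
  rw [← h2, Matrix.mulVec, dotProduct, Finset.mul_sum]
  refine Finset.sum_congr rfl fun m _ => ?_
  rw [unitNormal, div_eq_inv_mul]
  change _ = _ * (_ * grad (hypMetric n) u x m)
  ring

lemma sqrt_det_hypMetric (x : H n) : √(hypMetric n x).det = 1 / V x := by
  rw [det_hypMetric, Real.sqrt_div zero_le_one, Real.sqrt_one, V_eq]

/-- The mass integrand of a graph, with respect to Euclidean surface measure. -/
lemma massIntegrand_mul_areaDensity (hf : ∀ᶠ y in 𝓝 x, ContDiffAt ℝ ∞ f y) {k : ℕ} (hk : 1 ≤ k)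
    (hx : x ≠ 0) :
    massIntegrand (graphMetric f) k V x * areaDensity (hypMetric n) hypRadius x =
      ∑ i, (x i / ‖x‖) * gbcField f k x i := by
  have hn : ‖x‖ ≠ 0 := norm_ne_zero_iff.2 hx
  have hV := V_pos x
  have hpd : (fun i => pd i hypRadius x) = (1 / (‖x‖ * V x)) • (fun i => x i) := by
    ext i; rw [pd_hypRadius hx]; rfl
  have hgs : 0 < gradSq (hypMetric n) hypRadius x := by
    rw [gradSq_hypMetric]
    refine coNormSq_pos x ?_
    rw [hpd]
    refine smul_ne_zero (by positivity) fun h => hx ?_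
    ext i; exact congrFun h i
  have h1 : massIntegrand (graphMetric f) k V x = V x * ((√(gradSq (hypMetric n) hypRadius x))⁻¹ *
      (1 / (‖x‖ * V x) * fluxForm k (graphShape f x) (graphNormal f x) (fun i => x i))) := by
    rw [← fluxForm_smul_right, ← hpd, ← fluxForm_smul_right, ← sum_massTensor_mul_modP hf hk]
    rw [massIntegrand]
    refine Finset.sum_congr rfl fun i _ => ?_
    rw [sum_hypMetric_mul_unitNormal]
    rfl
  have h2 : ∑ i, pd i hypRadius x ^ 2 = (1 / V x) ^ 2 := by
    have : ∀ i, pd i hypRadius x ^ 2 = (1 / (‖x‖ * V x)) ^ 2 * (x i * x i) := fun i => by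
      rw [pd_hypRadius hx]; ring
    simp_rw [this]
    rw [← Finset.mul_sum, ← norm_sq_eq_sum]
    field_simp
  have h3 : ∑ i, (x i / ‖x‖) * gbcField f k x i =
      (1 / ‖x‖) * fluxForm k (graphShape f x) (graphNormal f x) (fun i => x i) := by
    rw [← sum_mul_gbcField, Finset.mul_sum]
    exact Finset.sum_congr rfl fun i _ => by ring
  have hs := (Real.sqrt_pos.2 hgs).ne'
  -- √det b and the Euclidean length of dr are both 1/V, so the area density reduces to |dr|_b. It
  -- cancels against the normalization of ν, and the factor V of the integrand cancels against dr =
  -- x/(|x| V).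
  rw [h1, h3, areaDensity, h2, Real.sqrt_sq (by positivity), sqrt_det_hypMetric]
  field_simp

end MassIntegrand

/-! ### Mean curvatures of level sets -/

/-- Up to powers of X, the characteristic polynomial is that of the symmetric matrix Nᵀ S N, which
splits over ℝ by the spectral theorem. -/
lemma splits_charpoly_mul {n m : ℕ} (N : Matrix (Fin n) (Fin m) ℝ) (S : Matrix (Fin n) (Fin n) ℝ)
    (hS : S.IsSymm) : (N * N.transpose * S).charpoly.Splits := by
  have h1 : (N.transpose * S * N).IsHermitian := by
    rw [Matrix.IsHermitian, Matrix.conjTranspose_mul, Matrix.conjTranspose_mul]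
    simp only [Matrix.conjTranspose_eq_transpose_of_trivial, Matrix.transpose_transpose]
    rw [hS.eq, Matrix.mul_assoc]
  have h2 : (N * (N.transpose * S)).charpoly * Polynomial.X ^ m =
      (N.transpose * S * N).charpoly * Polynomial.X ^ n := by
    have := Matrix.charpoly_mul_comm' N (N.transpose * S)
    simp only [Fintype.card_fin] at this
    rw [mul_comm, this, mul_comm]
  have h3 : ((N.transpose * S * N).charpoly * Polynomial.X ^ n).Splits :=
    h1.splits_charpoly.mul (Polynomial.Splits.X_pow n)
  rw [← h2] at h3
  rw [Matrix.mul_assoc]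
  exact h3.of_dvd (mul_ne_zero (Matrix.charpoly_monic _).ne_zero
    (pow_ne_zero _ Polynomial.X_ne_zero)) (Dvd.intro _ rfl)

/-- The elementary symmetric functions of the eigenvalues as mixed discriminants. -/
lemma factorial_mul_esymm_roots {n m : ℕ} (W : Matrix (Fin n) (Fin n) ℝ) (hm : m ≤ n)
    (hW : W.charpoly.Splits) :
    m.factorial * W.charpoly.roots.esymm m = mixedDisc (fun _ : Fin m => W) := by
  rw [mixedDisc_const_eq_sum_minors]
  have h1 := W.charpoly_coeff_eq_sum_minors m (by simpa using hm)
  have hdeg : W.charpoly.natDegree = n := by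
    rw [Matrix.charpoly_natDegree_eq_dim, Fintype.card_fin]
  -- Splitting is what makes the real roots exhaust the degree, so that coefficients are elementary
  -- symmetric functions of them. The same coefficients are sums of principal minors.
  have h2 := Polynomial.coeff_eq_esymm_roots_of_card hW.natDegree_eq_card_roots.symm
    (k := n - m) (by omega)
  rw [Fintype.card_fin, h2, hdeg, (Matrix.charpoly_monic W).leadingCoeff, one_mul,
    Nat.sub_sub_self hm] at h1
  have h3 : ((-1 : ℝ) ^ m) ≠ 0 := pow_ne_zero _ (by norm_num)
  rw [mul_left_cancel₀ h3 h1]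

section LevelSet

variable {n : ℕ} {u : H n → ℝ} {x : H n}

/-- The Jacobian of the unit normal of the level sets of `u`. -/
def levelShape (u : H n → ℝ) (x : H n) : Matrix (Fin n) (Fin n) ℝ :=
  Matrix.of fun i s => pd i (fun y => unitNormal (hypMetric n) u y s) x

lemma pd_ne_zero_of_fderiv_ne_zero (h : fderiv ℝ u x ≠ 0) : (fun i => pd i u x) ≠ 0 := by
  intro h0
  refine h (ContinuousLinearMap.ext fun v => ?_)
  rw [fderiv_apply_eq_sum_pd]
  simp [fun i => congrFun h0 i]

lemma gradSq_pos (h : fderiv ℝ u x ≠ 0) : 0 < gradSq (hypMetric n) u x := by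
  rw [gradSq_hypMetric]; exact coNormSq_pos x (pd_ne_zero_of_fderiv_ne_zero h)

lemma contDiffAt_unitNormal (hu : ContDiffAt ℝ ∞ u x) (h : fderiv ℝ u x ≠ 0) (s : Fin n) :
    ContDiffAt ℝ ∞ (fun y => unitNormal (hypMetric n) u y s) x := by
  simp_rw [unitNormal_hypMetric]
  exact contDiffAt_normalPart (c := fun _ => 0) (fun i => contDiffAt_pd_top i hu) contDiffAt_const
    le_rfl (Or.inr (pd_ne_zero_of_fderiv_ne_zero h)) s

/-- The unit conormal of the level sets. -/
def unitConormal (u : H n → ℝ) (x : H n) (i : Fin n) : ℝ :=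
  (√(gradSq (hypMetric n) u x))⁻¹ * pd i u x

lemma sum_unitConormal_mul_unitNormal (h : fderiv ℝ u x ≠ 0) :
    ∑ i, unitConormal u x i * unitNormal (hypMetric n) u x i = 1 := by
  have hp := gradSq_pos h
  have e : ∀ i, unitConormal u x i * unitNormal (hypMetric n) u x i =
      (gradSq (hypMetric n) u x)⁻¹ * ∑ j, (hypMetric n x)⁻¹ i j * pd i u x * pd j u x := by
    intro i
    rw [unitConormal, unitNormal, grad, div_eq_inv_mul, Finset.mul_sum, Finset.mul_sum,
      Finset.mul_sum]
    refine Finset.sum_congr rfl fun j _ => ?_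
    have : (gradSq (hypMetric n) u x)⁻¹ = (√(gradSq (hypMetric n) u x))⁻¹ *
        (√(gradSq (hypMetric n) u x))⁻¹ := by
      rw [← mul_inv, Real.mul_self_sqrt hp.le]
    rw [this]; ring
  simp_rw [e]
  rw [← Finset.mul_sum]
  exact inv_mul_cancel₀ hp.ne'

/-- As Γ^i_{jm} = -x^i b_{jm}, the Weingarten map and the plain Jacobian of ν differ by a multiple
of the conormal, which the flux form cannot see. -/
lemma weingarten_eq (i j : Fin n) : weingarten (hypMetric n) u x i j =
    levelShape u x j i - x i * unitConormal u x j := by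
  rw [weingarten, Matrix.of_apply, levelShape, Matrix.of_apply, unitConormal,
    ← sum_hypMetric_mul_unitNormal, Finset.mul_sum, sub_eq_add_neg, ← Finset.sum_neg_distrib]
  congr 1
  refine Finset.sum_congr rfl fun m _ => ?_
  rw [christoffel_hypMetric]; ring

lemma pd_hypMetric (k i j : Fin n) : pd k (fun y => hypMetric n y i j) x =
    - hypMetric n x k j * (∑ m, hypMetric n x i m * x m)
    - hypMetric n x k i * ∑ m, hypMetric n x j m * x m := by
  have h := pd_graphMetric_eq_christoffel (f := fun _ => (0 : ℝ)) (x := x) contDiffAt_const k i j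
  rw [← hypMetric_eq_graphMetric] at h
  rw [h, Finset.mul_sum, Finset.mul_sum, ← Finset.sum_sub_distrib]
  refine Finset.sum_congr rfl fun m _ => ?_
  rw [christoffel_hypMetric, christoffel_hypMetric]; ring

lemma differentiableAt_hypMetric (i j : Fin n) :
    DifferentiableAt ℝ (fun y => hypMetric n y i j) x := by
  have := contDiffAt_graphMetric (f := fun _ => (0 : ℝ)) (x := x) contDiffAt_const i j
  rw [← hypMetric_eq_graphMetric] at this
  exact this.differentiableAt (by simp)

/-- The Weingarten map takes values in the tangent space of the level set. -/
lemma sum_weingarten_mul_unitConormal (hu : ContDiffAt ℝ ∞ u x) (h : fderiv ℝ u x ≠ 0)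
    (i : Fin n) : ∑ j, weingarten (hypMetric n) u x j i * unitConormal u x j = 0 := by
  have hν : ∀ s, DifferentiableAt ℝ (fun y => unitNormal (hypMetric n) u y s) x := fun s =>
    (contDiffAt_unitNormal hu h s).differentiableAt (by simp)
  have hev : ∀ᶠ y in 𝓝 x, fderiv ℝ u y ≠ 0 :=
    ((hu.fderiv_right (m := ∞) (by simp)).continuousAt).eventually_ne h
  -- The identity to differentiate is b(ν, ν) = 1.
  have h1 : (fun y => ∑ s, ∑ t, hypMetric n y s t * (unitNormal (hypMetric n) u y s *
      unitNormal (hypMetric n) u y t)) =ᶠ[𝓝 x] fun _ => 1 := by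
    filter_upwards [hev] with y hy
    rw [← sum_unitConormal_mul_unitNormal hy]
    refine Finset.sum_congr rfl fun s _ => ?_
    rw [unitConormal, ← sum_hypMetric_mul_unitNormal, Finset.sum_mul]
    exact Finset.sum_congr rfl fun t _ => by ring
  have h2 := pd_congr i h1
  have hd : ∀ s t, DifferentiableAt ℝ (fun y => hypMetric n y s t *
      (unitNormal (hypMetric n) u y s * unitNormal (hypMetric n) u y t)) x := fun s t =>
    (differentiableAt_hypMetric s t).fun_mul ((hν s).fun_mul (hν t))
  rw [pd_const, pd_sum i fun s _ => DifferentiableAt.fun_sum fun t _ => hd s t] at h2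
  set ν := fun s => unitNormal (hypMetric n) u x s with hνdef
  set L := fun s => levelShape u x i s with hL
  have hflat : ∀ s, ∑ t, hypMetric n x s t * ν t = unitConormal u x s := fun s =>
    sum_hypMetric_mul_unitNormal u s
  have e : ∀ s, pd i (fun y => ∑ t, hypMetric n y s t * (unitNormal (hypMetric n) u y s *
      unitNormal (hypMetric n) u y t)) x =
      - (∑ m, hypMetric n x s m * x m) * ν s * unitConormal u x i
      - hypMetric n x i s * ν s * (∑ t, ν t * ∑ m, hypMetric n x t m * x m) +
      L s * unitConormal u x s + ν s * ∑ t, hypMetric n x s t * L t := by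
    intro s
    rw [pd_sum i fun t _ => hd s t]
    have : ∀ t, pd i (fun y => hypMetric n y s t * (unitNormal (hypMetric n) u y s *
        unitNormal (hypMetric n) u y t)) x =
        - (∑ m, hypMetric n x s m * x m) * ν s * (hypMetric n x i t * ν t) -
        hypMetric n x i s * ν s * (ν t * ∑ m, hypMetric n x t m * x m) +
        L s * (hypMetric n x s t * ν t) + ν s * (hypMetric n x s t * L t) := by
      intro t
      rw [pd_mul i (differentiableAt_hypMetric s t) ((hν s).fun_mul (hν t)),
        pd_mul i (hν s) (hν t), pd_hypMetric]
      change _ + hypMetric n x s t * (L s * ν t + ν s * L t) = _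
      ring
    simp_rw [this, Finset.sum_add_distrib, Finset.sum_sub_distrib, ← Finset.mul_sum, hflat]
  simp_rw [e, Finset.sum_add_distrib, Finset.sum_sub_distrib] at h2
  have e3 : ∑ s, ν s * ∑ t, hypMetric n x s t * L t = ∑ s, L s * unitConormal u x s := by
    simp_rw [← hflat, Finset.mul_sum]
    rw [Finset.sum_comm]
    refine Finset.sum_congr rfl fun s _ => Finset.sum_congr rfl fun t _ => ?_
    rw [hypMetric_symm]; ring
  have e4 : ∑ t, ν t * ∑ m, hypMetric n x t m * x m = ∑ m, x m * unitConormal u x m := by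
    simp_rw [← hflat, Finset.mul_sum]
    rw [Finset.sum_comm]
    refine Finset.sum_congr rfl fun s _ => Finset.sum_congr rfl fun t _ => ?_
    rw [hypMetric_symm]; ring
  have e5 : ∑ s, -(∑ m, hypMetric n x s m * x m) * ν s * unitConormal u x i =
      - unitConormal u x i * ∑ m, x m * unitConormal u x m := by
    rw [← e4, Finset.mul_sum]
    exact Finset.sum_congr rfl fun s _ => by ring
  have e6 : ∑ s, hypMetric n x i s * ν s * (∑ t, ν t * ∑ m, hypMetric n x t m * x m) =
      unitConormal u x i * ∑ m, x m * unitConormal u x m := by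
    rw [← Finset.sum_mul, hflat, e4]
  rw [e3, e5, e6] at h2
  have e7 : ∑ j, weingarten (hypMetric n) u x j i * unitConormal u x j =
      ∑ s, L s * unitConormal u x s - unitConormal u x i * ∑ m, x m * unitConormal u x m := by
    rw [Finset.mul_sum, ← Finset.sum_sub_distrib]
    refine Finset.sum_congr rfl fun j _ => ?_
    rw [weingarten_eq]; ring
  rw [e7]; linarith

/-- The Weingarten map, up to normal components, is the Hessian with one index raised. -/
lemma exists_levelShape_eq (hu : ContDiffAt ℝ ∞ u x) (h : fderiv ℝ u x ≠ 0) :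
    ∃ (c : Fin n → ℝ) (S : Matrix (Fin n) (Fin n) ℝ), S.IsSymm ∧
      weingarten (hypMetric n) u x = Matrix.vecMulVec (unitNormal (hypMetric n) u x) c +
        (hypMetric n x)⁻¹ * S := by
  have hp := gradSq_pos h
  have hd : ∀ j, DifferentiableAt ℝ (pd j u) x := fun j =>
    (contDiffAt_pd_top j hu).differentiableAt (by simp)
  have hc : ∀ j, DifferentiableAt ℝ (fun y : H n => y j) x := fun j => coord_differentiableAt j
  have hm : DifferentiableAt ℝ (fun y : H n => ∑ i, y i * pd i u y) x :=
    DifferentiableAt.fun_sum fun i _ => (hc i).mul (hd i)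
  have ha : DifferentiableAt ℝ (fun y => (√(gradSq (hypMetric n) u y))⁻¹) x := by
    have : DifferentiableAt ℝ (fun y => gradSq (hypMetric n) u y) x := by
      simp_rw [gradSq_hypMetric]
      exact (contDiffAt_coNormSq (fun i => contDiffAt_pd_top i hu) le_rfl).differentiableAt
        (by simp)
    exact (this.sqrt hp.ne').inv (Real.sqrt_pos.2 hp).ne'
  set a := (√(gradSq (hypMetric n) u x))⁻¹ with hadef
  have ha0 : a ≠ 0 := inv_ne_zero (Real.sqrt_pos.2 hp).ne'
  set m₀ := ∑ i, x i * pd i u x with hm₀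
  have hpm : ∀ i, pd i (fun y : H n => ∑ j, y j * pd j u y) x =
      pd i u x + ∑ j, x j * pd i (pd j u) x := by
    intro i
    rw [pd_sum i fun j _ => (hc j).fun_mul (hd j)]
    simp_rw [fun j => pd_mul i (hc j) (hd j), pd_coord, Finset.sum_add_distrib]
    simp
  refine ⟨fun j => a⁻¹ * pd j (fun y => (√(gradSq (hypMetric n) u y))⁻¹) x,
    a • ((Matrix.of fun i j => pd i (pd j u) x) + m₀ • hypMetric n x), ?_, ?_⟩
  · ext i j
    simp only [Matrix.transpose_apply, Matrix.smul_apply, Matrix.add_apply, Matrix.of_apply]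
    rw [pd_pd_comm j i hu, hypMetric_symm]
  · rw [Matrix.mul_smul, Matrix.mul_add, Matrix.mul_smul,
      Matrix.nonsing_inv_mul _ (isUnit_det_hypMetric x)]
    ext i j
    have hL : levelShape u x j i = (pd j (pd i u) x + (if j = i then 1 else 0) * m₀ +
        x i * (pd j u x + ∑ l, x l * pd j (pd l u) x)) * a +
        (pd i u x + x i * m₀) * pd j (fun y => (√(gradSq (hypMetric n) u y))⁻¹) x := by
      have e : (fun y => unitNormal (hypMetric n) u y i) = fun y =>
          (pd i u y + y i * ∑ j, y j * pd j u y) * (√(gradSq (hypMetric n) u y))⁻¹ := by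
        ext y; rw [unitNormal, grad_hypMetric, div_eq_mul_inv]
      rw [levelShape, Matrix.of_apply, e,
        pd_mul j ((hd i).fun_add ((hc i).fun_mul hm)) ha, pd_add j (hd i) ((hc i).fun_mul hm),
        pd_mul j (hc i) hm, hpm, pd_coord]
      ring
    have hinv : ((hypMetric n x)⁻¹ * Matrix.of fun i j => pd i (pd j u) x) i j =
        pd i (pd j u) x + x i * ∑ l, x l * pd l (pd j u) x :=
      sum_hypMetric_inv_mul x i (fun l => pd l (pd j u) x)
    rw [weingarten_eq, hL, Matrix.add_apply, Matrix.smul_apply, Matrix.add_apply, hinv,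
      Matrix.smul_apply, Matrix.one_apply, Matrix.vecMulVec_apply, unitNormal, grad_hypMetric,
      unitConormal, div_eq_mul_inv, ← hadef, ← hm₀, pd_pd_comm i j hu]
    have : ∑ l, x l * pd l (pd j u) x = ∑ l, x l * pd j (pd l u) x :=
      Finset.sum_congr rfl fun l _ => by rw [pd_pd_comm l j hu]
    rw [this]
    simp only [eq_comm (a := j) (b := i), smul_eq_mul]
    field_simp
    ring

/-- The projection P along ν onto the tangent space of the level set fixes the Weingarten map W and
kills its ν ⊗ c part. Hence W = P b⁻¹ Pᵀ S with S symmetric, and a square-root factorization of b⁻¹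
brings this into the form N Nᵀ S. -/
lemma splits_charpoly_weingarten (hu : ContDiffAt ℝ ∞ u x) (h : fderiv ℝ u x ≠ 0) :
    (weingarten (hypMetric n) u x).charpoly.Splits := by
  obtain ⟨c, S, hS, hW⟩ := exists_levelShape_eq hu h
  set W := weingarten (hypMetric n) u x
  set ν := unitNormal (hypMetric n) u x
  set νf := unitConormal u x
  have hν : ∑ i, νf i * ν i = 1 := sum_unitConormal_mul_unitNormal h
  set P : Matrix (Fin n) (Fin n) ℝ := 1 - Matrix.vecMulVec ν νf with hP
  have hflat : (hypMetric n x)⁻¹.mulVec νf = ν := by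
    ext i
    rw [Matrix.mulVec, dotProduct]
    change ∑ j, (hypMetric n x)⁻¹ i j * ((√(gradSq (hypMetric n) u x))⁻¹ * pd j u x) = _
    change _ = grad (hypMetric n) u x i / √(gradSq (hypMetric n) u x)
    rw [grad, div_eq_inv_mul, Finset.mul_sum]
    exact Finset.sum_congr rfl fun j _ => by ring
  have hBsymm : (hypMetric n x)⁻¹.IsSymm := by
    ext i j
    rw [Matrix.transpose_apply, hypMetric_inv_apply, hypMetric_inv_apply]
    simp only [eq_comm (a := j) (b := i)]; ring
  have hflat' : Matrix.vecMul νf (hypMetric n x)⁻¹ = ν := by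
    rw [← hflat, ← Matrix.mulVec_transpose, hBsymm.eq]
  have hPW : P * W = W := by
    rw [hP, Matrix.sub_mul, Matrix.one_mul, Matrix.vecMulVec_mul]
    have : Matrix.vecMul νf W = 0 := by
      ext i
      rw [Matrix.vecMul, dotProduct]
      simp only [Pi.zero_apply]
      rw [← sum_weingarten_mul_unitConormal hu h i]
      exact Finset.sum_congr rfl fun j _ => mul_comm _ _
    rw [this]; ext; simp
  have hPν : P.mulVec ν = 0 := by
    rw [hP, Matrix.sub_mulVec, Matrix.one_mulVec, Matrix.vecMulVec_mulVec]
    ext i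
    simp [dotProduct, hν]
  have hPB : P * (hypMetric n x)⁻¹ = P * (hypMetric n x)⁻¹ * P.transpose := by
    have e : P.transpose = 1 - Matrix.vecMulVec νf ν := by
      rw [hP, Matrix.transpose_sub, Matrix.transpose_one, Matrix.transpose_vecMulVec]
    rw [e, Matrix.mul_sub, Matrix.mul_one, Matrix.mul_vecMulVec, ← Matrix.mulVec_mulVec, hflat,
      hPν]
    ext; simp
  have hW2 : W = P * (hypMetric n x)⁻¹ * P.transpose * S := by
    rw [← hPB, ← hPW]
    conv_lhs => rw [hW]
    rw [Matrix.mul_add, Matrix.mul_vecMulVec, hPν, Matrix.mul_assoc]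
    ext; simp
  -- Since b⁻¹ = 1 + x xᵀ, it factors explicitly through the columns x, e₁, …, e_n.
  set L : Matrix (Fin n) (Fin (n + 1)) ℝ := Matrix.of fun i => Fin.cons (x i) (Pi.single i 1)
    with hLdef
  have hL : (hypMetric n x)⁻¹ = L * L.transpose := by
    ext i j
    rw [hypMetric_inv_apply, Matrix.mul_apply, Fin.sum_univ_succ]
    simp [hLdef, Pi.single_apply, add_comm, eq_comm]
  have hN : P * (hypMetric n x)⁻¹ * P.transpose = P * L * (P * L).transpose := by
    rw [hL, Matrix.transpose_mul]; simp only [Matrix.mul_assoc]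
  rw [hW2, hN]
  exact splits_charpoly_mul _ _ hS

/-- The mean curvature integrand of a level set as a flux form. -/
lemma meanCurv_mul_areaDensity (hu : ContDiffAt ℝ ∞ u x) (h : fderiv ℝ u x ≠ 0) {k : ℕ}
    (hk : 1 ≤ k) (hkn : 2 * k - 1 ≤ n) :
    ((2 * k - 1).factorial : ℝ) / 2 *
      ((V x * meanCurv (hypMetric n) u (2 * k - 1) x) * areaDensity (hypMetric n) u x) =
    fluxForm k (levelShape u x) (unitNormal (hypMetric n) u x) (fun i => pd i u x) /
      √(∑ i, pd i u x ^ 2) := by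
  have hp := gradSq_pos h
  have hα : (fun i => pd i u x) = √(gradSq (hypMetric n) u x) • unitConormal u x := by
    ext i
    rw [Pi.smul_apply, unitConormal, smul_eq_mul, mul_inv_cancel_left₀ (Real.sqrt_pos.2 hp).ne']
  have hB : levelShape u x = (1 : ℝ) • (weingarten (hypMetric n) u x).transpose +
      Matrix.vecMulVec (unitConormal u x) (fun i => x i) := by
    ext i j
    rw [one_smul, Matrix.add_apply, Matrix.transpose_apply, weingarten_eq, Matrix.vecMulVec_apply]
    ring
  -- An arbitrary enumeration of the slots, corrected by a transposition so that the free slot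
  -- becomes number 0.
  let e : Slots k ≃ Fin (2 * k - 1 + 1) :=
    (Fintype.equivFinOfCardEq (α := Slots k) (by simp; omega)).trans
      (Equiv.swap (Fintype.equivFinOfCardEq (α := Slots k) (n := 2 * k - 1 + 1) (by simp; omega)
        (Sum.inr 0)) 0)
  have he : e (Sum.inr 0) = 0 := by simp [e]
  -- The Jacobian of ν may be replaced by the Weingarten map. That map takes values in the kernel of
  -- the conormal, so the free slot can be removed; 2k - 1 slots remain and produce (2k-1)!
  -- σ_{2k-1}.
  have hm : fluxForm k (levelShape u x) (unitNormal (hypMetric n) u x) (unitConormal u x) =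
      (1 / 2) * mixedDisc (fun _ : Fin (2 * k - 1) => (weingarten (hypMetric n) u x).transpose) := by
    rw [fluxForm_congr hk (one_pow 2) (one_smul ℝ _).symm _ hB, fluxForm,
      ← mixedDisc_vecMulVec_cons _ (unitConormal u x) (unitNormal (hypMetric n) u x) _
        (sum_unitConormal_mul_unitNormal h), ← mixedDisc_reindex e]
    · congr 2
      ext1 a
      by_cases ha : a = Sum.inr 0
      · rw [ha, he, Function.update_self]; rfl
      · rw [Function.update_of_ne ha]
        obtain ⟨b, hb⟩ := Fin.exists_succ_eq.2 (show e a ≠ 0 from fun h0 =>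
          ha (e.injective (h0.trans he.symm)))
        rw [← hb, Fin.cons_succ]
    · intro i
      simp_rw [Matrix.transpose_apply]
      exact sum_weingarten_mul_unitConormal hu h i
  have hch : (weingarten (hypMetric n) u x).transpose.charpoly =
      (weingarten (hypMetric n) u x).charpoly := Matrix.charpoly_transpose _
  rw [hα, fluxForm_smul_right, hm, ← factorial_mul_esymm_roots _ hkn
    (by rw [hch]; exact splits_charpoly_weingarten hu h), hch, meanCurv, areaDensity,
    sqrt_det_hypMetric]
  have := (V_pos x).ne'
  field_simp

end LevelSet

/-! ### The area of graphs -/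

lemma euclideanHausdorffMeasure_image_le {X Y : Type*} [EMetricSpace X] [MeasurableSpace X]
    [BorelSpace X] [EMetricSpace Y] [MeasurableSpace Y] [BorelSpace Y] {K : NNReal} {h : X → Y}
    {s : Set X} (hh : LipschitzOnWith K h s) (d : ℕ) :
    (μHE[d] : Measure Y) (h '' s) ≤ (K : ENNReal) ^ d * (μHE[d] : Measure X) s := by
  rw [Measure.euclideanHausdorffMeasure_def, Measure.euclideanHausdorffMeasure_def,
    Measure.smul_apply, Measure.smul_apply, ENNReal.smul_def, ENNReal.smul_def, smul_eq_mul,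
    smul_eq_mul, mul_left_comm]
  gcongr
  have := hh.hausdorffMeasure_image_le (d := (d : ℝ)) (by positivity)
  rwa [ENNReal.rpow_natCast] at this

/-- The splitting of the `i`-th coordinate. -/
def insertCoord {m : ℕ} (i : Fin (m + 1)) : (H m × ℝ) ≃L[ℝ] H (m + 1) :=
  LinearEquiv.toContinuousLinearEquiv
    { toFun := fun p => WithLp.toLp 2 (Fin.insertNth i p.2 p.1.ofLp)
      invFun := fun x => (WithLp.toLp 2 fun j => x (i.succAbove j), x i)
      map_add' := fun p q => by
        ext j
        rcases Fin.eq_self_or_eq_succAbove i j with rfl | ⟨j, rfl⟩ <;> simp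
      map_smul' := fun c p => by
        ext j
        rcases Fin.eq_self_or_eq_succAbove i j with rfl | ⟨j, rfl⟩ <;> simp
      left_inv := fun p => by ext <;> simp
      right_inv := fun x => by
        ext j
        rcases Fin.eq_self_or_eq_succAbove i j with rfl | ⟨j, rfl⟩ <;> simp }

section Graph

variable {m : ℕ} (i : Fin (m + 1))

@[simp] lemma insertCoord_self (p : H m × ℝ) : insertCoord i p i = p.2 :=
  Fin.insertNth_apply_same (α := fun _ => ℝ) i p.2 p.1.ofLp

@[simp] lemma insertCoord_succAbove (p : H m × ℝ) (j : Fin m) :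
    insertCoord i p (i.succAbove j) = p.1 j :=
  Fin.insertNth_apply_succAbove (α := fun _ => ℝ) i p.2 p.1.ofLp j

lemma norm_insertCoord_sq (p : H m × ℝ) : ‖insertCoord i p‖ ^ 2 = ‖p.1‖ ^ 2 + p.2 ^ 2 := by
  rw [norm_sq_eq_sum, norm_sq_eq_sum, Fin.sum_univ_succAbove _ i]
  simp [add_comm, sq]

lemma insertCoord_zero_one : insertCoord i ((0 : H m), (1 : ℝ)) = EuclideanSpace.single i 1 := by
  ext j
  rcases Fin.eq_self_or_eq_succAbove i j with rfl | ⟨j, rfl⟩ <;> simp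

lemma insertCoord_single_zero (j : Fin m) :
    insertCoord i (EuclideanSpace.single j (1 : ℝ), (0 : ℝ)) =
      EuclideanSpace.single (i.succAbove j) 1 := by
  ext l
  rcases Fin.eq_self_or_eq_succAbove i l with rfl | ⟨l, rfl⟩ <;> simp

lemma measurePreserving_insertCoord :
    MeasurePreserving (insertCoord i : H m × ℝ → H (m + 1)) volume volume := by
  have h1 : MeasurePreserving (fun p : H m × ℝ => (p.2, p.1.ofLp)) volume volume :=
    (Measure.measurePreserving_swap (μ := (volume : Measure (Fin m → ℝ)))
      (ν := (volume : Measure ℝ))).comp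
      ((PiLp.volume_preserving_ofLp (Fin m)).prod (MeasurePreserving.id volume))
  have h2 := (volume_preserving_piFinSuccAbove (fun _ : Fin (m + 1) => ℝ) i).symm
  exact (PiLp.volume_preserving_toLp (Fin (m + 1))).comp (h2.comp h1)

/-- The Jacobian of the graph map. -/
def graphJacobian (ζ : H m → ℝ) (y : H m) : ℝ := √(1 + ∑ j, pd j ζ y ^ 2)

lemma graphJacobian_pos (ζ : H m → ℝ) (y : H m) : 0 < graphJacobian ζ y :=
  Real.sqrt_pos.2 (by positivity)

/-- The Gram matrix of y ↦ (y, l y) is the identity plus l ⊗ l, with determinant 1 + |l|². -/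
lemma measure_image_linear_graph (l : H m →L[ℝ] ℝ) (A : Set (H m)) :
    (μHE[m] : Measure (H (m + 1))) ((fun y => insertCoord i (y, l y)) '' A) =
      ENNReal.ofReal √(1 + ∑ j, l (EuclideanSpace.single j 1) ^ 2) * volume A := by
  let L : H m →ₗ[ℝ] H (m + 1) :=
    ((insertCoord i : H m × ℝ →L[ℝ] H (m + 1)).comp
      ((ContinuousLinearMap.id ℝ (H m)).prod l)).toLinearMap
  have hL : ∀ y, L y = insertCoord i (y, l y) := fun y => rfl
  have h1 := L.euclideanHausdorffMeasure_image_eq_normDet_mul_volume A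
  rw [finrank_euclideanSpace_fin] at h1
  have h2 : L.normDet = √(1 + ∑ j, l (EuclideanSpace.single j 1) ^ 2) := by
    rw [eq_comm, Real.sqrt_eq_iff_eq_sq (by positivity) L.normDet_nonneg, eq_comm]
    · have h3 := L.normDet_sq_eq_det_gram (EuclideanSpace.basisFun (Fin m) ℝ)
      have h4 : L.normDet ^ 2 = (Matrix.gram ℝ fun j => L (EuclideanSpace.basisFun (Fin m) ℝ j)).det :=
        h3
      rw [h4]
      have h5 : (Matrix.gram ℝ fun j => L (EuclideanSpace.basisFun (Fin m) ℝ j)) =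
          1 + Matrix.vecMulVec (fun j => l (EuclideanSpace.single j 1))
            (fun j => l (EuclideanSpace.single j 1)) := by
        ext a b
        rw [Matrix.gram_apply, hL, hL, PiLp.inner_apply, Fin.sum_univ_succAbove _ i]
        simp [Matrix.one_apply, Matrix.vecMulVec_apply, add_comm, mul_comm, eq_comm]
      rw [h5, Matrix.vecMulVec_eq Unit, Matrix.det_one_add_replicateCol_mul_replicateRow]
      simp [dotProduct, sq]
  rw [← h2]
  exact h1

variable {i}

lemma norm_insertCoord_le (v : H m) (a b : ℝ) :
    ‖insertCoord i (v, a)‖ ≤ ‖insertCoord i (v, b)‖ + |a - b| := by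
  have h : insertCoord i (v, a) = insertCoord i (v, b) + insertCoord i ((0 : H m), a - b) := by
    rw [← map_add]; simp
  have h2 : ‖insertCoord i ((0 : H m), a - b)‖ = |a - b| := by
    rw [← Real.sqrt_sq (norm_nonneg _), norm_insertCoord_sq, ← Real.sqrt_sq_eq_abs]; simp
  rw [h, ← h2]
  exact norm_add_le _ _

lemma norm_fst_le_norm_insertCoord (p : H m × ℝ) : ‖p.1‖ ≤ ‖insertCoord i p‖ := by
  refine le_of_sq_le_sq ?_ (norm_nonneg _)
  rw [norm_insertCoord_sq]
  nlinarith [sq_nonneg p.2]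

/-- Strict differentiability makes the vertical projection between the graph of ζ and that of its
linearization c-Lipschitz in both directions, and a c-Lipschitz map increases m-dimensional measure
by at most c^m. -/
lemma exists_measure_graph_le {ζ : H m → ℝ} {y₀ : H m} {l : H m →L[ℝ] ℝ}
    (hζ : HasStrictFDerivAt ζ l y₀) {c : NNReal} (hc : 1 < c) :
    ∃ U ∈ 𝓝 y₀, ∀ A ⊆ U,
      (μHE[m] : Measure (H (m + 1))) ((fun y => insertCoord i (y, ζ y)) '' A) ≤
        (c : ENNReal) ^ m *
          (ENNReal.ofReal √(1 + ∑ j, l (EuclideanSpace.single j 1) ^ 2) * volume A) ∧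
      ENNReal.ofReal √(1 + ∑ j, l (EuclideanSpace.single j 1) ^ 2) * volume A ≤
        (c : ENNReal) ^ m *
          (μHE[m] : Measure (H (m + 1))) ((fun y => insertCoord i (y, ζ y)) '' A) := by
  have hc' : (1 : ℝ) < c := by exact_mod_cast hc
  -- This tolerance serves both directions: c (1 - r) = 1, and 1 + r ≤ c because c + 1/c ≥ 2.
  set r : ℝ := 1 - (c : ℝ)⁻¹ with hr
  have hr0 : 0 < r := sub_pos.2 (inv_lt_one_of_one_lt₀ hc')
  have hcr : (c : ℝ) * (1 - r) = 1 := by rw [hr]; field_simp; ring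
  obtain ⟨U, hU, hA⟩ := hζ.approximates_deriv_on_nhds (c := ⟨r, hr0.le⟩) (Or.inr hr0)
  have key : ∀ y ∈ U, ∀ y' ∈ U, |(ζ y - ζ y') - (l y - l y')| ≤ r * ‖y - y'‖ := by
    intro y hy y' hy'
    have := hA y hy y' hy'
    rwa [map_sub] at this
  have hsub : ∀ p q : H m × ℝ, dist (insertCoord i p) (insertCoord i q) =
      ‖insertCoord i (p.1 - q.1, p.2 - q.2)‖ := by
    intro p q
    rw [dist_eq_norm, ← map_sub]; rfl
  have b1 : ∀ y ∈ U, ∀ y' ∈ U, dist (insertCoord i (y, ζ y)) (insertCoord i (y', ζ y')) ≤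
      c * dist (insertCoord i (y, l y)) (insertCoord i (y', l y')) := by
    intro y hy y' hy'
    rw [hsub, hsub]
    have h1 := norm_insertCoord_le (i := i) (y - y') (ζ y - ζ y') (l y - l y')
    have h2 := norm_fst_le_norm_insertCoord (i := i) (y - y', l y - l y')
    have h3 := key y hy y' hy'
    simp only at h1 h2 ⊢
    have h4 : 0 ≤ ‖insertCoord i (y - y', l y - l y')‖ := norm_nonneg _
    have h5 : 1 + r ≤ c := by nlinarith [sq_nonneg r, inv_pos.2 (zero_lt_one.trans hc')]
    nlinarith
  have b2 : ∀ y ∈ U, ∀ y' ∈ U, dist (insertCoord i (y, l y)) (insertCoord i (y', l y')) ≤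
      c * dist (insertCoord i (y, ζ y)) (insertCoord i (y', ζ y')) := by
    intro y hy y' hy'
    rw [hsub, hsub]
    have h1 := norm_insertCoord_le (i := i) (y - y') (l y - l y') (ζ y - ζ y')
    have h2 := norm_fst_le_norm_insertCoord (i := i) (y - y', l y - l y')
    have h3 := key y hy y' hy'
    rw [abs_sub_comm] at h1
    simp only at h1 h2 ⊢
    have h4 : (1 - r) * ‖insertCoord i (y - y', l y - l y')‖ ≤
        ‖insertCoord i (y - y', ζ y - ζ y')‖ := by nlinarith
    calc ‖insertCoord i (y - y', l y - l y')‖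
        = c * ((1 - r) * ‖insertCoord i (y - y', l y - l y')‖) := by rw [← mul_assoc, hcr, one_mul]
      _ ≤ _ := by gcongr
  refine ⟨U, hU, fun A hAU => ?_⟩
  rw [← measure_image_linear_graph i l A]
  constructor
  · have h : LipschitzOnWith c (fun z : H (m + 1) => insertCoord i
        (((insertCoord i).symm z).1, ζ ((insertCoord i).symm z).1))
        ((fun y => insertCoord i (y, l y)) '' A) := by
      refine LipschitzOnWith.of_dist_le_mul ?_
      rintro _ ⟨y, hy, rfl⟩ _ ⟨y', hy', rfl⟩
      simpa using b1 y (hAU hy) y' (hAU hy')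
    have := euclideanHausdorffMeasure_image_le h m
    rw [image_image] at this
    simpa using this
  · have h : LipschitzOnWith c (fun z : H (m + 1) => insertCoord i
        (((insertCoord i).symm z).1, l ((insertCoord i).symm z).1))
        ((fun y => insertCoord i (y, ζ y)) '' A) := by
      refine LipschitzOnWith.of_dist_le_mul ?_
      rintro _ ⟨y, hy, rfl⟩ _ ⟨y', hy', rfl⟩
      simpa using b2 y (hAU hy) y' (hAU hy')
    have := euclideanHausdorffMeasure_image_le h m
    rw [image_image] at this
    simpa using this

/-- By the Lindelöf property countably many of the neighbourhoods cover D; made disjoint, they cut A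
into pieces on which the inequality is known. -/
lemma measure_le_of_locally_le {X : Type*} [TopologicalSpace X] [SecondCountableTopology X]
    [MeasurableSpace X] [OpensMeasurableSpace X] {μ ν : Measure X} {D : Set X}
    (h : ∀ x ∈ D, ∃ U ∈ 𝓝 x, ∀ A ⊆ U ∩ D, MeasurableSet A → μ A ≤ ν A) {A : Set X} (hAD : A ⊆ D)
    (hA : MeasurableSet A) : μ A ≤ ν A := by
  rcases D.eq_empty_or_nonempty with rfl | hne
  · simp [subset_empty_iff.1 hAD]
  choose! U hU hUA using h
  obtain ⟨t, htD, htc, ht⟩ := TopologicalSpace.countable_cover_nhdsWithin (s := D)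
    (f := fun x => interior (U x)) fun x hx => mem_nhdsWithin_of_mem_nhds (interior_mem_nhds.2 (hU x hx))
  have htne : t.Nonempty := by
    obtain ⟨x, hx⟩ := hne
    obtain ⟨y, hy, -⟩ := mem_iUnion₂.1 (ht hx)
    exact ⟨y, hy⟩
  obtain ⟨s, rfl⟩ := htc.exists_eq_range htne
  set B : ℕ → Set X := disjointed fun n => interior (U (s n)) with hB
  have hBm : ∀ n, MeasurableSet (B n) := MeasurableSet.disjointed fun n => isOpen_interior.measurableSet
  have hAB : A = ⋃ n, A ∩ B n := by
    rw [← inter_iUnion, hB, iUnion_disjointed, eq_comm, inter_eq_left]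
    intro x hx
    have := ht (hAD hx)
    rwa [biUnion_range] at this
  have hd : Pairwise (Function.onFun Disjoint fun n => A ∩ B n) := fun a b hab =>
    ((disjoint_disjointed _) hab).mono inter_subset_right inter_subset_right
  rw [hAB, measure_iUnion hd fun n => hA.inter (hBm n), measure_iUnion hd fun n => hA.inter (hBm n)]
  refine ENNReal.tsum_le_tsum fun n => hUA (s n) (htD (mem_range_self n)) _ ?_ (hA.inter (hBm n))
  exact subset_inter (inter_subset_right.trans ((disjointed_subset _ _).trans interior_subset))
    (inter_subset_left.trans hAD)

lemma le_of_forall_one_lt_pow_mul_le {x y : ENNReal} {d : ℕ}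
    (h : ∀ c : NNReal, 1 < c → x ≤ (c : ENNReal) ^ d * y) : x ≤ y := by
  have h1 : Tendsto (fun c : NNReal => (c : ENNReal) ^ d * y) (𝓝[>] 1) (𝓝 (1 * y)) := by
    refine ENNReal.Tendsto.mul_const ?_ (Or.inl one_ne_zero)
    have : Tendsto (fun c : NNReal => ((c ^ d : NNReal) : ENNReal)) (𝓝[>] 1)
        (𝓝 ((1 ^ d : NNReal) : ENNReal)) :=
      ENNReal.tendsto_coe.2 (((continuous_pow d).tendsto 1).mono_left nhdsWithin_le_nhds)
    simpa using this
  rw [one_mul] at h1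
  exact ge_of_tendsto h1 (eventually_mem_nhdsWithin.mono fun c hc => h c hc)

lemma continuousAt_graphJacobian {ζ : H m → ℝ} {y : H m} (h : ContDiffAt ℝ 1 ζ y) :
    ContinuousAt (graphJacobian ζ) y := by
  have h1 : ∀ j, ContinuousAt (fun y => pd j ζ y) y := fun j =>
    ((h.fderiv_right (m := 0) (by simp)).continuousAt).clm_apply continuousAt_const
  exact (continuousAt_const.add (tendsto_finsetSum _ fun j _ => (h1 j).pow 2)).sqrt

/-- The area formula for graphs. -/
theorem measure_image_graph {ζ : H m → ℝ} {D : Set (H m)} (hζ : ∀ y ∈ D, ContDiffAt ℝ 1 ζ y)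
    {A : Set (H m)} (hAD : A ⊆ D) (hA : MeasurableSet A) :
    (μHE[m] : Measure (H (m + 1))) ((fun y => insertCoord i (y, ζ y)) '' A) =
      ∫⁻ y in A, ENNReal.ofReal (graphJacobian ζ y) := by
  set γ : H m → H (m + 1) := fun y => insertCoord i (y, ζ y) with hγ
  set pr : H (m + 1) → H m := fun z => ((insertCoord i).symm z).1 with hpr
  have hprm : Measurable pr := (continuous_fst.comp (insertCoord i).symm.continuous).measurable
  -- Projecting to the base makes both sides measures on the same space, so that local comparison
  -- suffices.
  set ν : Measure (H m) := ((μHE[m] : Measure (H (m + 1))).restrict (γ '' D)).map pr with hν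
  set κ : Measure (H m) := volume.withDensity fun y => ENNReal.ofReal (graphJacobian ζ y) with hκ
  have hνA : ∀ B ⊆ D, MeasurableSet B → ν B = (μHE[m] : Measure (H (m + 1))) (γ '' B) := by
    intro B hB hBm
    rw [hν, Measure.map_apply hprm hBm, Measure.restrict_apply (hprm hBm)]
    congr 1
    ext z
    constructor
    · rintro ⟨hz, y, hy, rfl⟩
      exact ⟨y, by simpa [hpr, hγ] using hz, rfl⟩
    · rintro ⟨y, hy, rfl⟩
      exact ⟨by simpa [hpr, hγ] using hy, y, hB hy, rfl⟩
  rw [← hνA A hAD hA, ← withDensity_apply _ hA]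
  -- In the exponent m + 1, the m comes from the Lipschitz comparison with the tangent plane and the
  -- extra 1 from the oscillation of the Jacobian. Afterwards c decreases to 1.
  have loc : ∀ c : NNReal, 1 < c → ∀ y₀ ∈ D, ∃ U ∈ 𝓝 y₀, ∀ B ⊆ U ∩ D, MeasurableSet B →
      ν B ≤ (c : ENNReal) ^ (m + 1) * κ B ∧ κ B ≤ (c : ENNReal) ^ (m + 1) * ν B := by
    intro c hc y₀ hy₀
    have hc' : (1 : ℝ) < c := by exact_mod_cast hc
    obtain ⟨U, hU, hUB⟩ := exists_measure_graph_le (i := i)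
      ((hζ y₀ hy₀).hasStrictFDerivAt (by simp)) hc
    have hJ := graphJacobian_pos ζ y₀
    have hJc := continuousAt_graphJacobian (hζ y₀ hy₀)
    have e1 : ∀ᶠ y in 𝓝 y₀, graphJacobian ζ y < c * graphJacobian ζ y₀ :=
      hJc.eventually_lt_const (by nlinarith)
    have e2 : ∀ᶠ y in 𝓝 y₀, graphJacobian ζ y₀ < c * graphJacobian ζ y :=
      (show ContinuousAt (fun y => (c : ℝ) * graphJacobian ζ y) y₀ from
        continuousAt_const.mul hJc).eventually_const_lt (by nlinarith)
    refine ⟨U ∩ {y | graphJacobian ζ y < c * graphJacobian ζ y₀ ∧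
      graphJacobian ζ y₀ < c * graphJacobian ζ y}, inter_mem hU (e1.and e2), fun B hB hBm => ?_⟩
    obtain ⟨h1, h2⟩ := hUB B fun y hy => (hB hy).1.1
    rw [hνA B (fun y hy => (hB hy).2) hBm, hκ, withDensity_apply _ hBm]
    change _ ≤ (c : ENNReal) ^ m * (ENNReal.ofReal (graphJacobian ζ y₀) * volume B) at h1
    change ENNReal.ofReal (graphJacobian ζ y₀) * volume B ≤ _ at h2
    have h3 : ENNReal.ofReal (graphJacobian ζ y₀) * volume B ≤
        c * ∫⁻ y in B, ENNReal.ofReal (graphJacobian ζ y) := by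
      rw [← lintegral_const_mul' _ _ ENNReal.coe_ne_top, ← setLIntegral_const]
      refine setLIntegral_mono' hBm fun y hy => ?_
      rw [← ENNReal.ofReal_coe_nnreal, ← ENNReal.ofReal_mul c.coe_nonneg]
      exact ENNReal.ofReal_le_ofReal (hB hy).1.2.2.le
    have h4 : ∫⁻ y in B, ENNReal.ofReal (graphJacobian ζ y) ≤
        c * (ENNReal.ofReal (graphJacobian ζ y₀) * volume B) := by
      rw [← mul_assoc, ← setLIntegral_const]
      refine setLIntegral_mono' hBm fun y hy => ?_
      rw [← ENNReal.ofReal_coe_nnreal, ← ENNReal.ofReal_mul c.coe_nonneg]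
      exact ENNReal.ofReal_le_ofReal (hB hy).1.2.1.le
    constructor
    · refine h1.trans ?_
      rw [pow_succ, mul_assoc]
      gcongr
    · refine h4.trans ?_
      rw [pow_succ', mul_assoc]
      gcongr
  refine le_antisymm ?_ ?_
  · refine le_of_forall_one_lt_pow_mul_le (d := m + 1) fun c hc => ?_
    have := measure_le_of_locally_le (μ := ν) (ν := (c : ENNReal) ^ (m + 1) • κ) (D := D)
      (fun y hy => by
        obtain ⟨U, hU, h⟩ := loc c hc y hy
        exact ⟨U, hU, fun B hB hBm => (h B hB hBm).1⟩) hAD hA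
    simpa using this
  · refine le_of_forall_one_lt_pow_mul_le (d := m + 1) fun c hc => ?_
    have := measure_le_of_locally_le (μ := κ) (ν := (c : ENNReal) ^ (m + 1) • ν) (D := D)
      (fun y hy => by
        obtain ⟨U, hU, h⟩ := loc c hc y hy
        exact ⟨U, hU, fun B hB hBm => (h B hB hBm).2⟩) hAD hA
    simpa using this

end Graph

/-! ### Local graph coordinates at a hypersurface -/

section Box

variable {m : ℕ} {i : Fin (m + 1)}

/-- Coordinates around the graph of `ζ`: the point at height `σ t` over the graph. -/
def boxMap (i : Fin (m + 1)) (σ : ℝ) (ζ : H m → ℝ) (y : H m) (t : ℝ) : H (m + 1) :=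
  insertCoord i (y, ζ y + σ * t)

/-- A box in which `{ρ = 0}` is the graph of `ζ` over `D` in the `i`-th coordinate. -/
structure IsGraphBox (ρ : H (m + 1) → ℝ) (O : Set (H (m + 1))) (i : Fin (m + 1)) (σ b : ℝ)
    (D : Set (H m)) (ζ : H m → ℝ) : Prop where
  sq_eq : σ ^ 2 = 1
  pos_b : 0 < b
  isOpen_D : IsOpen D
  bounded : Bornology.IsBounded D
  preconnected : IsPreconnected D
  contDiffAt : ∀ y ∈ D, ContDiffAt ℝ 1 ζ y
  mem : ∀ y ∈ D, ∀ t, |t| < b → boxMap i σ ζ y t ∈ O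
  eq_zero_iff : ∀ y ∈ D, ∀ t, |t| < b → (ρ (boxMap i σ ζ y t) = 0 ↔ t = 0)
  pos_iff : ∀ y ∈ D, ∀ t, |t| < b → (0 < ρ (boxMap i σ ζ y t) ↔ 0 < t)
  jacobian : ∀ y ∈ D, 0 < σ * pd i ρ (boxMap i σ ζ y 0) ∧ graphJacobian ζ y =
    √(∑ j, pd j ρ (boxMap i σ ζ y 0) ^ 2) / (σ * pd i ρ (boxMap i σ ζ y 0))

/-- The open set covered by a box. -/
def boxSet (i : Fin (m + 1)) (b : ℝ) (D : Set (H m)) (ζ : H m → ℝ) : Set (H (m + 1)) :=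
  {x | ((insertCoord i).symm x).1 ∈ D ∧ |x i - ζ ((insertCoord i).symm x).1| < b}

lemma hasDerivAt_boxMap (σ : ℝ) (ζ : H m → ℝ) (y : H m) (t : ℝ) :
    HasDerivAt (boxMap i σ ζ y) (σ • EuclideanSpace.single i 1) t := by
  have h1 : HasDerivAt (fun t : ℝ => (y, ζ y + σ * t)) ((0 : H m), σ) t :=
    (hasDerivAt_const t y).prodMk (by simpa using ((hasDerivAt_id t).const_mul σ).const_add (ζ y))
  have h2 := (insertCoord i).hasFDerivAt.comp_hasDerivAt t h1
  have h3 : insertCoord i ((0 : H m), σ) = σ • EuclideanSpace.single i 1 := by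
    rw [← insertCoord_zero_one, ← map_smul]; simp
  rw [← h3]
  exact h2

lemma hasDerivAt_comp_boxMap {σ : ℝ} {ζ : H m → ℝ} {y : H m} {t : ℝ} {F : H (m + 1) → ℝ}
    (hF : DifferentiableAt ℝ F (boxMap i σ ζ y t)) :
    HasDerivAt (fun t => F (boxMap i σ ζ y t)) (σ * pd i F (boxMap i σ ζ y t)) t := by
  have := hF.hasFDerivAt.comp_hasDerivAt t (hasDerivAt_boxMap (i := i) σ ζ y t)
  rw [map_smul] at this
  exact this

lemma mem_boxSet_boxMap {σ b : ℝ} (hσ : σ ^ 2 = 1) {D : Set (H m)} {ζ : H m → ℝ} {y : H m} {t : ℝ} :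
    boxMap i σ ζ y t ∈ boxSet i b D ζ ↔ y ∈ D ∧ |t| < b := by
  have : |σ| = 1 := by
    rw [← sq_abs] at hσ
    nlinarith [abs_nonneg σ]
  simp [boxSet, boxMap, abs_mul, this]

lemma exists_boxMap_eq {σ b : ℝ} (hσ : σ ^ 2 = 1) {D : Set (H m)} {ζ : H m → ℝ} {x : H (m + 1)}
    (hx : x ∈ boxSet i b D ζ) : ∃ y ∈ D, ∃ t, |t| < b ∧ boxMap i σ ζ y t = x := by
  set y := ((insertCoord i).symm x).1
  have h : boxMap i σ ζ y (σ * (x i - ζ y)) = x := by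
    have : ζ y + σ * (σ * (x i - ζ y)) = x i := by linear_combination (x i - ζ y) * hσ
    rw [boxMap, this]
    exact (insertCoord i).apply_symm_apply x
  rw [← h] at hx
  exact ⟨y, ((mem_boxSet_boxMap hσ).1 hx).1, _, ((mem_boxSet_boxMap hσ).1 hx).2, h⟩

namespace IsGraphBox

variable {ρ : H (m + 1) → ℝ} {O : Set (H (m + 1))} {σ b : ℝ} {D : Set (H m)} {ζ : H m → ℝ}

lemma isOpen_boxSet (h : IsGraphBox ρ O i σ b D ζ) : IsOpen (boxSet i b D ζ) := by
  have h1 : Continuous fun x : H (m + 1) => ((insertCoord i).symm x).1 :=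
    continuous_fst.comp (insertCoord i).symm.continuous
  have h2 : ContinuousOn (fun x : H (m + 1) => |x i - ζ ((insertCoord i).symm x).1|)
      ((fun x : H (m + 1) => ((insertCoord i).symm x).1) ⁻¹' D) := by
    intro x hx
    have h3 : ContinuousAt (fun x : H (m + 1) => ζ ((insertCoord i).symm x).1) x :=
      ContinuousAt.comp (f := fun x : H (m + 1) => ((insertCoord i).symm x).1) (g := ζ)
        (h.contDiffAt _ hx).continuousAt h1.continuousAt
    exact (((coord_differentiableAt i).continuousAt.sub h3).abs).continuousWithinAt
  exact h2.isOpen_inter_preimage (h.isOpen_D.preimage h1) isOpen_Iio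

lemma boxSet_subset (h : IsGraphBox ρ O i σ b D ζ) : boxSet i b D ζ ⊆ O := by
  intro x hx
  obtain ⟨y, hy, t, ht, rfl⟩ := exists_boxMap_eq h.sq_eq hx
  exact h.mem y hy t ht

/-- The area formula on the zero set of the defining function in a box. -/
lemma map_boxMap (h : IsGraphBox ρ O i σ b D ζ) {S : Set (H (m + 1))}
    (hS : ∀ x ∈ boxSet i b D ζ, x ∈ S ↔ ρ x = 0) {A : Set (H (m + 1))}
    (hA : MeasurableSet A) :
    (μHE[m] : Measure (H (m + 1))) (A ∩ (S ∩ boxSet i b D ζ)) =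
      ∫⁻ y in D ∩ (fun y => boxMap i σ ζ y 0) ⁻¹' A, ENNReal.ofReal (graphJacobian ζ y) := by
  have hc : ContinuousOn (fun y => boxMap i σ ζ y 0) D := by
    intro y hy
    have : ContinuousAt (fun y => (y, ζ y + σ * 0)) y :=
      continuousAt_id.prodMk ((h.contDiffAt y hy).continuousAt.add continuousAt_const)
    exact ((insertCoord i).continuous.continuousAt.comp this).continuousWithinAt
  have hm : MeasurableSet (D ∩ (fun y => boxMap i σ ζ y 0) ⁻¹' A) := by
    have := h.isOpen_D.measurableSet.subtype_image
      ((continuousOn_iff_continuous_domRestrict.1 hc).measurable hA)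
    convert this using 1
    ext y; simp [and_comm]
  rw [← measure_image_graph (i := i) h.contDiffAt inter_subset_left hm]
  congr 1
  ext x
  constructor
  · rintro ⟨hxA, hxS, hx⟩
    obtain ⟨y, hy, t, ht, rfl⟩ := exists_boxMap_eq h.sq_eq hx
    have h0 := (h.eq_zero_iff y hy t ht).1 ((hS _ hx).1 hxS)
    subst h0
    exact ⟨y, ⟨hy, hxA⟩, by simp [boxMap]⟩
  · rintro ⟨y, ⟨hy, hyA⟩, rfl⟩
    have e : insertCoord i (y, ζ y) = boxMap i σ ζ y 0 := by simp [boxMap]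
    have hb : boxMap i σ ζ y 0 ∈ boxSet i b D ζ :=
      (mem_boxSet_boxMap h.sq_eq).2 ⟨hy, by simpa using h.pos_b⟩
    simp only [e]
    exact ⟨hyA, (hS _ hb).2 ((h.eq_zero_iff y hy 0 (by simpa using h.pos_b)).2 rfl), hb⟩

end IsGraphBox

/-- The implicit function theorem in the i-th coordinate. With σ the sign of ∂_i ρ, the function ρ
increases strictly along every vertical segment of a small box, which determines its sign there. -/
lemma exists_isGraphBox {ρ : H (m + 1) → ℝ} {p : H (m + 1)} (hρ : ContDiffAt ℝ 1 ρ p)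
    (hp : ρ p = 0) (hi : pd i ρ p ≠ 0) {O : Set (H (m + 1))} (hO : O ∈ 𝓝 p) :
    ∃ σ b D ζ, IsGraphBox ρ O i σ b D ζ ∧ p ∈ boxSet i b D ζ := by
  set u := (insertCoord i).symm p with hu
  have hup : insertCoord i u = p := (insertCoord i).apply_symm_apply p
  set g : H m × ℝ → ℝ := fun v => ρ (insertCoord i v) with hg
  have hev : ∀ᶠ x in 𝓝 p, ContDiffAt ℝ 1 ρ x := hρ.eventually (by simp)
  have hgu : ContDiffAt ℝ 1 g u := by
    refine ContDiffAt.comp u ?_ (insertCoord i).contDiff.contDiffAt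
    rw [hup]; exact hρ
  have hfd : ∀ v, DifferentiableAt ℝ ρ (insertCoord i v) →
      HasFDerivAt g ((fderiv ℝ ρ (insertCoord i v)).comp (insertCoord i : H m × ℝ →L[ℝ] H (m + 1))) v :=
    fun v hv => hv.hasFDerivAt.comp v (insertCoord i).hasFDerivAt
  have hinv : (fderiv ℝ g u ∘L .inr ℝ (H m) ℝ).IsInvertible := by
    have e : fderiv ℝ g u ∘L .inr ℝ (H m) ℝ = (ContinuousLinearEquiv.unitsEquivAut ℝ
        (Units.mk0 _ hi) : ℝ →L[ℝ] ℝ) := by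
      ext
      rw [(hfd u (by rw [hup]; exact hρ.differentiableAt (by simp))).fderiv]
      simp [hup, pd, insertCoord_zero_one]
    rw [e]
    exact ContinuousLinearMap.isInvertible_equiv
  set ζ := hgu.implicitFunction one_ne_zero hinv with hζ
  have hζu : ζ u.1 = u.2 := hgu.implicitFunction_apply_self one_ne_zero hinv
  have hζC : ∀ᶠ y in 𝓝 u.1, ContDiffAt ℝ 1 ζ y :=
    (hgu.contDiffAt_implicitFunction one_ne_zero hinv).eventually (by simp)
  have hgz : ∀ᶠ y in 𝓝 u.1, ρ (insertCoord i (y, ζ y)) = 0 := by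
    have := hgu.eventually_apply_implicitFunction one_ne_zero hinv
    simp only [hg, hup, hp] at this
    exact this
  set σ : ℝ := pd i ρ p / |pd i ρ p| with hσ
  have hσ2 : σ ^ 2 = 1 := by
    rw [hσ, div_pow, sq_abs, div_self (pow_ne_zero 2 hi)]
  have hσp : 0 < σ * pd i ρ p := by
    rw [hσ, div_mul_eq_mul_div, ← sq]
    exact div_pos (by positivity) (abs_pos.2 hi)
  have hpdc : ContinuousAt (fun x => σ * pd i ρ x) p :=
    continuousAt_const.mul (((hρ.fderiv_right (m := 0) (by simp)).continuousAt).clm_apply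
      continuousAt_const)
  have hgood : ∀ᶠ x in 𝓝 p, x ∈ O ∧ 0 < σ * pd i ρ x ∧ ContDiffAt ℝ 1 ρ x :=
    (eventually_mem_set.2 hO).and ((hpdc.eventually_const_lt hσp).and hev)
  have hcont : ContinuousAt (fun v : H m × ℝ => boxMap i σ ζ v.1 v.2) (u.1, 0) := by
    have h1 : ContinuousAt (fun v : H m × ℝ => ζ v.1) (u.1, 0) :=
      ContinuousAt.comp (f := Prod.fst) (g := ζ)
        (hgu.contDiffAt_implicitFunction one_ne_zero hinv).continuousAt continuousAt_fst
    have h2 : ContinuousAt (fun v : H m × ℝ => (v.1, ζ v.1 + σ * v.2)) (u.1, 0) :=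
      continuousAt_fst.prodMk (h1.add (continuousAt_const.mul continuousAt_snd))
    exact (insertCoord i).continuous.continuousAt.comp h2
  have hp0 : boxMap i σ ζ u.1 0 = p := by
    rw [boxMap, hζu]; simpa using hup
  have h3 : ∀ᶠ v in 𝓝 ((u.1, 0) : H m × ℝ), boxMap i σ ζ v.1 v.2 ∈ O ∧
      0 < σ * pd i ρ (boxMap i σ ζ v.1 v.2) ∧ ContDiffAt ℝ 1 ρ (boxMap i σ ζ v.1 v.2) := by
    have h4 := hcont.tendsto
    simp only [hp0] at h4
    exact h4.eventually hgood
  rw [nhds_prod_eq, eventually_prod_iff] at h3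
  obtain ⟨pa, hpa, pb, hpb, hab⟩ := h3
  obtain ⟨b, hb, hpb⟩ := Metric.eventually_nhds_iff.1 hpb
  obtain ⟨a, ha, hD⟩ := Metric.eventually_nhds_iff_ball.1 (hpa.and (hζC.and hgz))
  have hpb' : ∀ t, |t| < b → pb t := fun t ht => hpb (by simpa [Real.dist_eq] using ht)
  have hρ0 : ∀ y ∈ Metric.ball u.1 a, ρ (boxMap i σ ζ y 0) = 0 := fun y hy => by
    simpa [boxMap] using (hD y hy).2.2
  have hmono : ∀ y ∈ Metric.ball u.1 a,
      StrictMonoOn (fun t => ρ (boxMap i σ ζ y t)) (Ioo (-b) b) := by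
    intro y hy
    have hd : ∀ t ∈ Ioo (-b) b, HasDerivAt (fun t => ρ (boxMap i σ ζ y t))
        (σ * pd i ρ (boxMap i σ ζ y t)) t := fun t ht => hasDerivAt_comp_boxMap
      ((hab (hD y hy).1 (hpb' t (abs_lt.2 ht))).2.2.differentiableAt (by simp))
    refine strictMonoOn_of_deriv_pos (convex_Ioo _ _)
      (fun t ht => (hd t ht).continuousAt.continuousWithinAt) fun t ht => ?_
    rw [interior_Ioo] at ht
    rw [(hd t ht).deriv]
    exact (hab (hD y hy).1 (hpb' t (abs_lt.2 ht))).2.1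
  have h0 : (0 : ℝ) ∈ Ioo (-b) b := by simpa using hb
  refine ⟨σ, b, Metric.ball u.1 a, ζ, ⟨hσ2, hb, Metric.isOpen_ball, Metric.isBounded_ball,
    (convex_ball _ _).isPreconnected,
    fun y hy => (hD y hy).2.1, fun y hy t ht => (hab (hD y hy).1 (hpb' t ht)).1,
    fun y hy t ht => ?_, fun y hy t ht => ?_, fun y hy => ?_⟩, ?_⟩
  · have := (hmono y hy).injOn.eq_iff (abs_lt.1 ht) h0
    rwa [hρ0 y hy] at this
  · have := (hmono y hy).lt_iff_lt h0 (abs_lt.1 ht)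
    rwa [hρ0 y hy] at this
  · obtain ⟨-, hpos, hC⟩ := hab (hD y hy).1 (hpb' 0 (by simpa using hb))
    refine ⟨hpos, ?_⟩
    have e : insertCoord i (y, ζ y) = boxMap i σ ζ y 0 := by simp [boxMap]
    have hζd : HasFDerivAt ζ (fderiv ℝ ζ y) y :=
      ((hD y hy).2.1.differentiableAt (by simp)).hasFDerivAt
    have hc : HasFDerivAt (fun y => ρ (insertCoord i (y, ζ y)))
        ((fderiv ℝ ρ (boxMap i σ ζ y 0)).comp ((insertCoord i : H m × ℝ →L[ℝ] H (m + 1)).comp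
          ((ContinuousLinearMap.id ℝ (H m)).prod (fderiv ℝ ζ y)))) y := by
      have h1 := (insertCoord i).hasFDerivAt.comp y ((hasFDerivAt_id y).prodMk hζd)
      refine HasFDerivAt.comp (g := ρ) y ?_ h1
      simp only [e]
      exact (hC.differentiableAt (by simp)).hasFDerivAt
    have hz : (fun y => ρ (insertCoord i (y, ζ y))) =ᶠ[𝓝 y] fun _ => 0 := by
      filter_upwards [Metric.isOpen_ball.mem_nhds hy] with y' hy'
      exact (hD y' hy').2.2
    -- Differentiating ρ(y, ζ y) = 0 expresses ∂ζ through ∂ρ, and hence the Jacobian as |dρ| / |∂_i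
    -- ρ|.
    have hzero := hc.unique ((hasFDerivAt_const (0 : ℝ) y).congr_of_eventuallyEq hz)
    have hj : ∀ j, pd (i.succAbove j) ρ (boxMap i σ ζ y 0) +
        pd j ζ y * pd i ρ (boxMap i σ ζ y 0) = 0 := by
      intro j
      have h1 := DFunLike.congr_fun hzero (EuclideanSpace.single j 1)
      simp only [ContinuousLinearMap.comp_apply, ContinuousLinearMap.prod_apply,
        ContinuousLinearMap.id_apply, zero_apply,
        ContinuousLinearEquiv.coe_coe] at h1
      have h2 : insertCoord i ((EuclideanSpace.single j (1 : ℝ) : H m),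
          fderiv ℝ ζ y (EuclideanSpace.single j 1)) =
          EuclideanSpace.single (i.succAbove j) 1 + pd j ζ y • EuclideanSpace.single i 1 := by
        rw [← insertCoord_single_zero, ← insertCoord_zero_one, ← map_smul, ← map_add]
        simp [pd]
      rw [h2, map_add, map_smul] at h1
      exact h1
    set a₀ := pd i ρ (boxMap i σ ζ y 0) with ha₀
    have hne : a₀ ≠ 0 := fun h => by simp [h] at hpos
    have hj' : ∀ j, pd (i.succAbove j) ρ (boxMap i σ ζ y 0) = - pd j ζ y * a₀ := fun j => by
      linear_combination hj j
    have hs : ∑ j, pd j ρ (boxMap i σ ζ y 0) ^ 2 = (σ * a₀) ^ 2 * (1 + ∑ j, pd j ζ y ^ 2) := by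
      rw [Fin.sum_univ_succAbove _ i, ← ha₀, mul_pow, hσ2, one_mul, mul_add, mul_one,
        Finset.mul_sum]
      congr 1
      refine Finset.sum_congr rfl fun j _ => ?_
      rw [hj']; ring
    rw [hs, Real.sqrt_mul (sq_nonneg _), Real.sqrt_sq hpos.le, mul_div_cancel_left₀ _ hpos.ne']
    rfl
  · rw [← hp0, mem_boxSet_boxMap hσ2]
    exact ⟨Metric.mem_ball_self ha, by simpa using hb⟩

end Box

/-! ### Concentration of cutoff derivatives at the boundary -/

section Concentration

variable {u u' k : ℝ → ℝ} {b M : ℝ}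

lemma cutoff_deriv_nonneg (j : ℕ) (t : ℝ) (hpos : 0 < u' t) :
    0 ≤ deriv smoothTransition (j * u t - 1) * (j * u' t) :=
  mul_nonneg Real.smoothTransition.monotone.deriv_nonneg (by positivity)

lemma hasDerivAt_cutoff (j : ℕ) {t : ℝ} (hd : HasDerivAt u (u' t) t) :
    HasDerivAt (fun t => smoothTransition (j * u t - 1))
      (deriv smoothTransition (j * u t - 1) * (j * u' t)) t := by
  have h : DifferentiableAt ℝ smoothTransition (j * u t - 1) :=
    (Real.smoothTransition.contDiffAt (n := 1)).differentiableAt (by simp)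
  exact h.hasDerivAt.comp t ((hd.const_mul (j : ℝ)).sub_const 1)

/-- The fundamental theorem of calculus; the lower end contributes nothing because the transition
function vanishes at -1. No bound on u' near 0 is available, and integrability follows from its sign
alone. -/
lemma integral_cutoff_deriv (hu : ContinuousOn u (Icc 0 b)) (hb : 0 ≤ b) (hu0 : u 0 = 0)
    (hd : ∀ t ∈ Ioo 0 b, HasDerivAt u (u' t) t) (hpos : ∀ t ∈ Ioo 0 b, 0 < u' t) (j : ℕ) :
    IntegrableOn (fun t => deriv smoothTransition (j * u t - 1) * (j * u' t)) (Ioo 0 b) ∧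
    ∫ t in Ioo 0 b, deriv smoothTransition (j * u t - 1) * (j * u' t) =
      smoothTransition (j * u b - 1) := by
  have hc : ContinuousOn (fun t => smoothTransition (j * u t - 1)) (Icc 0 b) :=
    Real.smoothTransition.continuous.comp_continuousOn
      ((continuousOn_const.mul hu).sub continuousOn_const)
  have h1 := intervalIntegral.integrableOn_deriv_of_nonneg hc
    (fun t ht => hasDerivAt_cutoff j (hd t ht)) fun t ht => cutoff_deriv_nonneg j t (hpos t ht)
  refine ⟨h1.mono_set Ioo_subset_Ioc_self, ?_⟩
  have h2 := intervalIntegral.integral_eq_sub_of_hasDerivAt_of_le hb hc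
    (fun t ht => hasDerivAt_cutoff j (hd t ht)) ((intervalIntegrable_iff_integrableOn_Ioc_of_le hb).2 h1)
  rw [intervalIntegral.integral_of_le hb, integral_Ioc_eq_integral_Ioo] at h2
  rw [h2, hu0, Real.smoothTransition.zero_of_nonpos (x := j * 0 - 1) (by norm_num), sub_zero]

lemma norm_integral_cutoff_deriv_mul_le (hu : ContinuousOn u (Icc 0 b)) (hb : 0 ≤ b)
    (hu0 : u 0 = 0) (hd : ∀ t ∈ Ioo 0 b, HasDerivAt u (u' t) t)
    (hpos : ∀ t ∈ Ioo 0 b, 0 < u' t) (hk : ∀ t ∈ Ioo 0 b, |k t| ≤ M) (hM : 0 ≤ M) (j : ℕ) :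
    ‖∫ t in Ioo 0 b, deriv smoothTransition (j * u t - 1) * (j * u' t) * k t‖ ≤ M := by
  obtain ⟨h1, h2⟩ := integral_cutoff_deriv hu hb hu0 hd hpos j
  refine (norm_integral_le_of_norm_le (h1.mul_const M) ?_).trans ?_
  · refine (ae_restrict_iff' measurableSet_Ioo).2 (Eventually.of_forall fun t ht => ?_)
    rw [norm_mul, Real.norm_of_nonneg (cutoff_deriv_nonneg j t (hpos t ht))]
    exact mul_le_mul_of_nonneg_left (hk t ht) (cutoff_deriv_nonneg j t (hpos t ht))
  · rw [integral_mul_const, h2]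
    exact mul_le_of_le_one_left hM (Real.smoothTransition.le_one _)

/-- The weights are nonnegative, have total mass 1 once j is large, and vanish where j u > 2. As u
is strictly increasing from 0, they form an approximate identity at t = 0. -/
lemma tendsto_integral_cutoff_deriv_mul (hu : ContinuousOn u (Icc 0 b)) (hb : 0 < b)
    (hu0 : u 0 = 0) (hd : ∀ t ∈ Ioo 0 b, HasDerivAt u (u' t) t)
    (hpos : ∀ t ∈ Ioo 0 b, 0 < u' t) (hk : ∀ t ∈ Ioo 0 b, |k t| ≤ M)
    (hkc : ContinuousOn k (Ico 0 b)) :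
    Tendsto (fun j : ℕ => ∫ t in Ioo 0 b, deriv smoothTransition (j * u t - 1) * (j * u' t) * k t)
      atTop (𝓝 (k 0)) := by
  have hmono : StrictMonoOn u (Icc 0 b) := by
    refine strictMonoOn_of_deriv_pos (convex_Icc _ _) hu fun t ht => ?_
    rw [interior_Icc] at ht
    rw [(hd t ht).deriv]; exact hpos t ht
  have hub : ∀ t ∈ Ioc 0 b, 0 < u t := fun t ht => by
    rw [← hu0]; exact hmono (left_mem_Icc.2 hb.le) (Ioc_subset_Icc_self ht) ht.1
  have hone : ∀ t ∈ Ioc 0 b, ∀ᶠ j : ℕ in atTop, 1 < j * u t - 1 := by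
    intro t ht
    have := (tendsto_natCast_atTop_atTop (R := ℝ)).atTop_mul_const (hub t ht)
    filter_upwards [this.eventually_gt_atTop 2] with j hj
    linarith
  rw [Metric.tendsto_nhds]
  intro ε hε
  obtain ⟨δ, hδ, hδk⟩ := Metric.continuousWithinAt_iff.1 (hkc 0 (left_mem_Ico.2 hb)) (ε / 2) (by linarith)
  set d := min (δ / 2) b with hd'
  have hd0 : d ∈ Ioc 0 b := ⟨by positivity, min_le_right _ _⟩
  filter_upwards [hone d hd0] with j hj
  obtain ⟨h1, h2⟩ := integral_cutoff_deriv hu hb.le hu0 hd hpos j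
  have hjb : 1 ≤ j * u b - 1 := by
    refine hj.le.trans ?_
    gcongr
    exact hmono.monotoneOn (Ioc_subset_Icc_self hd0) (right_mem_Icc.2 hb.le) hd0.2
  rw [Real.smoothTransition.one_of_one_le hjb] at h2
  have hbound : ∀ t ∈ Ioo 0 b, ‖deriv smoothTransition (j * u t - 1) * (j * u' t) * (k t - k 0)‖ ≤
      deriv smoothTransition (j * u t - 1) * (j * u' t) * (ε / 2) := by
    intro t ht
    have hw := cutoff_deriv_nonneg (u := u) j t (hpos t ht)
    rw [norm_mul, Real.norm_of_nonneg hw]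
    rcases le_or_gt t d with htd | htd
    · refine mul_le_mul_of_nonneg_left ?_ hw
      have := hδk (Ioo_subset_Ico_self ht) (by
        rw [Real.dist_eq, sub_zero, abs_of_pos ht.1]
        exact (htd.trans (min_le_left _ _)).trans_lt (by linarith))
      exact this.le
    · have hz : deriv smoothTransition (j * u t - 1) = 0 := by
        have h1 : 1 < j * u t - 1 := by
          refine hj.trans_le ?_
          gcongr
          exact hmono.monotoneOn (Ioc_subset_Icc_self hd0) (Ioo_subset_Icc_self ht) htd.le
        have : smoothTransition =ᶠ[𝓝 (j * u t - 1)] fun _ => 1 := by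
          filter_upwards [lt_mem_nhds h1] with s hs
          exact Real.smoothTransition.one_of_one_le hs.le
        rw [this.deriv_eq, deriv_const]
      simp [hz]
  have hkm : AEStronglyMeasurable k (volume.restrict (Ioo 0 b)) :=
    (hkc.mono Ioo_subset_Ico_self).aestronglyMeasurable measurableSet_Ioo
  have hint : IntegrableOn (fun t => deriv smoothTransition (j * u t - 1) * (j * u' t) * k t)
      (Ioo 0 b) :=
    h1.mul_bdd hkm (c := M) ((ae_restrict_iff' measurableSet_Ioo).2
      (Eventually.of_forall fun t ht => hk t ht))
  have e : (∫ t in Ioo 0 b, deriv smoothTransition (j * u t - 1) * (j * u' t) * k t) - k 0 =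
      ∫ t in Ioo 0 b, deriv smoothTransition (j * u t - 1) * (j * u' t) * (k t - k 0) := by
    simp_rw [mul_sub]
    rw [integral_sub hint (h1.mul_const _), integral_mul_const, h2, one_mul]
  rw [dist_eq_norm, e]
  refine (norm_integral_le_of_norm_le (h1.mul_const (ε / 2))
    ((ae_restrict_iff' measurableSet_Ioo).2 (Eventually.of_forall hbound))).trans_lt ?_
  rw [integral_mul_const, h2]
  linarith

end Concentration

/-! ### Surface integrals over a graph box -/

section Box

variable {m : ℕ} {i : Fin (m + 1)} {ρ : H (m + 1) → ℝ} {O : Set (H (m + 1))} {σ b : ℝ}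
  {D : Set (H m)} {ζ : H m → ℝ}

lemma IsGraphBox.mono (h : IsGraphBox ρ O i σ b D ζ) {b' : ℝ} (hb : 0 < b') (hb' : b' ≤ b) :
    IsGraphBox ρ O i σ b' D ζ where
  sq_eq := h.sq_eq
  pos_b := hb
  isOpen_D := h.isOpen_D
  bounded := h.bounded
  preconnected := h.preconnected
  contDiffAt := h.contDiffAt
  mem y hy t ht := h.mem y hy t (ht.trans_le hb')
  eq_zero_iff y hy t ht := h.eq_zero_iff y hy t (ht.trans_le hb')
  pos_iff y hy t ht := h.pos_iff y hy t (ht.trans_le hb')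
  jacobian := h.jacobian

lemma IsGraphBox.continuousOn_boxMap (h : IsGraphBox ρ O i σ b D ζ) :
    ContinuousOn (fun v : H m × ℝ => boxMap i σ ζ v.1 v.2) (D ×ˢ univ) := by
  intro v hv
  have h1 : ContinuousAt (fun v : H m × ℝ => ζ v.1) v :=
    ContinuousAt.comp (f := Prod.fst) (g := ζ) (h.contDiffAt v.1 hv.1).continuousAt continuousAt_fst
  have h2 : ContinuousAt (fun v : H m × ℝ => (v.1, ζ v.1 + σ * v.2)) v :=
    continuousAt_fst.prodMk (h1.add (continuousAt_const.mul continuousAt_snd))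
  exact ((insertCoord i).continuous.continuousAt.comp h2).continuousWithinAt

lemma continuous_boxMap (y : H m) : Continuous (boxMap i σ ζ y) :=
  (insertCoord i).continuous.comp (by fun_prop)

/-- Surface integrals in a box. -/
lemma IsGraphBox.integral_eq (h : IsGraphBox ρ O i σ b D ζ) {S : Set (H (m + 1))}
    (hS : ∀ x ∈ boxSet i b D ζ, x ∈ S ↔ ρ x = 0) (hSm : MeasurableSet S) {Φ : H (m + 1) → ℝ}
    (hΦ : ContinuousOn Φ S) :
    ∫ x in S ∩ boxSet i b D ζ, Φ x ∂(μHE[m] : Measure (H (m + 1))) =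
      ∫ y in D, graphJacobian ζ y * Φ (boxMap i σ ζ y 0) := by
  classical
  set γ : H m → H (m + 1) := fun y => boxMap i σ ζ y 0 with hγ
  have hDm := h.isOpen_D.measurableSet
  have hγc : ContinuousOn γ D :=
    (h.continuousOn_boxMap).comp (f := fun y => (y, (0 : ℝ))) (by fun_prop)
      fun y hy => ⟨hy, mem_univ _⟩
  have hJ : AEMeasurable (fun y => ENNReal.ofReal (graphJacobian ζ y)) (volume.restrict D) :=
    (ContinuousOn.aemeasurable (fun y hy =>
      (continuousAt_graphJacobian (h.contDiffAt y hy)).continuousWithinAt) hDm).ennreal_ofReal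
  -- An extension of γ that is measurable on the whole space; its values off D play no role.
  set γ' : H m → H (m + 1) := D.piecewise γ fun _ => 0 with hγ'
  have hγ'm : Measurable γ' := by
    refine measurable_of_restrict_of_restrict_compl hDm ?_ ?_
    · rw [hγ', domRestrict_piecewise]
      exact (continuousOn_iff_continuous_domRestrict.1 hγc).measurable
    · rw [hγ', domRestrict_piecewise_compl]
      exact measurable_const
  have hm : (μHE[m] : Measure (H (m + 1))).restrict (S ∩ boxSet i b D ζ) =
      Measure.map γ' ((volume.restrict D).withDensity
        fun y => ENNReal.ofReal (graphJacobian ζ y)) := by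
    ext A hA
    rw [Measure.map_apply hγ'm hA, withDensity_apply _ (hγ'm hA), Measure.restrict_apply hA,
      h.map_boxMap hS hA, Measure.restrict_restrict (hγ'm hA)]
    congr 2
    ext y
    constructor
    · rintro ⟨hy, hyA⟩
      exact ⟨by simpa [hγ', hy] using hyA, hy⟩
    · rintro ⟨hyA, hy⟩
      exact ⟨hy, by simpa [hγ', hy] using hyA⟩
  have hΦm : AEStronglyMeasurable Φ ((μHE[m] : Measure (H (m + 1))).restrict
      (S ∩ boxSet i b D ζ)) :=
    (hΦ.mono inter_subset_left).aestronglyMeasurable (hSm.inter h.isOpen_boxSet.measurableSet)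
  rw [hm] at hΦm ⊢
  rw [integral_map hγ'm.aemeasurable hΦm,
    integral_withDensity_eq_integral_toReal_smul₀ hJ (Eventually.of_forall fun y => ENNReal.ofReal_lt_top)]
  refine setIntegral_congr_fun hDm fun y hy => ?_
  simp [hγ', hy, hγ, ENNReal.toReal_ofReal (graphJacobian_pos ζ y).le]

lemma IsGraphBox.measure_lt_top (h : IsGraphBox ρ O i σ b D ζ) {S : Set (H (m + 1))}
    (hS : ∀ x ∈ boxSet i b D ζ, x ∈ S ↔ ρ x = 0) {C : ℝ}
    (hC : ∀ y ∈ D, graphJacobian ζ y ≤ C) :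
    (μHE[m] : Measure (H (m + 1))) (S ∩ boxSet i b D ζ) < ⊤ := by
  have := h.map_boxMap hS MeasurableSet.univ
  rw [univ_inter, preimage_univ, inter_univ] at this
  rw [this]
  refine (setLIntegral_mono' h.isOpen_D.measurableSet fun y hy =>
    ENNReal.ofReal_le_ofReal (hC y hy)).trans_lt ?_
  rw [setLIntegral_const]
  exact ENNReal.mul_lt_top ENNReal.ofReal_lt_top h.bounded.measure_lt_top

end Box

/-! ### Boundary charts -/

/-- A cutoff function vanishing near `{F = 0}`. -/
def cutoff {n : ℕ} (F : H n → ℝ) (j : ℕ) (x : H n) : ℝ := smoothTransition (j * F x - 1)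

/-- Near a boundary point of `W`, the open set `W` is `{ρ > 0}`, and the field `Z` may be singular
at the boundary, but its component along the covector field `β`, which is conormal to the boundary,
is a continuous function `h`, while the function `φ`, whose differential is proportional to `β` on
`W`, vanishes at the boundary. The resulting boundary density of `Z` is `K`, and `F = φ²`. -/
structure IsBoundaryChart {n : ℕ} (W : Set (H n)) (Z : H n → H n) (F K : H n → ℝ)
    (O : Set (H n)) (ρ φ h : H n → ℝ) (β : H n → Fin n → ℝ) : Prop where
  isOpen : IsOpen O
  contDiffAt : ∀ x ∈ O, ContDiffAt ℝ 1 ρ x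
  fderiv_ne : ∀ x ∈ O, x ∈ frontier W → fderiv ℝ ρ x ≠ 0
  mem_iff : ∀ x ∈ O, x ∈ W ↔ 0 < ρ x
  frontier_iff : ∀ x ∈ O, x ∈ frontier W ↔ ρ x = 0
  continuousOn_φ : ContinuousOn φ (closure W ∩ O)
  continuousOn_h : ContinuousOn h (closure W ∩ O)
  continuousOn_β : ∀ i, ContinuousOn (fun x => β x i) (closure W ∩ O)
  φ_eq_zero : ∀ x ∈ O, x ∈ frontier W → φ x = 0
  F_eq : ∀ x ∈ O, x ∈ closure W → F x = φ x ^ 2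
  contDiffAt_φ : ∀ x ∈ O, x ∈ W → ContDiffAt ℝ 1 φ x
  interior : ∀ x ∈ O, x ∈ W → ∃ μ : ℝ, μ ≠ 0 ∧ (∀ i, pd i φ x = μ * β x i) ∧
    ∑ i, pd i φ x * Z x i = μ * h x
  boundary : ∀ x ∈ O, x ∈ frontier W → ∃ c : ℝ, c ≠ 0 ∧ (∀ i, β x i = c * pd i ρ x) ∧
    h x = c * √(∑ i, pd i ρ x ^ 2) * K x

/-! ### Cutoff functions along coordinate lines near the boundary -/

section Chart

variable {m : ℕ} {W : Set (H (m + 1))} {Z : H (m + 1) → H (m + 1)} {F K : H (m + 1) → ℝ}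
    {O : Set (H (m + 1))} {ρ φ h : H (m + 1) → ℝ} {β : H (m + 1) → Fin (m + 1) → ℝ}
    {i : Fin (m + 1)} {σ b : ℝ} {D : Set (H m)} {ζ : H m → ℝ} {κ : H (m + 1) → ℝ}

lemma integral_insertCoord_eq_boxMap (hσ : σ ^ 2 = 1) (f : H (m + 1) → ℝ) (y : H m) :
    ∫ z, f (insertCoord i (y, z)) = ∫ t, f (boxMap i σ ζ y t) := by
  have hσ' : σ = 1 ∨ σ = -1 := by rwa [sq, mul_self_eq_one_iff] at hσ
  rcases hσ' with rfl | rfl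
  · simp only [boxMap, one_mul]
    exact (integral_add_left_eq_self (fun z => f (insertCoord i (y, z))) (ζ y)).symm
  · simp only [boxMap, neg_mul, one_mul, ← sub_eq_add_neg]
    exact (integral_sub_left_eq_self (fun z => f (insertCoord i (y, z))) volume (ζ y)).symm

lemma pd_cutoff {x : H (m + 1)} (hF : DifferentiableAt ℝ F x) (j : ℕ) (l : Fin (m + 1)) :
    pd l (cutoff F j) x = deriv smoothTransition (j * F x - 1) * (j * pd l F x) := by
  have h : DifferentiableAt ℝ smoothTransition (j * F x - 1) :=
    (Real.smoothTransition.contDiffAt (n := 1)).differentiableAt (by simp)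
  have h1 : HasFDerivAt (fun x => (j : ℝ) * F x - 1) ((j : ℝ) • fderiv ℝ F x) x :=
    (hF.hasFDerivAt.const_mul (j : ℝ)).sub_const 1
  have h2 := h.hasDerivAt.comp_hasFDerivAt x h1
  rw [pd]
  have : cutoff F j = smoothTransition ∘ fun x => (j : ℝ) * F x - 1 := rfl
  rw [this, h2.fderiv]
  simp [pd]

namespace IsBoundaryChart

variable (hch : IsBoundaryChart W Z F K O ρ φ h β)
include hch

lemma eventuallyEq_sq (hW : IsOpen W) {x : H (m + 1)} (hx : x ∈ O) (hxW : x ∈ W) :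
    F =ᶠ[𝓝 x] fun y => φ y ^ 2 := by
  filter_upwards [hch.isOpen.mem_nhds hx, hW.mem_nhds hxW] with y hy hyW
  exact hch.F_eq y hy (subset_closure hyW)

lemma contDiffAt_F (hW : IsOpen W) {x : H (m + 1)} (hx : x ∈ O) (hxW : x ∈ W) :
    ContDiffAt ℝ 1 F x :=
  ((hch.contDiffAt_φ x hx hxW).pow 2).congr_of_eventuallyEq (hch.eventuallyEq_sq hW hx hxW)

/-- The unknown factor μ, which may blow up, cancels between dφ = μ β and dφ(Z) = μ h. What remains
is the derivative of the cutoff along the i-th coordinate line times h / β_i, which is continuous up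
to the boundary. -/
lemma sum_pd_cutoff (hW : IsOpen W) {x : H (m + 1)} (hx : x ∈ O) (hxW : x ∈ W)
    (hβ : β x i ≠ 0) (j : ℕ) :
    ∑ l, pd l (cutoff F j) x * Z x l =
      deriv smoothTransition (j * φ x ^ 2 - 1) * (j * (2 * φ x * pd i φ x)) * (h x / β x i) := by
  obtain ⟨μ, hμ, hμβ, hμh⟩ := hch.interior x hx hxW
  have hd := (hch.contDiffAt_φ x hx hxW).differentiableAt (by simp)
  have e : ∀ l, pd l F x = 2 * φ x * pd l φ x := fun l => by
    rw [pd_congr l (hch.eventuallyEq_sq hW hx hxW)]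
    simp_rw [sq]
    rw [pd_mul l hd hd]; ring
  simp_rw [pd_cutoff ((hch.contDiffAt_F hW hx hxW).differentiableAt (by simp)), e,
    hch.F_eq x hx (subset_closure hxW)]
  have : ∀ l, deriv smoothTransition (j * φ x ^ 2 - 1) * (j * (2 * φ x * pd l φ x)) * Z x l =
      deriv smoothTransition (j * φ x ^ 2 - 1) * (j * (2 * φ x)) * (pd l φ x * Z x l) := fun l => by
    ring
  simp_rw [this]
  rw [← Finset.mul_sum, hμh, hμβ]
  field_simp

lemma cutoff_eventually_eq_zero (hW : IsOpen W) {x : H (m + 1)} (hx : x ∈ O) (hxW : x ∈ W) {j : ℕ}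
    (hj : j * F x < 1) : cutoff F j =ᶠ[𝓝 x] fun _ => 0 := by
  have : ∀ᶠ y in 𝓝 x, (j : ℝ) * F y < 1 :=
    (show ContinuousAt (fun y => (j : ℝ) * F y) x from
      continuousAt_const.mul (hch.contDiffAt_F hW hx hxW).continuousAt).eventually_lt_const hj
  filter_upwards [this] with y hy
  exact Real.smoothTransition.zero_of_nonpos (by linarith)

/-- Z may be unbounded near the boundary, but the cutoff vanishes identically near every point with
j F < 1. The rest of the support of κ in the closure of W is compact and contained in W, and there
the integrand is continuous. -/
lemma integrableOn_cutoff (hW : IsOpen W) (hZ : ∀ x ∈ W, ContinuousAt Z x) (hκ : Continuous κ)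
    (hκc : HasCompactSupport κ) (hκO : tsupport κ ⊆ O) (j : ℕ) :
    IntegrableOn (fun x => κ x * ∑ l, pd l (cutoff F j) x * Z x l) W := by
  set f := fun x => κ x * ∑ l, pd l (cutoff F j) x * Z x l with hf
  set T := tsupport κ ∩ closure W with hT
  have hTc : IsCompact T := hκc.isCompact.inter_right isClosed_closure
  have hFT : ContinuousOn F T := by
    refine ((hch.continuousOn_φ.mono fun x hx => ⟨hx.2, hκO hx.1⟩).pow 2).congr fun x hx => ?_
    exact hch.F_eq x (hκO hx.1) hx.2
  set C := T ∩ (fun x => (j : ℝ) * F x) ⁻¹' Ici 1 with hC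
  have hCc : IsCompact C := by
    refine hTc.of_isClosed_subset ?_ inter_subset_left
    exact (continuousOn_const.mul hFT).preimage_isClosed_of_isClosed hTc.isClosed isClosed_Ici
  have hCW : C ⊆ W := by
    intro x hx
    by_contra hxW
    have hfr : x ∈ frontier W := by
      rw [hW.frontier_eq]; exact ⟨hx.1.2, hxW⟩
    have h1 : (1 : ℝ) ≤ j * F x := hx.2
    rw [hch.F_eq x (hκO hx.1.1) hx.1.2, hch.φ_eq_zero x (hκO hx.1.1) hfr] at h1
    norm_num at h1
  have hfc : ContinuousOn f C := by
    intro x hx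
    have hxO := hκO hx.1.1
    have hxW := hCW hx
    have h1 : ∀ l, ContinuousAt (pd l (cutoff F j)) x := by
      intro l
      have hc : ContDiffAt ℝ 1 (cutoff F j) x :=
        (Real.smoothTransition.contDiffAt (n := 1)).comp x
          (((contDiffAt_const.mul (hch.contDiffAt_F hW hxO hxW))).sub contDiffAt_const)
      exact ((hc.fderiv_right (m := 0) (by simp)).continuousAt).clm_apply continuousAt_const
    refine (hκ.continuousAt.mul (tendsto_finsetSum _ fun l _ => (h1 l).mul ?_)).continuousWithinAt
    exact ContinuousAt.comp (f := Z) (g := fun v : H (m + 1) => v l)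
      (coord_differentiableAt l).continuousAt (hZ x hxW)
  refine (hfc.integrableOn_compact hCc).of_forall_sdiff_eq_zero hW.measurableSet fun x hx => ?_
  by_cases hxκ : x ∈ tsupport κ
  · have hj : (j : ℝ) * F x < 1 := by
      by_contra hj
      exact hx.2 ⟨⟨hxκ, subset_closure hx.1⟩, not_lt.1 hj⟩
    have h0 := hch.cutoff_eventually_eq_zero hW (hκO hxκ) hx.1 hj
    have : ∀ l, pd l (cutoff F j) x = 0 := fun l => by rw [pd_congr l h0, pd_const]
    simp [hf, this]
  · simp [hf, image_eq_zero_of_notMem_tsupport hxκ]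

section Fibre

variable (hW : IsOpen W) (hbox : IsGraphBox ρ O i σ b D ζ)
  (hβ : ∀ x ∈ O, x ∈ closure W → β x i ≠ 0) {y : H m} (hy : y ∈ D)
include hbox hy

lemma boxMap_mem {t : ℝ} (ht : t ∈ Ioo 0 b) : boxMap i σ ζ y t ∈ W := by
  have ht' : |t| < b := by rw [abs_of_pos ht.1]; exact ht.2
  exact (hch.mem_iff _ (hbox.mem y hy t ht')).2 ((hbox.pos_iff y hy t ht').2 ht.1)

lemma boxMap_zero_mem : boxMap i σ ζ y 0 ∈ frontier W := by
  have ht' : |(0 : ℝ)| < b := by simpa using hbox.pos_b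
  exact (hch.frontier_iff _ (hbox.mem y hy 0 ht')).2 ((hbox.eq_zero_iff y hy 0 ht').2 rfl)

lemma boxMap_mem_closure {t : ℝ} (ht : t ∈ Ico 0 b) : boxMap i σ ζ y t ∈ closure W ∩ O := by
  refine ⟨?_, hbox.mem y hy t (by rw [abs_of_nonneg ht.1]; exact ht.2)⟩
  rcases ht.1.eq_or_lt with rfl | h0
  · exact frontier_subset_closure (hch.boxMap_zero_mem hbox hy)
  · exact subset_closure (hch.boxMap_mem hbox hy ⟨h0, ht.2⟩)

lemma continuousOn_comp_boxMap {q : H (m + 1) → ℝ} (hq : ContinuousOn q (closure W ∩ O)) :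
    ContinuousOn (fun t => q (boxMap i σ ζ y t)) (Ico 0 b) :=
  hq.comp (continuous_boxMap y).continuousOn fun _ ht => hch.boxMap_mem_closure hbox hy ht

lemma hasDerivAt_φ_boxMap {t : ℝ} (ht : t ∈ Ioo 0 b) :
    HasDerivAt (fun t => φ (boxMap i σ ζ y t)) (σ * pd i φ (boxMap i σ ζ y t)) t :=
  hasDerivAt_comp_boxMap ((hch.contDiffAt_φ _ (hch.boxMap_mem_closure hbox hy
    (Ioo_subset_Ico_self ht)).2 (hch.boxMap_mem hbox hy ht)).differentiableAt (by simp))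

lemma hasDerivAt_sq_boxMap {t : ℝ} (ht : t ∈ Ioo 0 b) :
    HasDerivAt (fun t => φ (boxMap i σ ζ y t) ^ 2)
      (2 * φ (boxMap i σ ζ y t) * (σ * pd i φ (boxMap i σ ζ y t))) t := by
  simpa using (hch.hasDerivAt_φ_boxMap hbox hy ht).fun_pow 2

include hβ

lemma deriv_φ_boxMap_ne {t : ℝ} (ht : t ∈ Ioo 0 b) : σ * pd i φ (boxMap i σ ζ y t) ≠ 0 := by
  have hcl := hch.boxMap_mem_closure hbox hy (Ioo_subset_Ico_self ht)
  obtain ⟨μ, hμ, hμβ, -⟩ := hch.interior _ hcl.2 (hch.boxMap_mem hbox hy ht)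
  rw [hμβ]
  have hσ : σ ≠ 0 := fun h0 => by have := hbox.sq_eq; simp [h0] at this
  exact mul_ne_zero hσ (mul_ne_zero hμ (hβ _ hcl.2 hcl.1))

/-- Rolle: φ vanishes at the boundary end of the segment and its derivative along the segment has no
zero. -/
lemma φ_boxMap_ne {t : ℝ} (ht : t ∈ Ioo 0 b) : φ (boxMap i σ ζ y t) ≠ 0 := by
  intro h0
  have hc : ContinuousOn (fun t => φ (boxMap i σ ζ y t)) (Icc 0 t) :=
    (hch.continuousOn_comp_boxMap hbox hy hch.continuousOn_φ).mono
      fun s hs => ⟨hs.1, hs.2.trans_lt ht.2⟩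
  have h00 : φ (boxMap i σ ζ y 0) = 0 := hch.φ_eq_zero _
    (hch.boxMap_mem_closure hbox hy (left_mem_Ico.2 hbox.pos_b)).2 (hch.boxMap_zero_mem hbox hy)
  obtain ⟨s, hs, hs0⟩ := exists_hasDerivAt_eq_zero ht.1 hc (by rw [h00, h0])
    (fun s hs => hch.hasDerivAt_φ_boxMap hbox hy ⟨hs.1, hs.2.trans ht.2⟩)
  exact hch.deriv_φ_boxMap_ne hbox hβ hy ⟨hs.1, hs.2.trans ht.2⟩ hs0

/-- The derivative of φ² is nowhere zero, so by Darboux it has one sign; a negative sign is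
impossible for a nonnegative function starting at 0. Squaring φ removes the need to know on which
side of its boundary value f lies. -/
lemma deriv_sq_boxMap_pos {t : ℝ} (ht : t ∈ Ioo 0 b) :
    0 < 2 * φ (boxMap i σ ζ y t) * (σ * pd i φ (boxMap i σ ζ y t)) := by
  rcases hasDerivWithinAt_forall_lt_or_forall_gt_of_forall_ne (convex_Ioo 0 b)
    (fun s hs => (hch.hasDerivAt_sq_boxMap hbox hy hs).hasDerivWithinAt) (m := 0)
    (fun s hs => mul_ne_zero (mul_ne_zero two_ne_zero (hch.φ_boxMap_ne hbox hβ hy hs))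
      (hch.deriv_φ_boxMap_ne hbox hβ hy hs)) with hneg | hpos
  · exfalso
    have hanti : StrictAntiOn (fun t => φ (boxMap i σ ζ y t) ^ 2) (Ico 0 b) := by
      refine strictAntiOn_of_deriv_neg (convex_Ico _ _)
        ((hch.continuousOn_comp_boxMap hbox hy hch.continuousOn_φ).pow 2) fun s hs => ?_
      rw [interior_Ico] at hs
      rw [(hch.hasDerivAt_sq_boxMap hbox hy hs).deriv]
      exact hneg s hs
    have h1 := hanti (left_mem_Ico.2 hbox.pos_b) (Ioo_subset_Ico_self ht) ht.1
    have h00 : φ (boxMap i σ ζ y 0) = 0 := hch.φ_eq_zero _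
      (hch.boxMap_mem_closure hbox hy (left_mem_Ico.2 hbox.pos_b)).2 (hch.boxMap_zero_mem hbox hy)
    simp only [h00] at h1
    nlinarith [sq_nonneg (φ (boxMap i σ ζ y t))]
  · exact hpos t ht

end Fibre

end IsBoundaryChart

end Chart

/-! ### Limits of the cutoff terms -/

section Chart

variable {m : ℕ} {W : Set (H (m + 1))} {Z : H (m + 1) → H (m + 1)} {F K : H (m + 1) → ℝ}
    {O : Set (H (m + 1))} {ρ φ h : H (m + 1) → ℝ} {β : H (m + 1) → Fin (m + 1) → ℝ}
    {i : Fin (m + 1)} {σ b : ℝ} {D : Set (H m)} {ζ : H m → ℝ} {κ : H (m + 1) → ℝ}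

namespace IsBoundaryChart

lemma mono (hch : IsBoundaryChart W Z F K O ρ φ h β) {O' : Set (H (m + 1))} (hO' : IsOpen O')
    (hO : O' ⊆ O) : IsBoundaryChart W Z F K O' ρ φ h β where
  isOpen := hO'
  contDiffAt x hx := hch.contDiffAt x (hO hx)
  fderiv_ne x hx := hch.fderiv_ne x (hO hx)
  mem_iff x hx := hch.mem_iff x (hO hx)
  frontier_iff x hx := hch.frontier_iff x (hO hx)
  continuousOn_φ := hch.continuousOn_φ.mono (inter_subset_inter_right _ hO)
  continuousOn_h := hch.continuousOn_h.mono (inter_subset_inter_right _ hO)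
  continuousOn_β i := (hch.continuousOn_β i).mono (inter_subset_inter_right _ hO)
  φ_eq_zero x hx := hch.φ_eq_zero x (hO hx)
  F_eq x hx := hch.F_eq x (hO hx)
  contDiffAt_φ x hx := hch.contDiffAt_φ x (hO hx)
  interior x hx := hch.interior x (hO hx)
  boundary x hx := hch.boundary x (hO hx)

/-- Concentration of the cutoff terms on the boundary, in one box. -/
lemma tendsto_integral_cutoff (hch : IsBoundaryChart W Z F K O ρ φ h β) (hW : IsOpen W)
    (hZ : ∀ x ∈ W, ContinuousAt Z x) {b₀ : ℝ} (hbox₀ : IsGraphBox ρ O i σ b₀ D ζ)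
    (hb : 0 < b) (hbb : b < b₀)
    (hβ : ∀ x ∈ O, x ∈ closure W → β x i ≠ 0) (hK : ContinuousOn K (frontier W))
    (hκ : Continuous κ) (hκc : HasCompactSupport κ) (hκO : tsupport κ ⊆ boxSet i b D ζ) :
    Tendsto (fun j : ℕ => ∫ x in W, κ x * ∑ l, pd l (cutoff F j) x * Z x l) atTop
      (𝓝 (∫ x in frontier W, κ x * K x ∂(μHE[m] : Measure (H (m + 1))))) := by
  have hbox := hbox₀.mono hb hbb.le
  set f : ℕ → H (m + 1) → ℝ := fun j x => κ x * ∑ l, pd l (cutoff F j) x * Z x l with hf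
  have hκO' : tsupport κ ⊆ O := hκO.trans hbox.boxSet_subset
  have hσ := hbox.sq_eq
  have hint : ∀ j, Integrable (W.indicator (f j)) := fun j =>
    (integrable_indicator_iff hW.measurableSet).2
      (hch.integrableOn_cutoff hW hZ hκ hκc hκO' j)
  -- the amplitude
  set Q : H (m + 1) → ℝ := fun x => κ x * (h x / β x i) with hQ
  have hQc : ContinuousOn Q (closure W ∩ O) :=
    hκ.continuousOn.mul (hch.continuousOn_h.div (hch.continuousOn_β i) fun x hx => hβ x hx.2 hx.1)
  obtain ⟨M, hM0, hM⟩ : ∃ M, 0 ≤ M ∧ ∀ x ∈ closure W, |Q x| ≤ M := by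
    obtain ⟨M, hM⟩ := (hκc.isCompact.inter_right isClosed_closure).exists_bound_of_continuousOn
      (show ContinuousOn Q (tsupport κ ∩ closure W) from
        hQc.mono fun x hx => ⟨hx.2, hκO' hx.1⟩)
    refine ⟨max M 0, le_max_right _ _, fun x hx => ?_⟩
    by_cases hxκ : x ∈ tsupport κ
    · exact (hM x ⟨hxκ, hx⟩).trans (le_max_left _ _)
    · simp [hQ, image_eq_zero_of_notMem_tsupport hxκ]
  have hmemb : ∀ y ∈ D, ∀ t ∈ Ioo 0 b, boxMap i σ ζ y t ∈ W ∩ O := fun y hy t ht =>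
    ⟨hch.boxMap_mem hbox hy ht, (hch.boxMap_mem_closure hbox hy (Ioo_subset_Ico_self ht)).2⟩
  -- Fubini along the i-th coordinate lines; on each of them the one-dimensional concentration lemma
  -- applies.
  set A : ℕ → H m → ℝ := fun j y => ∫ z, W.indicator (f j) (insertCoord i (y, z)) with hA
  have hprod : ∀ j, ∫ x in W, f j x = ∫ y, A j y := by
    intro j
    rw [← integral_indicator hW.measurableSet, ← (measurePreserving_insertCoord i).integral_comp
      (insertCoord i).toHomeomorph.measurableEmbedding, Measure.volume_eq_prod, integral_prod]
    rw [← Measure.volume_eq_prod]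
    exact ((measurePreserving_insertCoord i).integrable_comp_emb
      (insertCoord i).toHomeomorph.measurableEmbedding).2 (hint j)
  have hAm : ∀ j, AEStronglyMeasurable (A j) volume := by
    intro j
    have h1 : Integrable (fun p : H m × ℝ => W.indicator (f j) (insertCoord i p))
        (volume.prod volume) := by
      rw [← Measure.volume_eq_prod]
      exact ((measurePreserving_insertCoord i).integrable_comp_emb
        (insertCoord i).toHomeomorph.measurableEmbedding).2 (hint j)
    exact h1.integral_prod_left.aestronglyMeasurable
  have hAD : ∀ j, ∀ y ∉ D, A j y = 0 := by
    intro j y hy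
    rw [hA]
    refine integral_eq_zero_of_ae (Eventually.of_forall fun z => ?_)
    have hk : κ (insertCoord i (y, z)) = 0 := by
      refine image_eq_zero_of_notMem_tsupport fun hmem => hy ?_
      simpa using (hκO hmem).1
    by_cases hw : insertCoord i (y, z) ∈ W <;> simp [hw, hf, hk]
  have hAeq : ∀ j, ∀ y ∈ D, A j y = ∫ t in Ioo 0 b,
      deriv smoothTransition (j * φ (boxMap i σ ζ y t) ^ 2 - 1) *
        (j * (2 * φ (boxMap i σ ζ y t) * (σ * pd i φ (boxMap i σ ζ y t)))) *
        (σ * Q (boxMap i σ ζ y t)) := by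
    intro j y hy
    rw [hA]
    simp only
    rw [integral_insertCoord_eq_boxMap hσ, ← integral_indicator measurableSet_Ioo]
    congr 1
    ext t
    by_cases ht : t ∈ Ioo 0 b
    · obtain ⟨hw, ho⟩ := hmemb y hy t ht
      rw [indicator_of_mem hw, indicator_of_mem ht, hf]
      simp only
      rw [hch.sum_pd_cutoff hW ho hw (hβ _ ho (subset_closure hw))]
      simp only [hQ]
      linear_combination (-(κ (boxMap i σ ζ y t) *
        (deriv smoothTransition (j * φ (boxMap i σ ζ y t) ^ 2 - 1) *
        (j * (2 * φ (boxMap i σ ζ y t) * pd i φ (boxMap i σ ζ y t))) *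
        (h (boxMap i σ ζ y t) / β (boxMap i σ ζ y t) i)))) * hσ
    · rw [indicator_of_notMem ht]
      by_cases hk : boxMap i σ ζ y t ∈ tsupport κ
      · have htb : |t| < b := ((mem_boxSet_boxMap hσ).1 (hκO hk)).2
        have hw : boxMap i σ ζ y t ∉ W := by
          rw [hch.mem_iff _ (hκO' hk), hbox.pos_iff y hy t htb]
          exact fun h0 => ht ⟨h0, (abs_lt.1 htb).2⟩
        rw [indicator_of_notMem hw]
      · rw [indicator_apply_eq_zero]
        intro _
        simp [hf, image_eq_zero_of_notMem_tsupport hk]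
  have hσ1 : |σ| = 1 := by
    rw [← sq_abs] at hσ
    nlinarith [abs_nonneg σ]
  -- Continuity at the closed end t = b is the reason for taking b smaller than the height b₀ of the
  -- box.
  have hu : ∀ y ∈ D, ContinuousOn (fun t => φ (boxMap i σ ζ y t) ^ 2) (Icc 0 b) := fun y hy =>
    ((hch.continuousOn_comp_boxMap hbox₀ hy hch.continuousOn_φ).mono
      fun s hs => ⟨hs.1, hs.2.trans_lt hbb⟩).pow 2
  have hu0 : ∀ y ∈ D, φ (boxMap i σ ζ y 0) ^ 2 = 0 := fun y hy => by
    rw [hch.φ_eq_zero _ (hch.boxMap_mem_closure hbox hy (left_mem_Ico.2 hb)).2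
      (hch.boxMap_zero_mem hbox hy)]
    norm_num
  have hkM : ∀ y ∈ D, ∀ t ∈ Ioo 0 b, |σ * Q (boxMap i σ ζ y t)| ≤ M := fun y hy t ht => by
    rw [abs_mul, hσ1, one_mul]
    exact hM _ (subset_closure (hmemb y hy t ht).1)
  have hlim : Tendsto (fun j => ∫ y, A j y) atTop
      (𝓝 (∫ y, D.indicator (fun y => σ * Q (boxMap i σ ζ y 0)) y)) := by
    -- Each line integral is at most M, the weights having total mass at most 1, and D is bounded.
    refine tendsto_integral_of_dominated_convergence (D.indicator fun _ => M) hAm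
      ((integrable_indicator_iff hbox.isOpen_D.measurableSet).2
        (integrableOn_const hbox.bounded.measure_lt_top.ne)) ?_ ?_
    · intro j
      refine Eventually.of_forall fun y => ?_
      by_cases hy : y ∈ D
      · rw [indicator_of_mem hy, hAeq j y hy]
        exact norm_integral_cutoff_deriv_mul_le (u := fun t => φ (boxMap i σ ζ y t) ^ 2)
          (u' := fun t => 2 * φ (boxMap i σ ζ y t) * (σ * pd i φ (boxMap i σ ζ y t)))
          (hu y hy) hb.le (hu0 y hy)
          (fun t ht => hch.hasDerivAt_sq_boxMap hbox hy ht)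
          (fun t ht => hch.deriv_sq_boxMap_pos hbox hβ hy ht) (hkM y hy) hM0 j
      · rw [indicator_of_notMem hy, hAD j y hy, norm_zero]
    · refine Eventually.of_forall fun y => ?_
      by_cases hy : y ∈ D
      · rw [indicator_of_mem hy]
        simp_rw [hAeq _ y hy]
        exact tendsto_integral_cutoff_deriv_mul (u := fun t => φ (boxMap i σ ζ y t) ^ 2)
          (u' := fun t => 2 * φ (boxMap i σ ζ y t) * (σ * pd i φ (boxMap i σ ζ y t)))
          (k := fun t => σ * Q (boxMap i σ ζ y t))
          (hu y hy) hb (hu0 y hy)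
          (fun t ht => hch.hasDerivAt_sq_boxMap hbox hy ht)
          (fun t ht => hch.deriv_sq_boxMap_pos hbox hβ hy ht) (hkM y hy)
          (continuousOn_const.mul (hch.continuousOn_comp_boxMap hbox hy hQc))
      · rw [indicator_of_notMem hy]
        simp_rw [hAD _ y hy]
        exact tendsto_const_nhds
  have hS : ∀ x ∈ boxSet i b D ζ, x ∈ frontier W ↔ ρ x = 0 := fun x hx =>
    hch.frontier_iff x (hbox.boxSet_subset hx)
  have hfin : ∫ y, D.indicator (fun y => σ * Q (boxMap i σ ζ y 0)) y =
      ∫ x in frontier W, κ x * K x ∂(μHE[m] : Measure (H (m + 1))) := by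
    rw [integral_indicator hbox.isOpen_D.measurableSet]
    have h1 := hbox.integral_eq (Φ := fun x => κ x * K x) hS isClosed_frontier.measurableSet (hκ.continuousOn.mul hK)
    have h2 : ∫ x in frontier W ∩ boxSet i b D ζ, κ x * K x ∂(μHE[m] : Measure (H (m + 1))) =
        ∫ x in frontier W, κ x * K x ∂(μHE[m] : Measure (H (m + 1))) := by
      refine (setIntegral_eq_of_subset_of_forall_sdiff_eq_zero isClosed_frontier.measurableSet
        inter_subset_left fun x hx => ?_).symm
      rw [image_eq_zero_of_notMem_tsupport fun hk => hx.2 ⟨hx.1, hκO hk⟩, zero_mul]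
    rw [← h2]
    refine Eq.trans ?_ h1.symm
    -- The limit on a line is σ h / β_i = |dρ| K / (σ ∂_i ρ), after cancelling the common factor c
    -- of h and β. This is K times the Jacobian of the graph.
    refine setIntegral_congr_fun hbox.isOpen_D.measurableSet fun y hy => ?_
    have hcl := hch.boxMap_mem_closure hbox hy (left_mem_Ico.2 hb)
    obtain ⟨c, hc, hcβ, hch'⟩ := hch.boundary _ hcl.2 (hch.boxMap_zero_mem hbox hy)
    obtain ⟨hpos, hJ⟩ := hbox.jacobian y hy
    have hσ0 : σ ≠ 0 := fun h0 => by simp [h0] at hpos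
    have hp0 : pd i ρ (boxMap i σ ζ y 0) ≠ 0 := fun h0 => by simp [h0] at hpos
    simp only [hQ]
    rw [hJ, hch', hcβ]
    generalize √(∑ j, pd j ρ (boxMap i σ ζ y 0) ^ 2) = R
    field_simp
    linear_combination (κ (boxMap i σ ζ y 0) * R * K (boxMap i σ ζ y 0)) * hσ
  rw [← hfin]
  exact hlim.congr fun j => (hprod j).symm

/-- Every boundary point has a neighbourhood in which the cutoff terms concentrate on the
boundary. -/
lemma exists_nhds (hch : IsBoundaryChart W Z F K O ρ φ h β) (hW : IsOpen W)
    (hZ : ∀ x ∈ W, ContinuousAt Z x) (hK : ContinuousOn K (frontier W)) {p : H (m + 1)}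
    (hpO : p ∈ O) (hp : p ∈ frontier W) :
    ∃ O' : Set (H (m + 1)), IsOpen O' ∧ p ∈ O' ∧ Bornology.IsBounded O' ∧ O' ⊆ O ∧
      (∀ x ∈ O', x ∈ W → φ x ≠ 0) ∧ (μHE[m] : Measure (H (m + 1))) (frontier W ∩ O') < ⊤ ∧
      ∀ κ : H (m + 1) → ℝ, Continuous κ → tsupport κ ⊆ O' →
        Tendsto (fun j : ℕ => ∫ x in W, κ x * ∑ l, pd l (cutoff F j) x * Z x l) atTop
          (𝓝 (∫ x in frontier W, κ x * K x ∂(μHE[m] : Measure (H (m + 1))))) := by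
  obtain ⟨i, hi⟩ := Function.ne_iff.1 (pd_ne_zero_of_fderiv_ne_zero (hch.fderiv_ne p hpO hp))
  simp only [Pi.zero_apply] at hi
  have hρ := hch.contDiffAt p hpO
  have hρ0 := (hch.frontier_iff p hpO).1 hp
  have hpdc : ∀ l, ContinuousAt (pd l ρ) p := fun l =>
    ((hρ.fderiv_right (m := 0) (by simp)).continuousAt).clm_apply continuousAt_const
  have e1 : ∀ᶠ x in 𝓝 p, x ∈ closure W ∩ O → β x i ≠ 0 := by
    refine eventually_nhdsWithin_iff.1 ?_
    obtain ⟨c, hc, hcβ, -⟩ := hch.boundary p hpO hp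
    refine (hch.continuousOn_β i p ⟨frontier_subset_closure hp, hpO⟩).eventually_ne ?_
    simp only [hcβ]; exact mul_ne_zero hc hi
  -- A bound for the Jacobian |dρ| / |∂_i ρ| of the boundary graph near p, needed for finite area.
  set C := √(∑ j, pd j ρ p ^ 2) / |pd i ρ p| + 1 with hC
  have e2 : ∀ᶠ x in 𝓝 p, √(∑ j, pd j ρ x ^ 2) < C * |pd i ρ x| := by
    have c1 : ContinuousAt (fun x => √(∑ j, pd j ρ x ^ 2)) p :=
      ContinuousAt.sqrt (tendsto_finsetSum _ fun l _ => (hpdc l).pow 2)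
    have c2 : ContinuousAt (fun x => C * |pd i ρ x|) p := continuousAt_const.mul (hpdc i).abs
    refine c1.eventually_lt c2 ?_
    rw [hC, add_mul, div_mul_cancel₀ _ (abs_pos.2 hi).ne', one_mul]
    linarith [abs_pos.2 hi]
  obtain ⟨O₁, hO₁, hO₁o, hpO₁⟩ := eventually_nhds_iff.1 (e1.and e2)
  set O₂ := O ∩ O₁ ∩ Metric.ball p 1 with hO₂
  have hO₂o : IsOpen O₂ := (hch.isOpen.inter hO₁o).inter Metric.isOpen_ball
  have hO₂O : O₂ ⊆ O := fun x hx => hx.1.1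
  have hpO₂ : p ∈ O₂ := ⟨⟨hpO, hpO₁⟩, Metric.mem_ball_self one_pos⟩
  obtain ⟨σ, b, D, ζ, hbox, hpb⟩ := exists_isGraphBox (i := i) hρ hρ0 hi (hO₂o.mem_nhds hpO₂)
  have hch₂ := hch.mono hO₂o hO₂O
  have hb := hbox.pos_b
  have hbox₂ := hbox.mono (half_pos hb) (half_le_self hb.le)
  have hβ : ∀ x ∈ O₂, x ∈ closure W → β x i ≠ 0 := fun x hx hxW => (hO₁ x hx.1.2).1 ⟨hxW, hx.1.1⟩
  have hbounded : Bornology.IsBounded (boxSet i (b / 2) D ζ) :=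
    Metric.isBounded_ball.subset fun x hx => (hbox₂.boxSet_subset hx).2
  refine ⟨boxSet i (b / 2) D ζ, hbox₂.isOpen_boxSet, ?_, hbounded,
    hbox₂.boxSet_subset.trans hO₂O, ?_, ?_, ?_⟩
  · obtain ⟨y, hy, t, ht, rfl⟩ := exists_boxMap_eq hbox.sq_eq hpb
    rw [hbox.eq_zero_iff y hy t ht] at hρ0
    subst hρ0
    exact (mem_boxSet_boxMap hbox.sq_eq).2 ⟨hy, by simpa using hb⟩
  · intro x hx hxW
    have hxO := hbox₂.boxSet_subset hx
    obtain ⟨y, hy, t, ht, rfl⟩ := exists_boxMap_eq hbox.sq_eq hx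
    have ht0 : 0 < t := by
      rwa [hch₂.mem_iff _ hxO, hbox₂.pos_iff y hy t ht] at hxW
    exact hch₂.φ_boxMap_ne hbox₂ hβ hy ⟨ht0, (abs_lt.1 ht).2⟩
  · refine hbox₂.measure_lt_top (fun x hx => hch₂.frontier_iff x (hbox₂.boxSet_subset hx))
      (C := C) fun y hy => ?_
    obtain ⟨hpos, hJ⟩ := hbox₂.jacobian y hy
    have hxO : boxMap i σ ζ y 0 ∈ O₂ := hbox₂.mem y hy 0 (by simpa using hb)
    have h2 := (hO₁ _ hxO.1.2).2
    have hσ1 : |σ| = 1 := by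
      have := hbox.sq_eq
      rw [← sq_abs] at this
      nlinarith [abs_nonneg σ]
    rw [hJ, div_le_iff₀ hpos, ← abs_of_pos hpos, abs_mul, hσ1, one_mul]
    exact h2.le
  · intro κ hκ hκO
    exact hch₂.tendsto_integral_cutoff hW hZ hbox (half_pos hb) (half_lt_self hb) hβ hK hκ
      (HasCompactSupport.of_support_subset_isCompact hbounded.isCompact_closure
        ((subset_tsupport κ).trans (hκO.trans subset_closure))) hκO

end IsBoundaryChart

end Chart

/-! ### The divergence theorem with conormal boundary data -/

lemma exists_contDiff_partition {n : ℕ} {ι : Type*} [Fintype ι] {S : Set (H n)} (hS : IsClosed S)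
    (U : ι → Set (H n)) (hU : ∀ a, IsOpen (U a)) (hSU : S ⊆ ⋃ a, U a) :
    ∃ κ : ι → H n → ℝ, (∀ a, ContDiff ℝ 1 (κ a)) ∧ (∀ a, tsupport (κ a) ⊆ U a) ∧
      (∀ x ∈ S, ∑ a, κ a x = 1) ∧ (∀ a x, 0 ≤ κ a x) ∧ ∀ x, ∑ a, κ a x ≤ 1 := by
  obtain ⟨f, hf⟩ := SmoothPartitionOfUnity.exists_isSubordinate (modelWithCornersSelf ℝ (H n)) hS U
    hU hSU
  refine ⟨fun a => f a, fun a => (f a).contMDiff.contDiff.of_le (by simp), fun a => hf a,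
    fun x hx => ?_, fun a x => f.nonneg a x, fun x => ?_⟩
  · rw [← finsum_eq_sum_of_fintype]; exact f.sum_eq_one hx
  · rw [← finsum_eq_sum_of_fintype]; exact f.sum_le_one x

lemma integral_pd_eq_zero {n : ℕ} {Y : H n → ℝ} (hY : ContDiff ℝ 1 Y) (hc : HasCompactSupport Y)
    (i : Fin n) : Integrable (pd i Y) ∧ ∫ x, pd i Y x = 0 := by
  have hcont : Continuous (pd i Y) := ((hY.continuous_fderiv (by simp)).clm_apply continuous_const)
  have hint : Integrable (pd i Y) :=
    hcont.integrable_of_hasCompactSupport (hc.fderiv_apply ℝ _)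
  have hY' : Integrable Y := hY.continuous.integrable_of_hasCompactSupport hc
  refine ⟨hint, ?_⟩
  have := integral_mul_fderiv_eq_neg_fderiv_mul_of_integrable (μ := (volume : Measure (H n)))
    (f := fun _ => (1 : ℝ)) (g := Y) (v := EuclideanSpace.single i 1) (by simp)
    (hint.congr (Eventually.of_forall fun x => (one_mul _).symm)) (by simpa using hY') (fun x _ => differentiableAt_const _)
    (fun x _ => hY.differentiable (by simp) x)
  simpa [pd] using this

section GaussGreen

variable {m : ℕ} {W : Set (H (m + 1))} {Z : H (m + 1) → H (m + 1)} {F K : H (m + 1) → ℝ}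

/-- The boundary is covered by finitely many charts, and there is a partition of unity. -/
lemma exists_boundary_cover (hW : IsOpen W) (hWb : Bornology.IsBounded W)
    (hZ : ∀ x ∈ W, ContinuousAt Z x) (hK : ContinuousOn K (frontier W))
    (hch : ∀ p ∈ frontier W, ∃ O ρ φ h β, p ∈ O ∧ IsBoundaryChart W Z F K O ρ φ h β) :
    ∃ (N : ℕ) (U : Fin N → Set (H (m + 1))) (φ : Fin N → H (m + 1) → ℝ),
      (∀ a, IsOpen (U a)) ∧ frontier W ⊆ ⋃ a, U a ∧
      (∀ a, ∀ x ∈ U a, x ∈ W → 0 < F x ∧ ContDiffAt ℝ 1 F x) ∧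
      (∀ a, ContinuousOn F (closure W ∩ U a)) ∧ (∀ a, ∀ x ∈ U a, x ∈ frontier W → F x = 0) ∧
      (∀ a, (μHE[m] : Measure (H (m + 1))) (frontier W ∩ U a) < ⊤) ∧
      ∀ a, ∀ κ : H (m + 1) → ℝ, Continuous κ → tsupport κ ⊆ U a →
        (∀ j : ℕ, IntegrableOn (fun x => κ x * ∑ l, pd l (cutoff F j) x * Z x l) W) ∧
        Tendsto (fun j : ℕ => ∫ x in W, κ x * ∑ l, pd l (cutoff F j) x * Z x l) atTop
          (𝓝 (∫ x in frontier W, κ x * K x ∂(μHE[m] : Measure (H (m + 1))))) := by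
  have hcpt : IsCompact (frontier W) :=
    hWb.isCompact_closure.of_isClosed_subset isClosed_frontier frontier_subset_closure
  choose! O ρ φ h β hO hch using hch
  have hn := fun p (hp : p ∈ frontier W) => (hch p hp).exists_nhds hW hZ hK (hO p hp) hp
  choose! U hU hpU hUb hUO hφ hfin hlim using hn
  obtain ⟨t, ht⟩ := hcpt.elim_finite_subcover (fun p : frontier W => U p) (fun p => hU p p.2)
    fun p hp => mem_iUnion.2 ⟨⟨p, hp⟩, hpU p hp⟩
  let e := t.equivFin.symm
  refine ⟨t.card, fun a => U (e a).1, fun a => φ (e a).1, fun a => hU _ (e a).1.2, ?_, ?_, ?_, ?_,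
    fun a => hfin _ (e a).1.2, fun a κ hκ hκU => ⟨fun j => ?_, hlim _ (e a).1.2 κ hκ hκU⟩⟩
  · intro x hx
    obtain ⟨p, hpt, hxp⟩ := mem_iUnion₂.1 (ht hx)
    exact mem_iUnion.2 ⟨e.symm ⟨p, hpt⟩, by simpa using hxp⟩
  · intro a x hx hxW
    have hp := (e a).1.2
    refine ⟨?_, (hch _ hp).contDiffAt_F hW (hUO _ hp hx) hxW⟩
    rw [(hch _ hp).F_eq x (hUO _ hp hx) (subset_closure hxW)]
    have := hφ _ hp x hx hxW
    positivity
  · intro a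
    have hp := (e a).1.2
    exact (((hch _ hp).continuousOn_φ.mono (inter_subset_inter_right _ (hUO _ hp))).pow 2).congr
      fun x hx => (hch _ hp).F_eq x (hUO _ hp hx.2) hx.1
  · intro a x hx hxf
    have hp := (e a).1.2
    rw [(hch _ hp).F_eq x (hUO _ hp hx) (frontier_subset_closure hxf),
      (hch _ hp).φ_eq_zero x (hUO _ hp hx) hxf]
    norm_num
  · have hp := (e a).1.2
    exact (hch _ hp).integrableOn_cutoff hW hZ hκ
      (HasCompactSupport.of_support_subset_isCompact (hUb _ hp).isCompact_closure
        ((subset_tsupport κ).trans (hκU.trans subset_closure))) (hκU.trans (hUO _ hp)) j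

/-- The field Z is multiplied by functions χ_j that vanish near the boundary and tend to 1 in W; the
divergence of χ_j Z integrates to 0. The derivatives of the partition of unity contribute an
expression that tends to 0, those of the cutoff contribute the boundary integral. The sign is
negative because K is the component of Z along the inward Euclidean normal, W being {ρ > 0} locally.
-/
theorem integral_divergence_eq (hW : IsOpen W) (hWb : Bornology.IsBounded W)
    (hZ : ∀ x ∈ W, ContDiffAt ℝ 1 Z x) (hK : ContinuousOn K (frontier W))
    (hch : ∀ p ∈ frontier W, ∃ O ρ φ h β, p ∈ O ∧ IsBoundaryChart W Z F K O ρ φ h β)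
    (hdiv : IntegrableOn (fun x => ∑ i, pd i (fun y => Z y i) x) W) :
    IntegrableOn K (frontier W) (μHE[m] : Measure (H (m + 1))) ∧
    ∫ x in W, ∑ i, pd i (fun y => Z y i) x =
      - ∫ x in frontier W, K x ∂(μHE[m] : Measure (H (m + 1))) := by
  have hcpt : IsCompact (frontier W) :=
    hWb.isCompact_closure.of_isClosed_subset isClosed_frontier frontier_subset_closure
  obtain ⟨N, U, φ, hU, hcov, hFW, hFc, hF0, hfin, hlim⟩ :=
    exists_boundary_cover hW hWb (fun x hx => (hZ x hx).continuousAt) hK hch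
  have hfinite : (μHE[m] : Measure (H (m + 1))) (frontier W) < ⊤ := by
    have : frontier W ⊆ ⋃ a, frontier W ∩ U a := by
      rw [← inter_iUnion]; exact subset_inter subset_rfl hcov
    refine (measure_mono this).trans_lt ((measure_iUnion_le _).trans_lt ?_)
    rw [tsum_fintype]
    exact ENNReal.sum_lt_top.2 fun a _ => hfin a
  have hKint : IntegrableOn K (frontier W) (μHE[m] : Measure (H (m + 1))) := by
    obtain ⟨M, hM⟩ := hcpt.exists_bound_of_continuousOn hK
    have := isFiniteMeasure_restrict.2 hfinite.ne
    exact Integrable.of_bound (hK.aestronglyMeasurable isClosed_frontier.measurableSet) M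
      ((ae_restrict_iff' isClosed_frontier.measurableSet).2 (Eventually.of_forall hM))
  refine ⟨hKint, ?_⟩
  obtain ⟨δ, hδ, hδU⟩ := hcpt.exists_cthickening_subset_open (isOpen_iUnion hU) hcov
  obtain ⟨κ, hκ, hκU, hκ1, hκ0, hκle⟩ := exists_contDiff_partition Metric.isClosed_cthickening U hU hδU
  have hκS : ∀ x ∈ Metric.thickening δ (frontier W), (fun y => ∑ a, κ a y) =ᶠ[𝓝 x] fun _ => 1 := by
    intro x hx
    filter_upwards [Metric.isOpen_thickening.mem_nhds hx] with y hy
    exact hκ1 y (Metric.thickening_subset_cthickening _ _ hy)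
  have hκd : ∀ a x, DifferentiableAt ℝ (κ a) x := fun a x => (hκ a).differentiable (by simp) x
  have hZd : ∀ x ∈ W, ∀ i, ContDiffAt ℝ 1 (fun y => Z y i) x := fun x hx i =>
    (contDiffAt_piLp 2).1 (hZ x hx) i
  have hg1 : ∀ j x, cutoff F j x ≤ 1 := fun j x => Real.smoothTransition.le_one _
  have hg0 : ∀ j x, 0 ≤ cutoff F j x := fun j x => Real.smoothTransition.nonneg _
  have hcut : ∀ a, ∀ x ∈ U a, x ∈ W → ∀ j, ContDiffAt ℝ 1 (cutoff F j) x := fun a x hx hxW j =>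
    (Real.smoothTransition.contDiffAt (n := 1)).comp x
      ((contDiffAt_const.mul (hFW a x hx hxW).2).sub contDiffAt_const)
  -- the cutoff near the boundary
  set χ : ℕ → H (m + 1) → ℝ := fun j x => 1 - ∑ a, κ a x * (1 - cutoff F j x) with hχ
  have hterm : ∀ a j, ∀ x ∈ W, ContDiffAt ℝ 1 (fun y => κ a y * (1 - cutoff F j y)) x := by
    intro a j x hx
    by_cases hxa : x ∈ tsupport (κ a)
    · exact (hκ a).contDiffAt.mul (contDiffAt_const.sub (hcut a x (hκU a hxa) hx j))
    · refine (contDiffAt_const (c := (0 : ℝ))).congr_of_eventuallyEq ?_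
      filter_upwards [notMem_tsupport_iff_eventuallyEq.1 hxa] with y hy
      rw [hy]; simp
  have hpdterm : ∀ a j, ∀ x ∈ W, ∀ i, pd i (fun y => κ a y * (1 - cutoff F j y)) x =
      pd i (κ a) x * (1 - cutoff F j x) - κ a x * pd i (cutoff F j) x := by
    intro a j x hx i
    by_cases hxa : x ∈ tsupport (κ a)
    · have hd := (hcut a x (hκU a hxa) hx j).differentiableAt (by simp)
      rw [pd_mul i (hκd a x) ((differentiableAt_const _).fun_sub hd),
        pd_sub i (differentiableAt_const _) hd, pd_const]
      ring
    · have h0 := notMem_tsupport_iff_eventuallyEq.1 hxa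
      have h1 : (fun y => κ a y * (1 - cutoff F j y)) =ᶠ[𝓝 x] fun _ => 0 := by
        filter_upwards [h0] with y hy
        rw [hy]; simp
      have h2 : κ a =ᶠ[𝓝 x] fun _ => 0 := h0
      rw [pd_congr i h1, pd_congr i h2, h2.self_of_nhds, pd_const]
      ring
  have hχC : ∀ j, ∀ x ∈ W, ContDiffAt ℝ 1 (χ j) x := fun j x hx =>
    contDiffAt_const.sub (ContDiffAt.sum fun a _ => hterm a j x hx)
  have hχpd : ∀ j, ∀ x ∈ W, ∀ i, pd i (χ j) x =
      - (∑ a, pd i (κ a) x) * (1 - cutoff F j x) + ∑ a, κ a x * pd i (cutoff F j) x := by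
    intro j x hx i
    rw [hχ]
    simp only
    rw [pd_sub i (differentiableAt_const _) (DifferentiableAt.fun_sum fun a _ =>
      (hterm a j x hx).differentiableAt (by simp)), pd_const,
      pd_sum i fun a _ => (hterm a j x hx).differentiableAt (by simp)]
    simp_rw [fun a => hpdterm a j x hx i]
    rw [Finset.sum_sub_distrib, ← Finset.sum_mul]
    ring
  have hχ0 : ∀ j, ∀ x ∈ frontier W, ∀ᶠ y in 𝓝 x, y ∈ W → χ j y = 0 := by
    intro j x hx
    obtain ⟨a, ha⟩ := mem_iUnion.1 (hcov hx)
    have h1 : ∀ᶠ y in 𝓝 x, y ∈ closure W ∩ U a → (j : ℝ) * F y < 1 := by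
      refine eventually_nhdsWithin_iff.1 ?_
      have hc : ContinuousWithinAt (fun y => (j : ℝ) * F y) (closure W ∩ U a) x :=
        continuousWithinAt_const.mul (hFc a x ⟨frontier_subset_closure hx, ha⟩)
      exact hc.eventually_lt_const (by simp [hF0 a x ha hx])
    filter_upwards [h1, (hU a).mem_nhds ha,
      hκS x (Metric.self_subset_thickening hδ _ hx)] with y hy hya hyκ hyW
    have : cutoff F j y = 0 := Real.smoothTransition.zero_of_nonpos
      (by linarith [hy ⟨subset_closure hyW, hya⟩])
    rw [hχ]
    simp only [this, sub_zero, mul_one]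
    rw [hyκ, sub_self]
  set Y : ℕ → Fin (m + 1) → H (m + 1) → ℝ := fun j i => W.indicator fun x => χ j x * Z x i with hY
  have hYW : ∀ j i, ∀ x ∈ W, Y j i =ᶠ[𝓝 x] fun y => χ j y * Z y i := by
    intro j i x hx
    filter_upwards [hW.mem_nhds hx] with y hy
    exact indicator_of_mem hy _
  have hYn : ∀ j i, ∀ x ∉ W, Y j i =ᶠ[𝓝 x] fun _ => 0 := by
    intro j i x hx
    by_cases hxc : x ∈ closure W
    · filter_upwards [hχ0 j x (by rw [hW.frontier_eq]; exact ⟨hxc, hx⟩)] with y hy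
      by_cases hyW : y ∈ W
      · rw [hY]; simp only; rw [indicator_of_mem hyW, hy hyW, zero_mul]
      · exact indicator_of_notMem hyW _
    · filter_upwards [isClosed_closure.isOpen_compl.mem_nhds hxc] with y hy
      exact indicator_of_notMem (fun h => hy (subset_closure h)) _
  have hYC : ∀ j i, ContDiff ℝ 1 (Y j i) := by
    intro j i
    rw [contDiff_iff_contDiffAt]
    intro x
    by_cases hx : x ∈ W
    · exact ((hχC j x hx).mul (hZd x hx i)).congr_of_eventuallyEq (hYW j i x hx)
    · exact (contDiffAt_const (c := (0 : ℝ))).congr_of_eventuallyEq (hYn j i x hx)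
  have hYc : ∀ j i, HasCompactSupport (Y j i) := fun j i =>
    HasCompactSupport.of_support_subset_isCompact hWb.isCompact_closure
      (support_indicator_subset.trans subset_closure)
  -- the integrands
  set dκ : H (m + 1) → ℝ := fun x => ∑ i, (∑ a, pd i (κ a) x) * Z x i with hdκ
  set A : ℕ → H (m + 1) → ℝ := fun j x =>
    χ j x * (∑ i, pd i (fun y => Z y i) x) - (1 - cutoff F j x) * dκ x with hA
  have hsplit : ∀ j, ∀ x ∈ W, ∑ i, pd i (Y j i) x =
      A j x + ∑ a, κ a x * ∑ l, pd l (cutoff F j) x * Z x l := by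
    intro j x hx
    have e : ∀ i, pd i (Y j i) x = χ j x * pd i (fun y => Z y i) x -
        (1 - cutoff F j x) * ((∑ a, pd i (κ a) x) * Z x i) +
        (∑ a, κ a x) * (pd i (cutoff F j) x * Z x i) := by
      intro i
      rw [pd_congr i (hYW j i x hx), pd_mul i ((hχC j x hx).differentiableAt (by simp))
        ((hZd x hx i).differentiableAt (by simp)), hχpd j x hx i, ← Finset.sum_mul]
      ring
    simp_rw [e, Finset.sum_add_distrib, Finset.sum_sub_distrib, ← Finset.mul_sum]
    rw [← Finset.sum_mul]
  have hzero : ∀ j, IntegrableOn (fun x => ∑ i, pd i (Y j i) x) W ∧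
      ∫ x in W, ∑ i, pd i (Y j i) x = 0 := by
    intro j
    have h1 : Integrable fun x => ∑ i, pd i (Y j i) x :=
      integrable_finsetSum _ fun i _ => (integral_pd_eq_zero (hYC j i) (hYc j i) i).1
    refine ⟨h1.integrableOn, ?_⟩
    rw [setIntegral_eq_integral_of_forall_compl_eq_zero, integral_finsetSum]
    · exact Finset.sum_eq_zero fun i _ => (integral_pd_eq_zero (hYC j i) (hYc j i) i).2
    · exact fun i _ => (integral_pd_eq_zero (hYC j i) (hYc j i) i).1
    · intro x hx
      exact Finset.sum_eq_zero fun i _ => by rw [pd_congr i (hYn j i x hx), pd_const]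
  have hcint : ∀ j, IntegrableOn (fun x => ∑ a, κ a x * ∑ l, pd l (cutoff F j) x * Z x l) W :=
    fun j => integrable_finsetSum _ fun a _ => (hlim a (κ a) (hκ a).continuous (hκU a)).1 j
  have hAint : ∀ j, IntegrableOn (A j) W := by
    intro j
    refine ((hzero j).1.sub (hcint j)).congr ?_
    refine (ae_restrict_iff' hW.measurableSet).2 (Eventually.of_forall fun x hx => ?_)
    simp only [Pi.sub_apply]
    rw [hsplit j x hx, add_sub_cancel_right]
  have hbal : ∀ j, ∫ x in W, A j x =
      - ∑ a, ∫ x in W, κ a x * ∑ l, pd l (cutoff F j) x * Z x l := by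
    intro j
    have h1 := (hzero j).2
    rw [setIntegral_congr_fun hW.measurableSet fun x hx => hsplit j x hx,
      integral_add (hAint j) (hcint j), integral_finsetSum _ fun a _ =>
        (hlim a (κ a) (hκ a).continuous (hκU a)).1 j] at h1
    linarith
  -- Near the boundary, where Z may be unbounded, the sum of the κ's is constant and its
  -- differential vanishes; the rest of W is contained in a compact subset of W.
  have hdκint : IntegrableOn dκ W := by
    set C := closure W \ Metric.thickening δ (frontier W) with hC
    have hCc : IsCompact C := hWb.isCompact_closure.diff Metric.isOpen_thickening
    have hCW : C ⊆ W := by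
      intro x hx
      by_contra hxW
      exact hx.2 (Metric.self_subset_thickening hδ _ (by rw [hW.frontier_eq]; exact ⟨hx.1, hxW⟩))
    have hc : ContinuousOn dκ C := by
      refine continuousOn_finsetSum _ fun i _ => ContinuousOn.mul ?_ ?_
      · exact continuousOn_finsetSum _ fun a _ =>
          (((hκ a).continuous_fderiv (by simp)).clm_apply continuous_const).continuousOn
      · exact fun x hx => (hZd x (hCW hx) i).continuousAt.continuousWithinAt
    refine (hc.integrableOn_compact hCc).of_forall_sdiff_eq_zero hW.measurableSet fun x hx => ?_
    have hxt : x ∈ Metric.thickening δ (frontier W) := by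
      by_contra hxt
      exact hx.2 ⟨subset_closure hx.1, hxt⟩
    refine Finset.sum_eq_zero fun i _ => ?_
    rw [← pd_sum i fun a _ => hκd a x, pd_congr i (hκS x hxt), pd_const, zero_mul]
  have hlimA : Tendsto (fun j => ∫ x in W, A j x) atTop
      (𝓝 (∫ x in W, ∑ i, pd i (fun y => Z y i) x)) := by
    refine tendsto_integral_of_dominated_convergence
      (fun x => |∑ i, pd i (fun y => Z y i) x| + |dκ x|)
      (fun j => (hAint j).aestronglyMeasurable) (hdiv.abs.add hdκint.abs) ?_ ?_
    · intro j
      refine Eventually.of_forall fun x => ?_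
      have hs0 : 0 ≤ ∑ a, κ a x := Finset.sum_nonneg fun a _ => hκ0 a x
      have hs1 := hκle x
      have hχe : χ j x = 1 - (∑ a, κ a x) * (1 - cutoff F j x) := by
        rw [hχ, Finset.sum_mul]
      have hχb : |χ j x| ≤ 1 := by
        rw [hχe, abs_le]
        constructor <;> nlinarith [hg0 j x, hg1 j x]
      have hgb : |1 - cutoff F j x| ≤ 1 := by
        rw [abs_le]; constructor <;> linarith [hg0 j x, hg1 j x]
      refine (norm_sub_le _ _).trans (add_le_add ?_ ?_)
      · rw [norm_mul]
        exact mul_le_of_le_one_left (abs_nonneg _) hχb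
      · rw [norm_mul]
        exact mul_le_of_le_one_left (abs_nonneg _) hgb
    · refine (ae_restrict_iff' hW.measurableSet).2 (Eventually.of_forall fun x hx => ?_)
      by_cases hxU : ∃ a, x ∈ U a
      · obtain ⟨a, ha⟩ := hxU
        have hFpos := (hFW a x ha hx).1
        -- At a fixed point of W inside a chart, F > 0 and the cutoff is eventually 1. The factor 1
        -- - cutoff in front of dκ then vanishes and χ becomes 1.
        have h1 : ∀ᶠ j : ℕ in atTop, cutoff F j x = 1 := by
          have := (tendsto_natCast_atTop_atTop (R := ℝ)).atTop_mul_const hFpos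
          filter_upwards [this.eventually_ge_atTop 2] with j hj
          exact Real.smoothTransition.one_of_one_le (by linarith)
        refine tendsto_const_nhds.congr' ?_
        filter_upwards [h1] with j hj
        simp [hA, hχ, hj]
      · have hk : ∀ a, κ a =ᶠ[𝓝 x] fun _ => 0 := fun a =>
          notMem_tsupport_iff_eventuallyEq.1 fun h => hxU ⟨a, hκU a h⟩
        have hk0 : ∀ a, κ a x = 0 := fun a => (hk a).self_of_nhds
        have hd0 : dκ x = 0 := Finset.sum_eq_zero fun i _ => by
          rw [Finset.sum_eq_zero fun a _ => by rw [pd_congr i (hk a), pd_const], zero_mul]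
        simp [hA, hχ, hk0, hd0]
  have hlimC : Tendsto (fun j => ∫ x in W, A j x) atTop
      (𝓝 (- ∫ x in frontier W, K x ∂(μHE[m] : Measure (H (m + 1))))) := by
    simp_rw [hbal]
    refine Tendsto.neg ?_
    have e : ∫ x in frontier W, K x ∂(μHE[m] : Measure (H (m + 1))) =
        ∑ a, ∫ x in frontier W, κ a x * K x ∂(μHE[m] : Measure (H (m + 1))) := by
      rw [← integral_finsetSum]
      · refine setIntegral_congr_fun isClosed_frontier.measurableSet fun x hx => ?_
        rw [← Finset.sum_mul, hκ1 x (Metric.self_subset_cthickening _ hx), one_mul]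
      · intro a _
        refine hKint.bdd_mul (c := 1) (hκ a).continuous.aestronglyMeasurable
          (Eventually.of_forall fun x => ?_)
        rw [Real.norm_of_nonneg (hκ0 a x)]
        exact (Finset.single_le_sum (fun b _ => hκ0 b x) (Finset.mem_univ a)).trans (hκle x)
    rw [e]
    exact tendsto_finsetSum _ fun a _ => (hlim a (κ a) (hκ a).continuous (hκU a)).2
  exact tendsto_nhds_unique hlimA hlimC

end GaussGreen

/-! ### Domains with a defining function -/

/-- A function which is constant on a regular level set has proportional differential. -/
lemma exists_pd_eq_mul {n : ℕ} {ρ u : H n → ℝ} {q : H n} (hρ : ContDiffAt ℝ 1 ρ q)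
    (hu : ContDiffAt ℝ 1 u q) (hρ' : fderiv ℝ ρ q ≠ 0)
    (h : ∀ᶠ y in 𝓝 q, ρ y = ρ q → u y = u q) : ∃ v : ℝ, ∀ i, pd i u q = v * pd i ρ q := by
  -- A constant function on the level set has a (trivial) constrained extremum there, so Lagrange
  -- multipliers apply.
  have hext : IsLocalExtrOn u {y | ρ y = ρ q} q := by
    refine Or.inl ?_
    have : ∀ᶠ y in 𝓝[{y | ρ y = ρ q}] q, u q ≤ u y :=
      eventually_nhdsWithin_iff.2 (h.mono fun y hy hy' => (hy hy').ge)
    exact this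
  obtain ⟨a, b, hab, hsum⟩ := hext.exists_multipliers_of_hasStrictFDerivAt_1d
    (hρ.hasStrictFDerivAt (by simp)) (hu.hasStrictFDerivAt (by simp))
  have hb : b ≠ 0 := by
    rintro rfl
    rw [zero_smul, add_zero, smul_eq_zero] at hsum
    rcases hsum with rfl | h0
    · exact hab rfl
    · exact hρ' h0
  refine ⟨-a / b, fun i => ?_⟩
  have h1 := DFunLike.congr_fun hsum (EuclideanSpace.single i 1)
  have h2 : a * pd i ρ q + b * pd i u q = 0 := h1
  field_simp
  linarith

section Defining

variable {m : ℕ} {ρ : H (m + 1) → ℝ} {Ω : Set (H (m + 1))} (hρ : IsDefiningFunction ρ Ω)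
include hρ

namespace IsDefiningFunction

lemma exists_box {p : H (m + 1)} (hp : ρ p = 0) {O : Set (H (m + 1))} (hO : O ∈ 𝓝 p) :
    ∃ i σ b D ζ, IsGraphBox ρ O i σ b D ζ ∧ ∃ y ∈ D, boxMap i σ ζ y 0 = p := by
  obtain ⟨i, hi⟩ := Function.ne_iff.1 (pd_ne_zero_of_fderiv_ne_zero (hρ.regular p hp))
  obtain ⟨σ, b, D, ζ, hbox, hpb⟩ := exists_isGraphBox (i := i)
    (hρ.smooth.contDiffAt.of_le (by simp)) hp hi hO
  refine ⟨i, σ, b, D, ζ, hbox, ?_⟩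
  obtain ⟨y, hy, t, ht, rfl⟩ := exists_boxMap_eq hbox.sq_eq hpb
  rw [hbox.eq_zero_iff y hy t ht] at hp
  subst hp
  exact ⟨y, hy, rfl⟩

lemma exists_neg {p : H (m + 1)} (hp : ρ p = 0) {O : Set (H (m + 1))} (hO : O ∈ 𝓝 p) :
    ∃ x ∈ O, ρ x < 0 := by
  obtain ⟨i, σ, b, D, ζ, hbox, y, hy, -⟩ := hρ.exists_box hp hO
  have hb := hbox.pos_b
  have ht : |-(b / 2)| < b := by rw [abs_neg, abs_of_pos (half_pos hb)]; exact half_lt_self hb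
  refine ⟨boxMap i σ ζ y (-(b / 2)), hbox.mem y hy _ ht, ?_⟩
  have h1 := (hbox.pos_iff y hy _ ht).not.2 (by linarith)
  have h2 := (hbox.eq_zero_iff y hy _ ht).not.2 (by linarith)
  exact lt_of_le_of_ne (not_lt.1 h1) h2

lemma exists_pos {p : H (m + 1)} (hp : ρ p = 0) {O : Set (H (m + 1))} (hO : O ∈ 𝓝 p) :
    ∃ x ∈ O, 0 < ρ x := by
  obtain ⟨i, σ, b, D, ζ, hbox, y, hy, -⟩ := hρ.exists_box hp hO
  have hb := hbox.pos_b
  have ht : |b / 2| < b := by rw [abs_of_pos (half_pos hb)]; exact half_lt_self hb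
  exact ⟨boxMap i σ ζ y (b / 2), hbox.mem y hy _ ht, (hbox.pos_iff y hy _ ht).2 (half_pos hb)⟩

lemma isOpen : IsOpen Ω := by
  rw [hρ.eq_lt]; exact isOpen_lt hρ.smooth.continuous continuous_const

lemma closure_eq : closure Ω = {x | ρ x ≤ 0} := by
  refine subset_antisymm ?_ fun x hx => ?_
  · rw [hρ.eq_lt]; exact closure_lt_subset_le hρ.smooth.continuous continuous_const
  · rcases (show ρ x ≤ 0 from hx).lt_or_eq with h | h
    · exact subset_closure (by rw [hρ.eq_lt]; exact h)
    · rw [mem_closure_iff_nhds]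
      intro O hO
      obtain ⟨y, hyO, hy⟩ := hρ.exists_neg h hO
      exact ⟨y, hyO, by rw [hρ.eq_lt]; exact hy⟩

lemma frontier_eq : frontier Ω = {x | ρ x = 0} := by
  rw [hρ.isOpen.frontier_eq, hρ.closure_eq, hρ.eq_lt]
  ext x
  exact ⟨fun h => le_antisymm h.1 (not_lt.1 h.2), fun h => ⟨le_of_eq h, not_lt.2 (ge_of_eq h)⟩⟩

lemma compl_closure_eq : (closure Ω)ᶜ = {x | 0 < ρ x} := by
  rw [hρ.closure_eq]; ext x; simp

lemma closure_compl_eq : closure (closure Ω)ᶜ = Ωᶜ := by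
  rw [hρ.compl_closure_eq, hρ.eq_lt]
  refine subset_antisymm ?_ fun x hx => ?_
  · refine (closure_lt_subset_le continuous_const hρ.smooth.continuous).trans fun x hx => ?_
    simpa using hx
  · rcases (show 0 ≤ ρ x by simpa using hx).lt_or_eq with h | h
    · exact subset_closure h
    · rw [mem_closure_iff_nhds]
      intro O hO
      obtain ⟨y, hyO, hy⟩ := hρ.exists_pos h.symm hO
      exact ⟨y, hyO, hy⟩

lemma frontier_compl_closure_eq : frontier (closure Ω)ᶜ = frontier Ω := by
  rw [isClosed_closure.isOpen_compl.frontier_eq, hρ.closure_compl_eq, frontier, hρ.isOpen.interior_eq]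
  ext x
  simp [and_comm]

/-- A function constant on the components of the boundary is locally constant there. -/
lemma eventually_eq_of_level {f : H (m + 1) → ℝ}
    (hlevel : ∀ p ∈ frontier Ω, ∀ q ∈ connectedComponentIn (frontier Ω) p, f q = f p)
    {p : H (m + 1)} (hp : p ∈ frontier Ω) : ∀ᶠ q in 𝓝 p, q ∈ frontier Ω → f q = f p := by
  have hp0 : ρ p = 0 := by rwa [hρ.frontier_eq] at hp
  obtain ⟨i, σ, b, D, ζ, hbox, y, hy, hyp⟩ := hρ.exists_box hp0 univ_mem
  have hpb : p ∈ boxSet i b D ζ := by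
    rw [← hyp, mem_boxSet_boxMap hbox.sq_eq]; exact ⟨hy, by simpa using hbox.pos_b⟩
  filter_upwards [hbox.isOpen_boxSet.mem_nhds hpb] with q hq hqf
  rw [hρ.frontier_eq] at hqf
  obtain ⟨y', hy', t, ht, rfl⟩ := exists_boxMap_eq hbox.sq_eq hq
  have := (hbox.eq_zero_iff y' hy' t ht).1 hqf
  subst this
  refine hlevel p hp _ ?_
  have hc : ContinuousOn (fun y => boxMap i σ ζ y 0) D :=
    hbox.continuousOn_boxMap.comp (f := fun y => (y, (0 : ℝ))) (by fun_prop)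
      fun y hy => ⟨hy, mem_univ _⟩
  -- The piece of Σ in the box is the image of a connected base, hence lies in one component of Σ.
  have hpre := hbox.preconnected.image _ hc
  refine hpre.subset_connectedComponentIn (x := p) ⟨y, hy, hyp⟩ ?_ ⟨y', hy', rfl⟩
  rintro _ ⟨y'', hy'', rfl⟩
  rw [hρ.frontier_eq]
  exact (hbox.eq_zero_iff y'' hy'' 0 (by simpa using hbox.pos_b)).2 rfl

/-- Compactness of Σ and local constancy. Finiteness makes the distance from f(x) to the set of
horizon heights equal to |f(x) - f(p)| near p, so that one global function restricts to the cutoff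
function of every chart. -/
lemma finite_image_frontier (hΩ : Bornology.IsBounded Ω) {f : H (m + 1) → ℝ}
    (hlevel : ∀ p ∈ frontier Ω, ∀ q ∈ connectedComponentIn (frontier Ω) p, f q = f p) :
    (f '' frontier Ω).Finite := by
  have hcpt : IsCompact (frontier Ω) :=
    hΩ.isCompact_closure.of_isClosed_subset isClosed_frontier frontier_subset_closure
  obtain ⟨t, ht, hcov⟩ := hcpt.elim_nhds_subcover
    (fun p => {q | q ∈ frontier Ω → f q = f p}) fun p hp => hρ.eventually_eq_of_level hlevel hp
  refine (t.finite_toSet.image f).subset ?_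
  rintro _ ⟨q, hq, rfl⟩
  obtain ⟨p, hpt, hpq⟩ := mem_iUnion₂.1 (hcov hq)
  exact ⟨p, hpt, (hpq hq).symm⟩

/-- In a box Σ is a graph, which vertical lines meet at most once; Fubini gives measure 0. -/
lemma measure_frontier : volume (frontier Ω) = 0 := by
  refine measure_null_of_locally_null _ fun p hp => ?_
  have hp0 : ρ p = 0 := by rwa [hρ.frontier_eq] at hp
  obtain ⟨i, σ, b, D, ζ, hbox, y₀, hy₀, hyp⟩ := hρ.exists_box hp0 univ_mem
  have hpb : p ∈ boxSet i b D ζ := by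
    rw [← hyp, mem_boxSet_boxMap hbox.sq_eq]; exact ⟨hy₀, by simpa using hbox.pos_b⟩
  refine ⟨frontier Ω ∩ boxSet i b D ζ, inter_mem_nhdsWithin _ (hbox.isOpen_boxSet.mem_nhds hpb), ?_⟩
  have hm : MeasurableSet (frontier Ω ∩ boxSet i b D ζ) :=
    isClosed_frontier.measurableSet.inter hbox.isOpen_boxSet.measurableSet
  rw [← (measurePreserving_insertCoord i).measure_preimage hm.nullMeasurableSet,
    Measure.volume_eq_prod, Measure.measure_prod_null ((insertCoord i).continuous.measurable hm)]
  refine Eventually.of_forall fun y => ?_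
  refine measure_mono_null (t := {ζ y}) ?_ (measure_singleton _)
  rintro z ⟨hz, hzb⟩
  obtain ⟨y', hy', t, ht, he⟩ := exists_boxMap_eq hbox.sq_eq hzb
  rw [← he, hρ.frontier_eq] at hz
  have h0 := (hbox.eq_zero_iff y' hy' t ht).1 hz
  subst h0
  have h1 := (insertCoord i).injective he
  rw [Prod.mk.injEq] at h1
  rw [mem_singleton_iff, ← h1.2, h1.1, mul_zero, add_zero]

end IsDefiningFunction

end Defining

lemma infDist_eq_abs_sub {C : Set ℝ} (hC : C.Finite) {c : ℝ} (hc : c ∈ C) :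
    ∀ᶠ s in 𝓝 c, Metric.infDist s C = |s - c| := by
  have hclosed : IsClosed (C \ {c}) := (hC.subset sdiff_subset).isClosed
  obtain ⟨δ, hδ, hball⟩ := Metric.isOpen_iff.1 hclosed.isOpen_compl c (by simp)
  filter_upwards [Metric.ball_mem_nhds c (half_pos hδ)] with s hs
  rw [Metric.mem_ball, Real.dist_eq] at hs
  refine le_antisymm ?_ ((Metric.le_infDist ⟨c, hc⟩).2 fun c' hc' => ?_)
  · rw [← Real.dist_eq]; exact Metric.infDist_le_dist_of_mem hc
  · rw [Real.dist_eq]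
    by_cases h : c' = c
    · rw [h]
    · have h1 : ¬ dist c' c < δ := fun h1 => hball h1 ⟨hc', h⟩
      rw [Real.dist_eq, not_lt] at h1
      have h2 : |c' - c| ≤ |s - c'| + |s - c| := by
        rw [abs_sub_comm s c']
        exact abs_sub_le c' s c
      linarith

/-! ### Hypersurfaces `{G = 0}` of the product -/

section Implicit

variable {n : ℕ} {G : H n × ℝ → ℝ} {z : H n × ℝ}

/-- The horizontal differential of a function on the product. -/
def horizDiff (G : H n × ℝ → ℝ) (z : H n × ℝ) (i : Fin n) : ℝ :=
  fderiv ℝ G z (EuclideanSpace.single i 1, 0)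

/-- The vertical derivative of a function on the product. -/
def vertDiff (G : H n × ℝ → ℝ) (z : H n × ℝ) : ℝ := fderiv ℝ G z (0, 1)

/-- The horizontal part of the normal of the level sets of `G`. -/
def implicitNormal (G : H n × ℝ → ℝ) (z : H n × ℝ) (s : Fin n) : ℝ :=
  normalPart z.1 (vertDiff G z) (horizDiff G z) s

/-- The horizontal Jacobian of the normal of the level sets of `G`. -/
def implicitShape (G : H n × ℝ → ℝ) (z : H n × ℝ) : Matrix (Fin n) (Fin n) ℝ :=
  Matrix.of fun i s => horizDiff (fun w => implicitNormal G w s) z i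

lemma contDiffAt_horizDiff (hG : ContDiffAt ℝ ∞ G z) (i : Fin n) :
    ContDiffAt ℝ ∞ (fun w => horizDiff G w i) z :=
  (hG.fderiv_right (m := ∞) (by simp)).clm_apply contDiffAt_const

lemma contDiffAt_vertDiff (hG : ContDiffAt ℝ ∞ G z) : ContDiffAt ℝ ∞ (vertDiff G) z :=
  (hG.fderiv_right (m := ∞) (by simp)).clm_apply contDiffAt_const

lemma contDiffAt_fst_apply (i : Fin n) : ContDiffAt ℝ ∞ (fun w : H n × ℝ => w.1 i) z :=
  ContDiffAt.comp (f := Prod.fst) (g := fun y : H n => y i) z (contDiff_coord i).contDiffAt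
    contDiffAt_fst

lemma contDiffAt_implicitNormal (hG : ContDiffAt ℝ ∞ G z) (h : horizDiff G z ≠ 0) (s : Fin n) :
    ContDiffAt ℝ ∞ (fun w => implicitNormal G w s) z := by
  unfold implicitNormal normalPart coNormSq
  have hpos : 0 < vertDiff G z ^ 2 / (1 + ‖z.1‖ ^ 2) + coNormSq z.1 (horizDiff G z) := by
    have := coNormSq_pos z.1 h
    positivity
  have hα := fun i => contDiffAt_horizDiff hG i
  have hx := fun i : Fin n => contDiffAt_fst_apply (z := z) i
  have hsum : ContDiffAt ℝ ∞ (fun w : H n × ℝ => ∑ i, w.1 i * horizDiff G w i) z :=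
    ContDiffAt.sum fun i _ => (hx i).mul (hα i)
  have hN : ContDiffAt ℝ ∞ (fun w : H n × ℝ => 1 + ‖w.1‖ ^ 2) z :=
    ContDiffAt.comp (f := Prod.fst) (g := fun y : H n => 1 + ‖y‖ ^ 2) z
      contDiff_one_add_norm_sq.contDiffAt contDiffAt_fst
  refine ContDiffAt.div ((hα s).add ((hx s).mul hsum)) (ContDiffAt.sqrt ?_ hpos.ne')
    (Real.sqrt_pos.2 hpos).ne'
  exact (((contDiffAt_vertDiff hG).pow 2).div hN (one_add_norm_sq_pos z.1).ne').add
    ((ContDiffAt.sum fun i _ => (hα i).mul (hα i)).add (hsum.pow 2))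

lemma contDiffAt_implicitShape (hG : ContDiffAt ℝ ∞ G z) (h : horizDiff G z ≠ 0) (i s : Fin n) :
    ContDiffAt ℝ ∞ (fun w => implicitShape G w i s) z :=
  contDiffAt_horizDiff (contDiffAt_implicitNormal hG h s) i

lemma pd_comp_graph {P : H n × ℝ → ℝ} {f : H n → ℝ} {x : H n} (hP : DifferentiableAt ℝ P (x, f x))
    (hf : DifferentiableAt ℝ f x) (i : Fin n) :
    pd i (fun y => P (y, f y)) x = horizDiff P (x, f x) i + pd i f x * vertDiff P (x, f x) := by
  have h1 : HasFDerivAt (fun y => P (y, f y))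
      ((fderiv ℝ P (x, f x)).comp ((ContinuousLinearMap.id ℝ (H n)).prod (fderiv ℝ f x))) x :=
    HasFDerivAt.comp (f := fun y => (y, f y)) x hP.hasFDerivAt
      ((hasFDerivAt_id x).prodMk hf.hasFDerivAt)
  rw [pd, h1.fderiv, horizDiff, vertDiff, pd, ← smul_eq_mul, ← map_smul, ← map_add]
  simp

lemma pd_slice {P : H n × ℝ → ℝ} {c : ℝ} {x : H n} (hP : DifferentiableAt ℝ P (x, c)) (i : Fin n) :
    pd i (fun y => P (y, c)) x = horizDiff P (x, c) i := by
  have := pd_comp_graph (f := fun _ => c) hP (differentiableAt_const c) i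
  rw [this, pd_const, zero_mul, add_zero]

lemma normalPart_neg (x : H n) (c : ℝ) (α : Fin n → ℝ) (s : Fin n) :
    normalPart x (-c) α s = normalPart x c α s := by
  rw [normalPart, normalPart, neg_sq]

lemma div_abs_sq {a : ℝ} (ha : a ≠ 0) : (a / |a|) ^ 2 = 1 := by
  rw [div_pow, sq_abs, div_self (pow_ne_zero 2 ha)]

lemma horizDiff_eq_of_graph {f : H n → ℝ} {x : H n} (hG : DifferentiableAt ℝ G (x, f x))
    (hf : DifferentiableAt ℝ f x) (h : ∀ᶠ y in 𝓝 x, G (y, f y) = 0) (i : Fin n) :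
    horizDiff G (x, f x) i + pd i f x * vertDiff G (x, f x) = 0 := by
  rw [← pd_comp_graph hG hf i, pd_congr i (h : (fun y => G (y, f y)) =ᶠ[𝓝 x] fun _ => 0), pd_const]

lemma graphNormal_eq_implicitNormal {f : H n → ℝ} {x : H n} (hG : DifferentiableAt ℝ G (x, f x))
    (hf : DifferentiableAt ℝ f x) (h : ∀ᶠ y in 𝓝 x, G (y, f y) = 0)
    (hv : vertDiff G (x, f x) ≠ 0) (s : Fin n) :
    graphNormal f x s =
      -vertDiff G (x, f x) / |vertDiff G (x, f x)| * implicitNormal G (x, f x) s := by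
  set v := vertDiff G (x, f x) with hvd
  have e : (fun i => pd i f x) = (-v⁻¹) • horizDiff G (x, f x) := by
    ext i
    have := horizDiff_eq_of_graph hG hf h i
    rw [Pi.smul_apply, smul_eq_mul]
    field_simp
    linarith
  have h1 : (1 : ℝ) = -v⁻¹ * -v := by field_simp
  rw [graphNormal, e, h1, normalPart_smul, implicitNormal, normalPart_neg, abs_neg, abs_inv]
  congr 1
  have : |v| ≠ 0 := abs_ne_zero.2 hv
  field_simp
  rw [sq_abs]

/-- The flux form of a graph in terms of a defining function of the graph. -/
lemma fluxForm_graph_eq {f : H n → ℝ} {x : H n} {k : ℕ} (hk : 1 ≤ k) (hG : ContDiff ℝ ∞ G)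
    (hf : ∀ᶠ y in 𝓝 x, DifferentiableAt ℝ f y) (h : ∀ᶠ y in 𝓝 x, G (y, f y) = 0)
    (hh : horizDiff G (x, f x) ≠ 0) (hv : vertDiff G (x, f x) ≠ 0) :
    fluxForm k (graphShape f x) (graphNormal f x) (horizDiff G (x, f x)) =
      fluxForm k (implicitShape G (x, f x)) (implicitNormal G (x, f x)) (horizDiff G (x, f x)) := by
  have hGd : ∀ z, DifferentiableAt ℝ G z := fun z => hG.differentiable (by simp) z
  have hfx := hf.self_of_nhds
  set v := vertDiff G (x, f x) with hvd
  have hcont : ContinuousAt (fun y => vertDiff G (y, f y)) x :=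
    ContinuousAt.comp (f := fun y => (y, f y)) (g := vertDiff G)
      (contDiffAt_vertDiff hG.contDiffAt).continuousAt (continuousAt_id.prodMk hfx.continuousAt)
  -- The two unit normals differ by the sign of -∂_s G. That sign is locally constant, so it can be
  -- pulled out of the derivatives below.
  have hsign : ∀ᶠ y in 𝓝 x, -vertDiff G (y, f y) / |vertDiff G (y, f y)| = -v / |v| ∧
      vertDiff G (y, f y) ≠ 0 := by
    rcases hv.lt_or_gt with hneg | hpos
    · filter_upwards [hcont.eventually_lt_const hneg] with y hy
      rw [abs_of_neg hy, abs_of_neg hneg, div_self (by linarith), div_self (by linarith)]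
      exact ⟨rfl, hy.ne⟩
    · filter_upwards [hcont.eventually_const_lt hpos] with y hy
      rw [abs_of_pos hy, abs_of_pos hpos, neg_div, neg_div, div_self hy.ne', div_self hpos.ne']
      exact ⟨rfl, hy.ne'⟩
  set ε := -v / |v| with hε
  have hε2 : ε ^ 2 = 1 := by rw [hε, neg_div, neg_sq, div_abs_sq hv]
  have hev : ∀ s, (fun y => graphNormal f y s) =ᶠ[𝓝 x] fun y => ε * implicitNormal G (y, f y) s := by
    intro s
    filter_upwards [hf, h.eventually_nhds, hsign] with y hfy hy hsy
    rw [graphNormal_eq_implicitNormal (hGd _) hfy hy hsy.2, hsy.1]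
  have hq : graphNormal f x = ε • implicitNormal G (x, f x) := by
    ext s; exact (hev s).self_of_nhds
  refine fluxForm_congr hk hε2 hq
    (fun s => -v⁻¹ * (ε * vertDiff (fun w => implicitNormal G w s) (x, f x))) ?_
  ext i s
  have hqd : DifferentiableAt ℝ (fun w => implicitNormal G w s) (x, f x) :=
    (contDiffAt_implicitNormal hG.contDiffAt hh s).differentiableAt (by simp)
  have hcomp : DifferentiableAt ℝ (fun y => implicitNormal G (y, f y) s) x :=
    DifferentiableAt.comp (f := fun y => (y, f y)) (g := fun w => implicitNormal G w s) x hqd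
      (differentiableAt_id.prodMk hfx)
  rw [graphShape, Matrix.of_apply, pd_congr i (hev s), pd_const_mul i ε hcomp, Matrix.add_apply,
    Matrix.smul_apply, Matrix.vecMulVec_apply, implicitShape, Matrix.of_apply, smul_eq_mul,
    pd_comp_graph hqd hfx i]
  have := horizDiff_eq_of_graph (hGd (x, f x)) hfx h i
  -- By the chain rule the Jacobian of the graph normal has the extra term ∂_i f ⊗ (vertical
  -- derivative). As df is a multiple of the horizontal differential of G, this is of the form α ⊗
  -- v, which the flux form ignores.
  have e : pd i f x = - v⁻¹ * horizDiff G (x, f x) i := by field_simp; linarith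
  rw [e]; ring

/-- At a horizon, the flux form is that of the boundary hypersurface. -/
lemma fluxForm_level_eq {ρ : H n → ℝ} {q : H n} {c : ℝ} {k : ℕ} (hk : 1 ≤ k) (hG : ContDiff ℝ ∞ G)
    (hρ : ContDiff ℝ ∞ ρ) (hρq : ρ q = 0) (hρ' : fderiv ℝ ρ q ≠ 0)
    (hh : horizDiff G (q, c) ≠ 0) (h : ∀ᶠ y in 𝓝 q, ρ y = 0 → G (y, c) = 0 ∧ vertDiff G (y, c) = 0) :
    ∃ μ : ℝ, μ ≠ 0 ∧ (∀ i, horizDiff G (q, c) i = μ * pd i ρ q) ∧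
      fluxForm k (implicitShape G (q, c)) (implicitNormal G (q, c)) (fun i => pd i ρ q) =
      fluxForm k (levelShape ρ q) (unitNormal (hypMetric n) ρ q) (fun i => pd i ρ q) := by
  have hGd : ∀ z, DifferentiableAt ℝ G z := fun z => hG.differentiable (by simp) z
  have hslice : ∀ y, ContDiffAt ℝ ∞ (fun y => G (y, c)) y := fun y =>
    (hG.comp (contDiff_id.prodMk contDiff_const)).contDiffAt
  -- proportionality at all nearby points of the level set
  have hprop : ∀ᶠ y in 𝓝 q, ρ y = 0 → ∃ v : ℝ, ∀ i, horizDiff G (y, c) i = v * pd i ρ y := by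
    have hne : ∀ᶠ y in 𝓝 q, fderiv ℝ ρ y ≠ 0 :=
      ((hρ.continuous_fderiv (by simp)).continuousAt).eventually_ne hρ'
    filter_upwards [h.eventually_nhds, hne] with y hy hney hρy
    obtain ⟨v, hv⟩ := exists_pd_eq_mul (u := fun y => G (y, c)) (hρ.contDiffAt.of_le (by simp))
      ((hslice y).of_le (by simp)) hney (hy.mono fun w hw hw' => by
        rw [(hw (hw'.trans hρy)).1, (hy.self_of_nhds hρy).1])
    exact ⟨v, fun i => by rw [← pd_slice (hGd _), hv]⟩
  obtain ⟨μ, hμ⟩ := hprop.self_of_nhds hρq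
  have hμ0 : μ ≠ 0 := by
    rintro rfl
    exact hh (funext fun i => by rw [hμ, zero_mul]; rfl)
  refine ⟨μ, hμ0, hμ, ?_⟩
  obtain ⟨i₀, hi₀⟩ := Function.ne_iff.1 (pd_ne_zero_of_fderiv_ne_zero hρ')
  simp only [Pi.zero_apply] at hi₀
  set ε := μ / |μ| with hε
  have hε2 : ε ^ 2 = 1 := div_abs_sq hμ0
  -- the normals agree along the level set
  have hcz : ContinuousAt (fun y => horizDiff G (y, c) i₀ * pd i₀ ρ y * μ) q := by
    have h1 : ContinuousAt (fun y => horizDiff G (y, c) i₀) q :=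
      ContinuousAt.comp (f := fun y => (y, c)) (g := fun w => horizDiff G w i₀)
        (contDiffAt_horizDiff hG.contDiffAt i₀).continuousAt
        (continuousAt_id.prodMk continuousAt_const)
    exact (h1.mul (contDiffAt_pd_top i₀ hρ.contDiffAt).continuousAt).mul continuousAt_const
  -- One nonzero component of dρ is enough to see that the proportionality factor keeps its sign
  -- near q.
  have hsg : ∀ᶠ y in 𝓝 q, 0 < horizDiff G (y, c) i₀ * pd i₀ ρ y * μ := by
    refine hcz.eventually_const_lt ?_
    simp only [hμ]
    have : 0 < (μ * pd i₀ ρ q) ^ 2 := by positivity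
    nlinarith
  have hnorm : ∀ᶠ y in 𝓝 q, ρ y = 0 → ∀ s, implicitNormal G (y, c) s =
      ε * unitNormal (hypMetric n) ρ y s := by
    filter_upwards [hprop, hsg, h] with y hy hys hyv hρy s
    obtain ⟨v, hv⟩ := hy hρy
    rw [hv] at hys
    have hvμ : 0 < v * μ := by
      have : 0 < (v * μ) * pd i₀ ρ y ^ 2 := by nlinarith
      exact pos_of_mul_pos_left this (sq_nonneg _)
    have hvε : v / |v| = ε := by
      rcases hμ0.lt_or_gt with hm | hm
      · have : v < 0 := by nlinarith
        rw [hε, abs_of_neg this, abs_of_neg hm, div_neg_self this.ne, div_neg_self hm.ne]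
      · have : 0 < v := by nlinarith
        rw [hε, abs_of_pos this, abs_of_pos hm, div_self this.ne', div_self hm.ne']
    have e : horizDiff G (y, c) = v • fun i => pd i ρ y := funext hv
    rw [implicitNormal, (hyv hρy).2, e, ← mul_zero v, normalPart_smul, hvε, unitNormal_hypMetric]
  have hcn : ∀ s, ContDiffAt ℝ ∞ (fun y => implicitNormal G (y, c) s) q := fun s =>
    ContDiffAt.comp (f := fun y => (y, c)) (g := fun w => implicitNormal G w s) q
      (contDiffAt_implicitNormal hG.contDiffAt hh s) (contDiffAt_id.prodMk contDiffAt_const)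
  have hcu : ∀ s, ContDiffAt ℝ ∞ (fun y => unitNormal (hypMetric n) ρ y s) q := fun s =>
    contDiffAt_unitNormal hρ.contDiffAt hρ' s
  -- The difference of the two normals vanishes on {ρ = 0}, so its differential is a multiple of dρ.
  -- Hence the two Jacobians agree up to the sign ε and a term dρ ⊗ v.
  have hw : ∀ s, ∃ v : ℝ, ∀ i, pd i (fun y => implicitNormal G (y, c) s -
      ε * unitNormal (hypMetric n) ρ y s) q = v * pd i ρ q := by
    intro s
    refine exists_pd_eq_mul (hρ.contDiffAt.of_le (by simp))
      (((hcn s).sub (contDiffAt_const.mul (hcu s))).of_le (by simp)) hρ' ?_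
    filter_upwards [hnorm] with y hy hyq
    rw [hy (hyq.trans hρq), hnorm.self_of_nhds hρq]
    ring
  choose v hv using hw
  refine fluxForm_congr hk hε2 (funext fun s => hnorm.self_of_nhds hρq s) v ?_
  ext i s
  have h1 := hv s i
  have hdu : DifferentiableAt ℝ (fun y => unitNormal (hypMetric n) ρ y s) q :=
    (hcu s).differentiableAt (by simp)
  have hdn : DifferentiableAt ℝ (fun y => implicitNormal G (y, c) s) q :=
    (hcn s).differentiableAt (by simp)
  rw [pd_sub i hdn (hdu.const_mul ε), pd_const_mul i ε hdu,
    pd_slice (P := fun w => implicitNormal G w s)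
      ((contDiffAt_implicitNormal hG.contDiffAt hh s).differentiableAt (by simp))] at h1
  rw [implicitShape, Matrix.of_apply, Matrix.add_apply, Matrix.smul_apply, Matrix.vecMulVec_apply,
    levelShape, Matrix.of_apply, smul_eq_mul]
  linarith

end Implicit

/-! ### The boundary chart at a horizon -/

lemma horizDiff_ne_zero {n : ℕ} {G : H n × ℝ → ℝ} {z : H n × ℝ} (h : fderiv ℝ G z ≠ 0)
    (hv : vertDiff G z = 0) : horizDiff G z ≠ 0 := by
  intro hh
  apply h
  have h1 : (fderiv ℝ G z).comp (ContinuousLinearMap.inl ℝ (H n) ℝ) = 0 := by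
    apply ContinuousLinearMap.coe_injective
    refine (EuclideanSpace.basisFun (Fin n) ℝ).toBasis.ext fun i => ?_
    simpa [horizDiff] using congrFun hh i
  ext v
  · simpa using DFunLike.congr_fun h1 v
  · simpa [vertDiff] using hv

lemma tendsto_coNormSq {n : ℕ} {l : Filter (H n)} {α : H n → Fin n → ℝ} {x : H n}
    {a : Fin n → ℝ} (hl : l ≤ 𝓝 x) (h : ∀ i, Tendsto (fun y => α y i) l (𝓝 (a i))) :
    Tendsto (fun y => coNormSq y (α y)) l (𝓝 (coNormSq x a)) := by
  have hx : ∀ i, Tendsto (fun y : H n => y i) l (𝓝 (x i)) := fun i =>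
    (((contDiff_coord i).continuous).tendsto x).mono_left hl
  exact (tendsto_finsetSum _ fun i _ => (h i).mul (h i)).add
    ((tendsto_finsetSum _ fun i _ => (hx i).mul (h i)).pow 2)

/-- The Euclidean density of the boundary term on the level sets of `ρ`. -/
def horizonFlux {n : ℕ} (ρ : H n → ℝ) (k : ℕ) (x : H n) : ℝ :=
  fluxForm k (levelShape ρ x) (unitNormal (hypMetric n) ρ x) (fun i => pd i ρ x) /
    √(∑ i, pd i ρ x ^ 2)

namespace IsHorizonGraph

variable {m k : ℕ} {ρ f : H (m + 1) → ℝ} {Ω : Set (H (m + 1))} {G : H (m + 1) × ℝ → ℝ}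

lemma contDiffAt {n : ℕ} {f : H n → ℝ} {Ω : Set (H n)} (hf : IsHorizonGraph Ω f) {x : H n}
    (hx : x ∈ (closure Ω)ᶜ) : ContDiffAt ℝ ∞ f x :=
  hf.smooth.contDiffAt (isClosed_closure.isOpen_compl.mem_nhds hx)

lemma eventually_contDiffAt {n : ℕ} {f : H n → ℝ} {Ω : Set (H n)} (hf : IsHorizonGraph Ω f)
    {x : H n} (hx : x ∈ (closure Ω)ᶜ) : ∀ᶠ y in 𝓝 x, ContDiffAt ℝ ∞ f y := by
  filter_upwards [isClosed_closure.isOpen_compl.mem_nhds hx] with y hy using hf.contDiffAt hy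

/-- The tangent spaces of the graph are vertical over the horizon. -/
lemma vertDiff_eq_zero (hρ : IsDefiningFunction ρ Ω) (hf : IsHorizonGraph Ω f)
    (hG : ContDiff ℝ ∞ G) {q : H (m + 1)} (hq : q ∈ frontier Ω)
    (h : ∀ᶠ y in 𝓝 q, y ∈ (closure Ω)ᶜ → ∀ᶠ w in 𝓝 y, G (w, f w) = 0) :
    vertDiff G (q, f q) = 0 := by
  -- If the vertical derivative were nonzero, ∂_i f = -∂_i G / ∂_s G would have a finite limit at q,
  -- contradicting |∇̄f| → ∞.
  by_contra hv
  have hqc : q ∈ Ωᶜ := by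
    have : q ∉ interior Ω := hq.2
    rwa [hρ.isOpen.interior_eq] at this
  have hsub : (closure Ω)ᶜ ⊆ Ωᶜ := compl_subset_compl.2 subset_closure
  have hne : (𝓝[(closure Ω)ᶜ] q).NeBot := by
    rw [← mem_closure_iff_nhdsWithin_neBot, hρ.closure_compl_eq]; exact hqc
  have hft : Tendsto f (𝓝[(closure Ω)ᶜ] q) (𝓝 (f q)) :=
    (hf.continuousOn q hqc).mono_left (nhdsWithin_mono q hsub)
  have hpt : Tendsto (fun y => (y, f y)) (𝓝[(closure Ω)ᶜ] q) (𝓝 (q, f q)) :=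
    (tendsto_id.mono_left nhdsWithin_le_nhds).prodMk_nhds hft
  have hvt : Tendsto (fun y => vertDiff G (y, f y)) (𝓝[(closure Ω)ᶜ] q)
      (𝓝 (vertDiff G (q, f q))) := (contDiffAt_vertDiff hG.contDiffAt).continuousAt.tendsto.comp hpt
  have hht : ∀ i, Tendsto (fun y => horizDiff G (y, f y) i) (𝓝[(closure Ω)ᶜ] q)
      (𝓝 (horizDiff G (q, f q) i)) := fun i =>
    ((contDiffAt_horizDiff hG.contDiffAt i).continuousAt.tendsto).comp hpt
  have hpd : ∀ i, Tendsto (fun y => pd i f y) (𝓝[(closure Ω)ᶜ] q)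
      (𝓝 (-horizDiff G (q, f q) i / vertDiff G (q, f q))) := by
    intro i
    refine ((hht i).neg.div hvt hv).congr' ?_
    filter_upwards [h.filter_mono nhdsWithin_le_nhds, self_mem_nhdsWithin,
      hvt.eventually_ne hv] with y hy hyU hyv
    have := horizDiff_eq_of_graph (hG.differentiable (by simp) _)
      ((hf.contDiffAt hyU).differentiableAt (by simp)) (hy hyU) i
    rw [Pi.div_apply, div_eq_iff hyv]
    linarith
  have hlim := (tendsto_coNormSq nhdsWithin_le_nhds hpd).sqrt
  have hinf : Tendsto (fun x => √(gradSq (hypMetric (m + 1)) f x)) (𝓝[(closure Ω)ᶜ] q) atTop :=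
    hf.grad_tendsto.mono_left (inf_le_inf_right _ (nhds_le_nhdsSet hq))
  simp_rw [gradSq_hypMetric] at hinf
  exact not_tendsto_nhds_of_tendsto_atTop hinf _ hlim

/-- Near the horizon, `f` minus its boundary value is a boundary chart for the field whose
divergence is the Gauss-Bonnet curvature of the graph. -/
lemma exists_isBoundaryChart (hk : 1 ≤ k) (hΩ : Bornology.IsBounded Ω)
    (hρ : IsDefiningFunction ρ Ω) (hf : IsHorizonGraph Ω f) {p : H (m + 1)}
    (hp : p ∈ frontier Ω) {B : Set (H (m + 1))} (hB : IsOpen B) (hpB : p ∈ B)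
    {F K : H (m + 1) → ℝ} (hF : ∀ᶠ x in 𝓝 p, F x = Metric.infDist (f x) (f '' frontier Ω) ^ 2)
    (hK : ∀ᶠ x in 𝓝 p, K x = horizonFlux ρ k x) :
    ∃ O ρ φ h β, p ∈ O ∧
      IsBoundaryChart ((closure Ω)ᶜ ∩ B) (gbcField f k) F K O ρ φ h β := by
  obtain ⟨G, hG, hGp, hGf⟩ := hf.smooth_boundary p hp
  have hsub : (closure Ω)ᶜ ⊆ Ωᶜ := compl_subset_compl.2 subset_closure
  have hfr : frontier Ω ⊆ Ωᶜ := fun q hq => by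
    have : q ∉ interior Ω := hq.2
    rwa [hρ.isOpen.interior_eq] at this
  have hpt : ∀ q ∈ Ωᶜ, ContinuousWithinAt (fun y => (y, f y)) Ωᶜ q := fun q hq =>
    continuousWithinAt_id.prodMk (hf.continuousOn q hq)
  have hopen : ∀ {O : Set (H (m + 1))}, IsOpen O → (∀ x ∈ O, x ∈ Ωᶜ → G (x, f x) = 0) →
      ∀ y ∈ O, y ∈ (closure Ω)ᶜ → ∀ᶠ w in 𝓝 y, G (w, f w) = 0 := fun hO hOG y hy hyU => by
    filter_upwards [hO.mem_nhds hy, isClosed_closure.isOpen_compl.mem_nhds hyU] with w hw hwU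
    exact hOG w hw (hsub hwU)
  have hGf' := eventually_nhdsWithin_iff.1 hGf
  have hvp : vertDiff G (p, f p) = 0 := by
    obtain ⟨O, hO, hOo, hpO⟩ := eventually_nhds_iff.1 hGf'
    exact hf.vertDiff_eq_zero hρ hG hp (by
      filter_upwards [hOo.mem_nhds hpO] with y hy using hopen hOo hO y hy)
  have hhp := horizDiff_ne_zero hGp hvp
  have hhne : ∀ᶠ x in 𝓝[Ωᶜ] p, horizDiff G (x, f x) ≠ 0 := by
    obtain ⟨i, hi⟩ := Function.ne_iff.1 hhp
    have : ContinuousWithinAt (fun y => horizDiff G (y, f y) i) Ωᶜ p :=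
      ContinuousAt.comp_continuousWithinAt (g := fun w => horizDiff G w i)
        (contDiffAt_horizDiff hG.contDiffAt i).continuousAt (hpt p (hfr hp))
    exact (this.eventually_ne hi).mono fun x hx hx0 => hx (congrFun hx0 i)
  have hdist : ∀ᶠ x in 𝓝[Ωᶜ] p, Metric.infDist (f x) (f '' frontier Ω) = |f x - f p| :=
    (hf.continuousOn p (hfr hp)).eventually (infDist_eq_abs_sub
      (hρ.finite_image_frontier hΩ hf.level) (mem_image_of_mem f hp))
  have hBp : ∀ᶠ x in 𝓝 p, x ∈ B := hB.mem_nhds hpB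
  obtain ⟨O, hO, hOo, hpO⟩ := eventually_nhds_iff.1 (hGf'.and
    ((hρ.eventually_eq_of_level hf.level hp).and ((eventually_nhdsWithin_iff.1 hhne).and
      ((eventually_nhdsWithin_iff.1 hdist).and (hBp.and (hF.and hK))))))
  have hOB : O ⊆ B := fun x hx => (hO x hx).2.2.2.2.1
  replace hF := fun x hx => (hO x hx).2.2.2.2.2.1
  replace hK := fun x hx => (hO x hx).2.2.2.2.2.2
  have hOG : ∀ y ∈ O, y ∈ (closure Ω)ᶜ → ∀ᶠ w in 𝓝 y, G (w, f w) = 0 :=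
    hopen hOo fun x hx => (hO x hx).1
  have hfW : ∀ x ∈ O, x ∈ frontier ((closure Ω)ᶜ ∩ B) → x ∈ frontier Ω := fun x hx hxW => by
    have : x ∈ frontier ((closure Ω)ᶜ ∩ B) ∩ B := ⟨hxW, hOB hx⟩
    rw [frontier_inter_open_inter hB, hρ.frontier_compl_closure_eq] at this
    exact this.1
  have hfW' : ∀ x ∈ O, x ∈ frontier Ω → x ∈ frontier ((closure Ω)ᶜ ∩ B) := fun x hx hxW => by
    have : x ∈ frontier (closure Ω)ᶜ ∩ B := ⟨by rwa [hρ.frontier_compl_closure_eq], hOB hx⟩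
    rw [← frontier_inter_open_inter hB] at this
    exact this.1
  have hcW : closure ((closure Ω)ᶜ ∩ B) ⊆ Ωᶜ := by
    rw [← hρ.closure_compl_eq]; exact closure_mono inter_subset_left
  have hv : ∀ x ∈ O, x ∈ frontier Ω → vertDiff G (x, f p) = 0 := fun x hx hxf => by
    rw [← (hO x hx).2.1 hxf]
    exact hf.vertDiff_eq_zero hρ hG hxf (by
      filter_upwards [hOo.mem_nhds hx] with y hy using hOG y hy)
  have hptW : ∀ q ∈ closure ((closure Ω)ᶜ ∩ B) ∩ O,
      ContinuousWithinAt (fun y => (y, f y)) (closure ((closure Ω)ᶜ ∩ B) ∩ O) q := fun q hq =>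
    (hpt q (hcW hq.1)).mono (inter_subset_left.trans hcW)
  have hβc : ∀ i, ContinuousOn (fun x => horizDiff G (x, f x) i)
      (closure ((closure Ω)ᶜ ∩ B) ∩ O) := fun i q hq =>
    ContinuousAt.comp_continuousWithinAt (g := fun w => horizDiff G w i)
      (contDiffAt_horizDiff hG.contDiffAt i).continuousAt (hptW q hq)
  refine ⟨O, ρ, fun x => f x - f p, fun x => fluxForm k (implicitShape G (x, f x))
    (implicitNormal G (x, f x)) (horizDiff G (x, f x)), fun x => horizDiff G (x, f x), hpO,
    { isOpen := hOo
      contDiffAt := fun x _ => hρ.smooth.contDiffAt.of_le (by simp)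
      fderiv_ne := fun x hx hxW => hρ.regular x ?_
      mem_iff := fun x hx => ?_
      frontier_iff := fun x hx => ?_
      continuousOn_φ := (hf.continuousOn.mono (inter_subset_left.trans hcW)).sub continuousOn_const
      continuousOn_h := fun q hq => continuousWithinAt_fluxForm (fun i j => ?_) (fun i => ?_)
        (fun i => hβc i q hq)
      continuousOn_β := hβc
      φ_eq_zero := fun x hx hxW => ?_
      F_eq := fun x hx hxW => ?_
      contDiffAt_φ := fun x hx hxW => ((hf.contDiffAt hxW.1).of_le (by simp)).sub contDiffAt_const
      interior := fun x hx hxW => ?_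
      boundary := fun x hx hxW => ?_ }⟩
  · have := hfW x hx hxW
    rwa [hρ.frontier_eq] at this
  · rw [mem_inter_iff, hρ.compl_closure_eq]
    exact ⟨fun h => h.1, fun h => ⟨h, hOB hx⟩⟩
  · rw [show ρ x = 0 ↔ x ∈ frontier Ω by rw [hρ.frontier_eq]; rfl]
    exact ⟨hfW x hx, hfW' x hx⟩
  · exact ContinuousAt.comp_continuousWithinAt (g := fun w => implicitShape G w i j)
      (contDiffAt_implicitShape hG.contDiffAt ((hO q hq.2).2.2.1 (hcW hq.1)) i j).continuousAt
      (hptW q hq)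
  · exact ContinuousAt.comp_continuousWithinAt (g := fun w => implicitNormal G w i)
      (contDiffAt_implicitNormal hG.contDiffAt ((hO q hq.2).2.2.1 (hcW hq.1)) i).continuousAt
      (hptW q hq)
  · exact sub_eq_zero.2 ((hO x hx).2.1 (hfW x hx hxW))
  · rw [hF x hx, (hO x hx).2.2.2.1 (hcW hxW), sq_abs]
  · have hxU : x ∈ (closure Ω)ᶜ := hxW.1
    have hd := fun i => horizDiff_eq_of_graph (hG.differentiable (by simp) _)
      ((hf.contDiffAt hxU).differentiableAt (by simp)) (hOG x hx hxU) i
    have hh := (hO x hx).2.2.1 (hsub hxU)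
    -- Off the horizon the graph is nowhere vertical, so μ = -1/∂_s G is finite; it is this factor
    -- that blows up at Σ.
    have hvx : vertDiff G (x, f x) ≠ 0 := fun h0 => hh (funext fun i => by simpa [h0] using hd i)
    have hpd : ∀ i, pd i (fun x => f x - f p) x = -(vertDiff G (x, f x))⁻¹ * horizDiff G (x, f x) i := by
      intro i
      rw [pd_sub i ((hf.contDiffAt hxU).differentiableAt (by simp)) (differentiableAt_const _),
        pd_const]
      field_simp
      linarith [hd i]
    refine ⟨-(vertDiff G (x, f x))⁻¹, neg_ne_zero.2 (inv_ne_zero hvx), hpd, ?_⟩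
    rw [← fluxForm_graph_eq hk hG ((hf.eventually_contDiffAt hxU).mono fun y hy =>
      hy.differentiableAt (by simp)) (hOG x hx hxU) hh hvx, ← sum_mul_gbcField, Finset.mul_sum]
    exact Finset.sum_congr rfl fun i _ => by rw [hpd i, mul_assoc]
  · have hxf := hfW x hx hxW
    have hx0 : ρ x = 0 := by rwa [hρ.frontier_eq] at hxf
    have hfx : f x = f p := (hO x hx).2.1 hxf
    obtain ⟨μ, hμ, hβ, hflux⟩ := fluxForm_level_eq (c := f p) hk hG hρ.smooth hx0
      (hρ.regular x hx0) (by rw [← hfx]; exact (hO x hx).2.2.1 (hfr hxf)) (by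
        filter_upwards [hOo.mem_nhds hx] with y hy hy0
        have hyf : y ∈ frontier Ω := by rw [hρ.frontier_eq]; exact hy0
        refine ⟨?_, hv y hy hyf⟩
        have := (hO y hy).1 (hfr hyf)
        rwa [(hO y hy).2.1 hyf] at this)
    simp only [hfx]
    refine ⟨μ, hμ, hβ, ?_⟩
    have hs : √(∑ i, pd i ρ x ^ 2) ≠ 0 := by
      obtain ⟨i, hi⟩ := Function.ne_iff.1 (pd_ne_zero_of_fderiv_ne_zero (hρ.regular x hx0))
      exact (sqrt_pos.2 (Finset.sum_pos' (fun j _ => sq_nonneg (pd j ρ x))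
        ⟨i, Finset.mem_univ i, sq_pos_of_ne_zero hi⟩)).ne'
    rw [hK x hx, horizonFlux, ← hflux, show horizDiff G (x, f p) = μ • fun i => pd i ρ x from
      funext fun i => hβ i, fluxForm_smul_right]
    field_simp

end IsHorizonGraph

/-! ### The flux through large spheres -/

lemma pd_sub_norm_sq {n : ℕ} (c : ℝ) (i : Fin n) (x : H n) :
    pd i (fun y => c - ‖y‖ ^ 2) x = -2 * x i := by
  have h : HasFDerivAt (fun y : H n => c - ‖y‖ ^ 2) (-(2 • innerSL ℝ x)) x :=
    (hasStrictFDerivAt_norm_sq x).hasFDerivAt.const_sub c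
  rw [pd, h.fderiv]
  simp [EuclideanSpace.inner_single_right]

/-- At the outer sphere Z is regular, and the same formalism applies with ρ = φ = S² - |x|², β = dφ
and trivial proportionality factors. The inward normal accounts for the sign in K. -/
lemma isBoundaryChart_sphere {n : ℕ} {W O : Set (H n)} {Z : H n → H n} {F K : H n → ℝ} {S : ℝ}
    (hS : 0 < S) (hO : IsOpen O) (hW : ∀ x ∈ O, x ∈ W ↔ ‖x‖ < S)
    (hfr : ∀ x ∈ O, x ∈ frontier W ↔ ‖x‖ = S) (hZ : ContinuousOn Z O)
    (hF : ∀ x ∈ O, F x = (S ^ 2 - ‖x‖ ^ 2) ^ 2)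
    (hK : ∀ x ∈ O, K x = - ∑ i, (x i / ‖x‖) * Z x i) :
    IsBoundaryChart W Z F K O (fun x => S ^ 2 - ‖x‖ ^ 2) (fun x => S ^ 2 - ‖x‖ ^ 2)
      (fun x => ∑ i, -2 * x i * Z x i) (fun x i => -2 * x i) := by
  have hc : ContDiff ℝ 1 fun x : H n => S ^ 2 - ‖x‖ ^ 2 := contDiff_const.sub (contDiff_norm_sq ℝ)
  have hx : ∀ i, Continuous fun x : H n => -2 * x i := fun i =>
    continuous_const.mul (contDiff_coord i).continuous
  have hZi : ∀ i, ContinuousOn (fun x => Z x i) O := fun i =>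
    (contDiff_coord i).continuous.comp_continuousOn hZ
  refine
    { isOpen := hO
      contDiffAt := fun x _ => hc.contDiffAt
      fderiv_ne := fun x hxO hxW h0 => ?_
      mem_iff := fun x hxO => ?_
      frontier_iff := fun x hxO => ?_
      continuousOn_φ := hc.continuous.continuousOn
      continuousOn_h := continuousOn_finsetSum _ fun i _ =>
        (hx i).continuousOn.mul ((hZi i).mono inter_subset_right)
      continuousOn_β := fun i => (hx i).continuousOn
      φ_eq_zero := fun x hxO hxW => by rw [(hfr x hxO).1 hxW, sub_self]
      F_eq := fun x hxO _ => hF x hxO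
      contDiffAt_φ := fun x _ _ => hc.contDiffAt
      interior := fun x hxO _ => ⟨1, one_ne_zero, fun i => by rw [pd_sub_norm_sq, one_mul], by
        simp_rw [pd_sub_norm_sq, one_mul]⟩
      boundary := fun x hxO hxW => ⟨1, one_ne_zero, fun i => by rw [pd_sub_norm_sq, one_mul], ?_⟩ }
  · have h1 : x = 0 := by
      ext i
      have := pd_sub_norm_sq (S ^ 2) i x
      rw [pd, h0] at this
      simpa using this
    have := (hfr x hxO).1 hxW
    rw [h1, norm_zero] at this
    exact hS.ne this
  · rw [hW x hxO, sub_pos, sq_lt_sq₀ (norm_nonneg x) hS.le]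
  · rw [hfr x hxO, sub_eq_zero, eq_comm, sq_eq_sq₀ hS.le (norm_nonneg x)]
  · have hnx : ‖x‖ ≠ 0 := by rw [(hfr x hxO).1 hxW]; exact hS.ne'
    have h1 : √(∑ i, pd i (fun x => S ^ 2 - ‖x‖ ^ 2) x ^ 2) = 2 * ‖x‖ := by
      simp_rw [pd_sub_norm_sq, mul_pow]
      rw [← Finset.mul_sum, show ∑ i, x i ^ 2 = ‖x‖ ^ 2 by
        rw [EuclideanSpace.norm_sq_eq]; simp, ← mul_pow, sqrt_sq_eq_abs, abs_mul, abs_norm]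
      simp
    rw [h1, hK x hxO, mul_neg, Finset.mul_sum, ← Finset.sum_neg_distrib]
    refine Finset.sum_congr rfl fun i _ => ?_
    field_simp

lemma setOf_hypRadius_eq {n : ℕ} (R : ℝ) :
    {x : H n | hypRadius x = R} = Metric.sphere 0 (sinh R) := by
  ext x
  rw [mem_sphere_zero_iff_norm, ← arsinh_inj (y := sinh R), arsinh_sinh]
  rfl

lemma frontier_inter_ball {n : ℕ} {U : Set (H n)} (hU : IsOpen U) {S : ℝ} (hS : 0 < S)
    (h : ∀ x, x ∉ U → ‖x‖ < S) (h' : ∀ x ∈ frontier U, ‖x‖ < S) :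
    frontier (U ∩ Metric.ball 0 S) = frontier U ∪ Metric.sphere 0 S := by
  ext x
  by_cases hx : ‖x‖ < S
  · have hb : x ∈ Metric.ball (0 : H n) S := mem_ball_zero_iff.2 hx
    have := Set.ext_iff.1 (frontier_inter_open_inter (s := U) (t := Metric.ball (0 : H n) S)
      Metric.isOpen_ball) x
    simp only [mem_inter_iff, hb, and_true] at this
    rw [this, mem_union, mem_sphere_zero_iff_norm]
    exact ⟨Or.inl, fun h => h.resolve_right hx.ne⟩
  · have hxU : x ∈ U := by by_contra h0; exact hx (h x h0)
    have := Set.ext_iff.1 (frontier_inter_open_inter (s := Metric.ball (0 : H n) S) (t := U) hU) x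
    simp only [mem_inter_iff, hxU, and_true] at this
    rw [inter_comm, this, frontier_ball _ hS.ne', mem_union]
    exact ⟨Or.inr, fun h => h.resolve_left fun h0 => hx (h' x h0)⟩

lemma continuousAt_horizonFlux {n : ℕ} {ρ : H n → ℝ} (hρ : ContDiff ℝ ∞ ρ) {x : H n}
    (hx : fderiv ℝ ρ x ≠ 0) (k : ℕ) : ContinuousAt (horizonFlux ρ k) x := by
  have hp : ∀ i, ContDiffAt ℝ ∞ (pd i ρ) x := fun i => contDiffAt_pd_top i hρ.contDiffAt
  have hpos : √(∑ i, pd i ρ x ^ 2) ≠ 0 := by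
    obtain ⟨i, hi⟩ := Function.ne_iff.1 (pd_ne_zero_of_fderiv_ne_zero hx)
    exact (sqrt_pos.2 (Finset.sum_pos' (fun j _ => sq_nonneg (pd j ρ x))
      ⟨i, Finset.mem_univ i, sq_pos_of_ne_zero hi⟩)).ne'
  refine ContinuousAt.div (contDiffAt_fluxForm (m := ∞) (fun i j => ?_)
    (fun i => contDiffAt_unitNormal hρ.contDiffAt hx i) hp).continuousAt
    (Real.continuous_sqrt.continuousAt.comp (tendsto_finsetSum _ fun i _ =>
      (hp i).continuousAt.tendsto.pow 2)) hpos
  exact contDiffAt_pd_top i (contDiffAt_unitNormal hρ.contDiffAt hx j)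

section Flux

variable {m k : ℕ} {ρ f : H (m + 1) → ℝ} {Ω : Set (H (m + 1))}

/-- The mass flux through a large sphere, by the divergence theorem. -/
theorem massFlux_eq (hk : 1 ≤ k) (hΩ : Bornology.IsBounded Ω) (hρ : IsDefiningFunction ρ Ω)
    (hf : IsHorizonGraph Ω f)
    (hint : IntegrableOn (modGaussBonnet (graphMetric f) k) (closure Ω)ᶜ) {S' R : ℝ}
    (hS' : 0 < S') (hΩS : closure Ω ⊆ Metric.ball 0 S') (hR : S' < sinh R) :
    IntegrableOn (horizonFlux ρ k) (frontier Ω) (μHE[m] : Measure (H (m + 1))) ∧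
    massFlux (graphMetric f) k V R =
      (1 / 2) * (∫ x in (closure Ω)ᶜ ∩ Metric.ball 0 (sinh R), modGaussBonnet (graphMetric f) k x) +
        ∫ x in frontier Ω, horizonFlux ρ k x ∂(μHE[m] : Measure (H (m + 1))) := by
  set S := sinh R with hS
  have hSpos : 0 < S := hS'.trans hR
  set U := (closure Ω)ᶜ with hU
  have hUo : IsOpen U := isClosed_closure.isOpen_compl
  set W := U ∩ Metric.ball (0 : H (m + 1)) S with hWdef
  have hWo : IsOpen W := hUo.inter Metric.isOpen_ball
  have hmemU : ∀ x : H (m + 1), S' ≤ ‖x‖ → x ∈ U := fun x hx hxc =>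
    (mem_ball_zero_iff.1 (hΩS hxc)).not_ge hx
  have hfrU : frontier U = frontier Ω := hρ.frontier_compl_closure_eq
  have hfrS : ∀ x ∈ frontier Ω, ‖x‖ < S' := fun x hx =>
    mem_ball_zero_iff.1 (hΩS (frontier_subset_closure hx))
  have hfrW : frontier W = frontier Ω ∪ Metric.sphere 0 S := by
    rw [← hfrU]
    refine frontier_inter_ball hUo hSpos (fun x hx => ?_) fun x hx => ?_
    · by_contra h0
      exact hx (hmemU x (hR.le.trans (not_lt.1 h0)))
    · exact (hfrS x (hfrU ▸ hx)).trans hR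
  have hZ : ∀ x ∈ U, ContDiffAt ℝ ∞ (gbcField f k) x := fun x hx =>
    contDiffAt_gbcField (hf.contDiffAt hx) k
  set J : H (m + 1) → ℝ := fun x => - ∑ i, (x i / ‖x‖) * gbcField f k x i with hJ
  have hJc : ∀ x, x ≠ 0 → x ∈ U → ContinuousAt J x := fun x hx0 hx =>
    (tendsto_finsetSum _ fun i _ => (((contDiff_coord i).continuous.tendsto x).div
      (continuous_norm.tendsto x) (norm_ne_zero_iff.2 hx0)).mul
      (((contDiff_coord i).continuous.tendsto _).comp (hZ x hx).continuousAt.tendsto)).neg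
  -- The sphere of radius S' separates Σ from the outer sphere. The jump of F and K there is
  -- harmless, because they are only used near the boundary.
  set F : H (m + 1) → ℝ := fun x => if ‖x‖ < S' then Metric.infDist (f x) (f '' frontier Ω) ^ 2
    else (S ^ 2 - ‖x‖ ^ 2) ^ 2 with hF
  set K : H (m + 1) → ℝ := fun x => if ‖x‖ < S' then horizonFlux ρ k x else J x with hK
  have hin : ∀ x : H (m + 1), ‖x‖ < S' → ∀ᶠ y in 𝓝 x, ‖y‖ < S' := fun x hx =>
    continuous_norm.continuousAt.eventually_lt continuousAt_const hx
  have hout : ∀ x : H (m + 1), S' < ‖x‖ → ∀ᶠ y in 𝓝 x, ¬ ‖y‖ < S' := fun x hx =>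
    (continuousAt_const.eventually_lt continuous_norm.continuousAt hx).mono fun y hy => hy.le.not_gt
  have hKc : ContinuousOn K (frontier W) := by
    intro x hx
    refine ContinuousAt.continuousWithinAt ?_
    rw [hfrW] at hx
    rcases hx with hx | hx
    · have hx0 : ρ x = 0 := by rwa [hρ.frontier_eq] at hx
      exact (continuousAt_horizonFlux hρ.smooth (hρ.regular x hx0) k).congr
        ((hin x (hfrS x hx)).mono fun y hy => (if_pos hy).symm)
    · have hx1 : ‖x‖ = S := mem_sphere_zero_iff_norm.1 hx
      exact (hJc x (norm_ne_zero_iff.1 (hx1 ▸ hSpos.ne')) (hmemU x (hx1 ▸ hR.le))).congr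
        ((hout x (hx1 ▸ hR)).mono fun y hy => (if_neg hy).symm)
  have hcharts : ∀ p ∈ frontier W, ∃ O ρ φ h β, p ∈ O ∧
      IsBoundaryChart W (gbcField f k) F K O ρ φ h β := by
    intro p hp
    rw [hfrW] at hp
    rcases hp with hp | hp
    · exact hf.exists_isBoundaryChart hk hΩ hρ hp Metric.isOpen_ball
        (mem_ball_zero_iff.2 ((hfrS p hp).trans hR))
        ((hin p (hfrS p hp)).mono fun y hy => if_pos hy)
        ((hin p (hfrS p hp)).mono fun y hy => if_pos hy)
    · have hp1 : ‖p‖ = S := mem_sphere_zero_iff_norm.1 hp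
      refine ⟨{x | S' < ‖x‖}, _, _, _, _, ?_, isBoundaryChart_sphere hSpos
        (isOpen_lt continuous_const continuous_norm) (fun x hx => ?_) (fun x hx => ?_)
        (fun x hx => ?_) (fun x hx => if_neg (le_of_lt hx).not_gt)
        (fun x hx => if_neg (le_of_lt hx).not_gt)⟩
      · exact hR.trans_eq hp1.symm
      · rw [hWdef, mem_inter_iff, mem_ball_zero_iff]
        exact and_iff_right (hmemU x (le_of_lt hx))
      · rw [hfrW, mem_union, mem_sphere_zero_iff_norm]
        exact or_iff_right fun h0 => (hfrS x h0).not_gt hx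
      · exact (hZ x (hmemU x (le_of_lt hx))).continuousAt.continuousWithinAt
  have hdiveq : ∀ x ∈ W, ∑ i, pd i (fun y => gbcField f k y i) x =
      (1 / 2) * modGaussBonnet (graphMetric f) k x := fun x hx =>
    sum_pd_gbcField_eq_modGaussBonnet (hf.eventually_contDiffAt hx.1) hk
  have hdiv : IntegrableOn (fun x => ∑ i, pd i (fun y => gbcField f k y i) x) W :=
    IntegrableOn.congr_fun ((hint.mono_set inter_subset_left).const_mul (1 / 2))
      (fun x hx => (hdiveq x hx).symm) hWo.measurableSet
  obtain ⟨hKi, hmain⟩ := integral_divergence_eq hWo (Metric.isBounded_ball.subset inter_subset_right)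
    (fun x hx => (hZ x hx.1).of_le (by simp)) hKc hcharts hdiv
  rw [hfrW] at hKi hmain
  have hKb : ∀ x ∈ frontier Ω, K x = horizonFlux ρ k x := fun x hx => if_pos (hfrS x hx)
  have hKS : ∀ x ∈ Metric.sphere (0 : H (m + 1)) S, K x = J x := fun x hx =>
    if_neg (by rw [mem_sphere_zero_iff_norm.1 hx]; exact hR.le.not_gt)
  have hdisj : Disjoint (frontier Ω) (Metric.sphere (0 : H (m + 1)) S) := by
    refine disjoint_left.2 fun x hx hxS => ?_
    have := hfrS x hx
    rw [mem_sphere_zero_iff_norm.1 hxS] at this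
    exact hR.not_gt this
  have hmS : MeasurableSet (Metric.sphere (0 : H (m + 1)) S) := Metric.isClosed_sphere.measurableSet
  have hmb : MeasurableSet (frontier Ω) := isClosed_frontier.measurableSet
  refine ⟨(hKi.mono_set subset_union_left).congr_fun hKb hmb, ?_⟩
  rw [setIntegral_union hdisj hmS (hKi.mono_set subset_union_left)
    (hKi.mono_set subset_union_right), setIntegral_congr_fun hmb hKb,
    setIntegral_congr_fun hmS hKS, setIntegral_congr_fun hWo.measurableSet hdiveq,
    integral_const_mul] at hmain
  -- J is the inward flux density, hence the minus sign.
  have hflux : massFlux (graphMetric f) k V R =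
      - ∫ x in Metric.sphere 0 S, J x ∂(μHE[m] : Measure (H (m + 1))) := by
    rw [massFlux, surfaceIntegral, setOf_hypRadius_eq, ← integral_neg]
    refine setIntegral_congr_fun hmS fun x hx => ?_
    have hx1 : ‖x‖ = S := mem_sphere_zero_iff_norm.1 hx
    have hxU : x ∈ U := hmemU x (hx1 ▸ hR.le)
    simp only [hJ, neg_neg]
    exact massIntegrand_mul_areaDensity (hf.eventually_contDiffAt hxU) hk
      (norm_ne_zero_iff.1 (hx1 ▸ hSpos.ne'))
  rw [hflux]
  linarith

end Flux

/-! ### Convergence of the integrals -/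

lemma V_mul_sqrt_det_graphMetric {n : ℕ} (f : H n → ℝ) (x : H n) :
    V x * √(graphMetric f x).det = √(1 + V x ^ 2 * gradSq (hypMetric n) f x) := by
  have hV := V_pos x
  have h : V x = √(V x ^ 2) := (sqrt_sq hV.le).symm
  nth_rewrite 1 [h]
  rw [det_graphMetric, ← V_sq_eq, ← sqrt_mul (sq_nonneg _)]
  congr 1
  field_simp

lemma one_le_sqrt_one_add_gradSq {n : ℕ} (f : H n → ℝ) (x : H n) :
    1 ≤ √(1 + V x ^ 2 * gradSq (hypMetric n) f x) := by
  rw [one_le_sqrt, gradSq_hypMetric]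
  have := coNormSq_nonneg x fun i => pd i f x
  have : 0 ≤ V x ^ 2 * coNormSq x fun i => pd i f x := by positivity
  linarith

/-- Continuity is read off from the divergence formula, the flux field being smooth where f is. -/
lemma continuousOn_modGaussBonnet {n k : ℕ} (hk : 1 ≤ k) {f : H n → ℝ} {U : Set (H n)}
    (hU : IsOpen U) (hf : ContDiffOn ℝ ∞ f U) :
    ContinuousOn (modGaussBonnet (graphMetric f) k) U := by
  intro x hx
  have hev : ∀ y ∈ U, ∀ᶠ z in 𝓝 y, ContDiffAt ℝ ∞ f z := fun y hy => by
    filter_upwards [hU.mem_nhds hy] with z hz using hf.contDiffAt (hU.mem_nhds hz)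
  have h1 : ContinuousAt (fun y => 2 * ∑ i, pd i (fun y => gbcField f k y i) y) x :=
    (tendsto_finsetSum _ fun i _ => (contDiffAt_pd_top i
      ((contDiff_coord i).contDiffAt.comp x
        (contDiffAt_gbcField (hf.contDiffAt (hU.mem_nhds hx)) k))).continuousAt.tendsto).const_mul 2
  refine (h1.congr ?_).continuousWithinAt
  filter_upwards [hU.mem_nhds hx] with y hy
  rw [sum_pd_gbcField_eq_modGaussBonnet (hev y hy) hk]
  ring

/-- The weight V √det g = √(1 + V²|∇̄f|²) is at least 1, so L̃_k dx is dominated by V L̃_k dV_g. -/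
lemma integrableOn_modGaussBonnet {n k : ℕ} (hk : 1 ≤ k) {f : H n → ℝ} {U : Set (H n)}
    (hU : IsOpen U) (hf : ContDiffOn ℝ ∞ f U)
    (h : VolumeIntegrable (graphMetric f) U fun x => V x * modGaussBonnet (graphMetric f) k x) :
    IntegrableOn (modGaussBonnet (graphMetric f) k) U := by
  refine Integrable.mono h ((continuousOn_modGaussBonnet hk hU hf).aestronglyMeasurable
    hU.measurableSet) (Eventually.of_forall fun x => ?_)
  have : V x * modGaussBonnet (graphMetric f) k x * √(graphMetric f x).det =
      modGaussBonnet (graphMetric f) k x * √(1 + V x ^ 2 * gradSq (hypMetric n) f x) := by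
    rw [← V_mul_sqrt_det_graphMetric]; ring
  rw [this, norm_mul]
  refine le_mul_of_one_le_right (norm_nonneg _) ?_
  rw [Real.norm_of_nonneg (sqrt_nonneg _)]
  exact one_le_sqrt_one_add_gradSq f x

lemma mul_sqrt_det_graphMetric {n : ℕ} (f : H n → ℝ) (L : ℝ) (x : H n) :
    V x * L / √(1 + V x ^ 2 * gradSq (hypMetric n) f x) * √(graphMetric f x).det = L := by
  have h := one_le_sqrt_one_add_gradSq f x
  rw [div_mul_eq_mul_div, div_eq_iff (by positivity), ← V_mul_sqrt_det_graphMetric]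
  ring

/-! ### The static potential `cosh r` -/

lemma hess_V {n : ℕ} (x : H n) (i j : Fin n) :
    hess (hypMetric n) V x i j = V x * hypMetric n x i j := by
  have hV := (V_pos x).ne'
  have h1 : pd i (pd j V) x = (if i = j then 1 else 0) / V x - x i * x j / V x ^ 3 := by
    have hVd : DifferentiableAt ℝ (V : H n → ℝ) x := (hasFDerivAt_V x).differentiableAt
    have e : pd j (V : H n → ℝ) = fun y => y j * (V y)⁻¹ := by
      ext y; rw [pd_V, div_eq_mul_inv]
    have hVi : DifferentiableAt ℝ (fun y : H n => (V y)⁻¹) x := hVd.inv hV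
    rw [e, pd_mul i (coord_differentiableAt j) hVi, pd_coord,
      pd_comp i (hasDerivAt_inv hV) hVd, pd_V]
    field_simp
    ring
  have h2 : ∑ l, christoffel (hypMetric n) l i j x * pd l V x =
      -(hypMetric n x i j * ‖x‖ ^ 2 / V x) := by
    rw [EuclideanSpace.norm_sq_eq, Finset.mul_sum, Finset.sum_div, ← Finset.sum_neg_distrib]
    refine Finset.sum_congr rfl fun l _ => ?_
    rw [christoffel_hypMetric, pd_V, Real.norm_eq_abs, sq_abs]
    ring
  rw [hess, h1, h2, hypMetric_apply, ← V_sq_eq, show ‖x‖ ^ 2 = V x ^ 2 - 1 by linarith [V_sq x]]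
  field_simp
  ring

lemma V_mem_Nb1 (n : ℕ) : (V : H n → ℝ) ∈ Nb1 n :=
  ⟨⟨contDiff_V, hess_V⟩, V_pos, eta_V_V⟩

lemma gbcMass_eq_of_isLeast {n k : ℕ} {g : MetricField n}
    (h : ∀ W ∈ Nb1 n, massFunctional g k V ≤ massFunctional g k W) :
    gbcMass g k = massConst n k * massFunctional g k V := by
  rw [gbcMass]
  congr 1
  exact IsLeast.csInf_eq ⟨mem_image_of_mem _ (V_mem_Nb1 n), by rintro _ ⟨W, hW, rfl⟩; exact h W hW⟩

end

end GBCMass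

/-! ### The mass formula -/

theorem theorem1p4 {n k : ℕ} (hk : 2 ≤ k) (hkn : 2 * k < n)
    {τ : ℝ} (hτ : (n : ℝ) / (k + 1) < τ)
    (Ω : Set (H n)) (hΩ : Bornology.IsBounded Ω)
    (ρ : H n → ℝ) (hρ : IsDefiningFunction ρ Ω)
    (f : H n → ℝ) (hf : IsHorizonGraph Ω f)
    (hAH : IsAsymptoticallyHyperbolic (graphMetric f) τ)
    (hint : VolumeIntegrable (graphMetric f) Ωᶜ
      (fun x => V x * modGaussBonnet (graphMetric f) k x)) :
    -- the limit defining the mass functional at `V = cosh r` exists,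
    Tendsto (massFlux (graphMetric f) k V) atTop (𝓝 (massFunctional (graphMetric f) k V)) ∧
    -- the two integrals converge,
    VolumeIntegrable (graphMetric f) Ωᶜ
      (fun x => V x * modGaussBonnet (graphMetric f) k x /
        √(1 + V x ^ 2 * gradSq (hypMetric n) f x)) ∧
    SurfaceIntegrable (hypMetric n) ρ (frontier Ω)
      (fun x => V x * meanCurv (hypMetric n) ρ (2 * k - 1) x) ∧
    -- the formula for `c(n,k) H_k(V)`,
    massConst n k * massFunctional (graphMetric f) k V =
      massConst n k *
        ((1 / 2) * volumeIntegral (graphMetric f) Ωᶜ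
          (fun x => V x * modGaussBonnet (graphMetric f) k x /
            √(1 + V x ^ 2 * gradSq (hypMetric n) f x)) +
        ((2 * k - 1).factorial : ℝ) / 2 * surfaceIntegral (hypMetric n) ρ (frontier Ω)
          (fun x => V x * meanCurv (hypMetric n) ρ (2 * k - 1) x)) ∧
    -- and for the mass, when the infimum in its definition is achieved by `V`
    ((∀ W ∈ Nb1 n, massFunctional (graphMetric f) k V ≤ massFunctional (graphMetric f) k W) →
      gbcMass (graphMetric f) k =
        massConst n k *
          ((1 / 2) * volumeIntegral (graphMetric f) Ωᶜ
            (fun x => V x * modGaussBonnet (graphMetric f) k x /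
              √(1 + V x ^ 2 * gradSq (hypMetric n) f x)) +
          ((2 * k - 1).factorial : ℝ) / 2 * surfaceIntegral (hypMetric n) ρ (frontier Ω)
            (fun x => V x * meanCurv (hypMetric n) ρ (2 * k - 1) x))) := by
  obtain ⟨m, rfl⟩ : ∃ m, n = m + 1 := ⟨n - 1, by omega⟩
  have hk1 : 1 ≤ k := by omega
  have hUo : IsOpen (closure Ω)ᶜ := isClosed_closure.isOpen_compl
  -- The statement integrates over the complement of Ω, the divergence theorem over the open
  -- complement of its closure; Σ is a null set.
  have hae : (Ωᶜ : Set (H (m + 1))) =ᵐ[volume] ((closure Ω)ᶜ : Set (H (m + 1))) :=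
    (closure_ae_eq_of_null_frontier hρ.measure_frontier).symm.compl
  have hL : IntegrableOn (modGaussBonnet (graphMetric f) k) (closure Ω)ᶜ :=
    integrableOn_modGaussBonnet hk1 hUo hf.smooth (hint.congr_set_ae hae.symm)
  have hLc : IntegrableOn (modGaussBonnet (graphMetric f) k) Ωᶜ := hL.congr_set_ae hae
  obtain ⟨S', hS', hΩS⟩ := hΩ.closure.subset_ball_lt 0 0
  have hsinh : Tendsto sinh atTop atTop := sinhOrderIso.tendsto_atTop
  obtain ⟨R₀, hR₀⟩ := (hsinh.eventually_gt_atTop S').exists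
  have hflux := (massFlux_eq hk1 hΩ hρ hf hL hS' hΩS hR₀).1
  have hUball : ⋃ R : ℝ, (closure Ω)ᶜ ∩ Metric.ball (0 : H (m + 1)) (sinh R) = (closure Ω)ᶜ := by
    rw [← inter_iUnion, inter_eq_left]
    intro x _
    obtain ⟨R, hR⟩ := (hsinh.eventually_gt_atTop ‖x‖).exists
    exact mem_iUnion.2 ⟨R, mem_ball_zero_iff.2 hR⟩
  -- The flux identity is exact for every large R, so its limit exists as soon as the volume
  -- integrals over the exhausting balls of radius sinh R converge.
  have hlimL := tendsto_setIntegral_of_monotone (μ := volume)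
    (s := fun R : ℝ => (closure Ω)ᶜ ∩ Metric.ball (0 : H (m + 1)) (sinh R))
    (fun R => hUo.measurableSet.inter Metric.isOpen_ball.measurableSet)
    (fun R R' h => inter_subset_inter_right _ (Metric.ball_subset_ball (sinh_le_sinh.2 h)))
    (hUball.symm ▸ hL)
  rw [hUball, ← setIntegral_congr_set hae] at hlimL
  have hlim := ((hlimL.const_mul (1 / 2)).add_const
    (∫ x in frontier Ω, horizonFlux ρ k x ∂(μHE[m] : Measure (H (m + 1))))).congr' <| by
      filter_upwards [hsinh.eventually_gt_atTop S'] with R hR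
      exact (massFlux_eq hk1 hΩ hρ hf hL hS' hΩS hR).2.symm
  have hvol : (fun x => V x * modGaussBonnet (graphMetric f) k x /
      √(1 + V x ^ 2 * gradSq (hypMetric (m + 1)) f x) * √(graphMetric f x).det) =
      modGaussBonnet (graphMetric f) k := funext fun x => mul_sqrt_det_graphMetric f _ x
  have hfact : ((2 * k - 1).factorial : ℝ) / 2 ≠ 0 := by positivity
  have hsurf : ∀ x ∈ frontier Ω, ((2 * k - 1).factorial : ℝ) / 2 *
      (V x * meanCurv (hypMetric (m + 1)) ρ (2 * k - 1) x *
        areaDensity (hypMetric (m + 1)) ρ x) = horizonFlux ρ k x := fun x hx =>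
    meanCurv_mul_areaDensity hρ.smooth.contDiffAt
      (hρ.regular x (by rwa [hρ.frontier_eq] at hx)) hk1 (by omega)
  have hmb : MeasurableSet (frontier Ω) := isClosed_frontier.measurableSet
  have hmass : massFunctional (graphMetric f) k V = (1 / 2) * volumeIntegral (graphMetric f) Ωᶜ
      (fun x => V x * modGaussBonnet (graphMetric f) k x /
        √(1 + V x ^ 2 * gradSq (hypMetric (m + 1)) f x)) +
      ((2 * k - 1).factorial : ℝ) / 2 * surfaceIntegral (hypMetric (m + 1)) ρ (frontier Ω)
        (fun x => V x * meanCurv (hypMetric (m + 1)) ρ (2 * k - 1) x) := by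
    rw [massFunctional, hlim.limUnder_eq, volumeIntegral, hvol]
    congr 1
    exact (setIntegral_congr_fun hmb hsurf).symm.trans (integral_const_mul _ _)
  refine ⟨?_, ?_, ?_, by rw [hmass], fun h => by rw [gbcMass_eq_of_isLeast h, hmass]⟩
  · rw [massFunctional, hlim.limUnder_eq]
    exact hlim
  · rw [VolumeIntegrable, hvol]
    exact hLc
  · refine IntegrableOn.congr_fun (hflux.const_mul (((2 * k - 1).factorial : ℝ) / 2)⁻¹)
      (fun x hx => ?_) hmb
    simp only [← hsurf x hx]
    rw [inv_mul_cancel_left₀ hfact]
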